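/- Let $\theta_{12},\theta_{34}$ be nonzero real numbers, and on $L^2(\mathbb{R}^2)$, in the variables $(x_1,x_3)$, let $\hat x_1=x_1$, $\hat x_2=-i\theta_{12}\,\partial/\partial x_1$, $\hat x_3=x_3$, $\hat x_4=-i\theta_{34}\,\partial/\partial x_3$, so that for $k\in\mathbb{R}^4$ $$[e^{ik\cdot\hat x}\psi](x_1,x_3)=e^{i(k_1k_2\theta_{12}+k_3k_4\theta_{34})/2}\,e^{i(k_1x_1+k_3x_3)}\,\psi(x_1+\theta_{12}k_2,\;x_3+\theta_{34}k_4).$$ For a function $f:\mathbb{R}^4\to\mathbb{C}$ let $$\hat{\mathcal W}[f]=\int_{\mathbb{R}^4} f(x)\,\hat\Delta(x)\,d^4x,\qquad \hat\Delta(x)=\frac1{(2\pi)^4}\int_{\mathbb{R}^4}e^{ik\cdot\hat x}\,e^{-ik\cdot x}\,d^4k,$$ be its Weyl quantization, the integrals being understood weakly: $\hat{\mathcal W}[f]$ is the bounded operator $T$ on $L^2(\mathbb{R}^2)$ such that, for all Schwartz functions $\varphi,\psi$ on $\mathbb{R}^2$, $\langle\varphi,T\psi\rangle=\int f(x)\,\langle\varphi,\hat\Delta(x)\psi\rangle\,d^4x$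 with an absolutely convergent integral, where $\langle\varphi,\hat\Delta(x)\psi\rangle=(2\pi)^{-4}\int\langle\varphi,e^{ik\cdot\hat x}\psi\rangle e^{-ik\cdot x}\,d^4k$. Consider the following classes of complex-valued functions on $\mathbb{R}^4$: * the Schwartz space $\mathcal S(\mathbb{R}^4)$; * for real $m<0$ and $0<\rho\le1$, the class $\Gamma^m_\rho(\mathbb{R}^4)$ of all $f\in C^\infty(\mathbb{R}^4)$ such that for every multi-index $\alpha\in\mathbb{N}_0^4$ there is a constant $C_\alpha$ with $|\partial_\alpha f(x)|\le C_\alpha(1+|x|^2)^{(m-\rho|\alpha|)/2}$ for all $x$; * the class $\mathcal K^\infty(\mathbb{R}^4)$ of all $f\in C^\infty(\mathbb{R}^4)$ with $\lim_{|x|\to\infty}|\partial_\alpha f(x)|=0$ for every multi-index $\alpha\in\mathbb{N}_0^4$. Then for each of these classes $\mathcal F$ (for every admissible $m,\rho$ in the second case), the operator $\hat{\mathcal W}[f]$ exists and is unique for every $f\in\mathcal F$, and $\hat{\mathcal W}[\mathcal F]=\{\hat{\mathcal W}[f] : f\in\mathcal F\}$ is a (not necessarily unital) complex subalgebra of the algebra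 $\mathcal K$ of compact operators on $L^2(\mathbb{R}^2)$ that is dense in $\mathcal K$ in the operator norm. -/

import Mathlib

open MeasureTheory Filter Topology
open scoped ContDiff SchwartzMap InnerProductSpace

noncomputable section

namespace WeylQuantization

/-- The space `ℝ⁴` of symbols' arguments; `x 0, x 1, x 2, x 3` are `x₁, x₂, x₃, x₄`. -/
abbrev R4 := EuclideanSpace ℝ (Fin 4)

/-- The configuration space `ℝ²`; for `u : R2`, `u 0` is `x₁` and `u 1` is `x₃`. -/
abbrev R2 := EuclideanSpace ℝ (Fin 2)

/-- The Hilbert space `L²(ℝ²)`. -/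
abbrev L2 := Lp ℂ 2 (volume : Measure R2)

/-! ### The coordinate operators and their exponentials -/

/-- The coordinate operators: `x̂₁`, `x̂₃` are multiplication by `x₁`, `x₃`, and
`x̂₂ = -i θ₁₂ ∂/∂x₁`, `x̂₄ = -i θ₃₄ ∂/∂x₃`. -/
def xHat (θ₁₂ θ₃₄ : ℝ) (j : Fin 4) (ψ : R2 → ℂ) (u : R2) : ℂ :=
  match j with
  | 0 => (u 0 : ℂ) * ψ u
  | 1 => -Complex.I * θ₁₂ * fderiv ℝ ψ u (EuclideanSpace.single 0 1)
  | 2 => (u 1 : ℂ) * ψ u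
  | 3 => -Complex.I * θ₃₄ * fderiv ℝ ψ u (EuclideanSpace.single 1 1)

/-- The unitary operator `exp (i ∑ⱼ kⱼ x̂ⱼ)`, in its explicit form
`ψ(x₁, x₃) ↦ exp(i(k₁k₂θ₁₂ + k₃k₄θ₃₄)/2) exp(i(k₁x₁ + k₃x₃)) ψ(x₁ + θ₁₂k₂, x₃ + θ₃₄k₄)`.
That this is the exponential is `expXHat_zero` and `hasDerivAt_expXHat` below. -/
def expXHat (θ₁₂ θ₃₄ : ℝ) (k : R4) (ψ : R2 → ℂ) (u : R2) : ℂ :=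
  Complex.exp (Complex.I * ((k 0 * k 1 * θ₁₂ + k 2 * k 3 * θ₃₄) / 2 : ℝ)) *
    Complex.exp (Complex.I * (k 0 * u 0 + k 2 * u 1 : ℝ)) *
      ψ (u + !₂[θ₁₂ * k 1, θ₃₄ * k 3])

theorem expXHat_zero (θ₁₂ θ₃₄ : ℝ) (ψ : R2 → ℂ) : expXHat θ₁₂ θ₃₄ 0 ψ = ψ := by
  funext u
  have h : (!₂[(0 : ℝ), 0] : R2) = 0 := by
    ext i; fin_cases i <;> rfl
  simp [expXHat, h]

/-- `d/dt exp(i t k·x̂) ψ = i (k·x̂) exp(i t k·x̂) ψ`. -/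
theorem hasDerivAt_expXHat (θ₁₂ θ₃₄ : ℝ) (k : R4) (ψ : R2 → ℂ) (hψ : Differentiable ℝ ψ)
    (u : R2) (t : ℝ) :
    HasDerivAt (fun s : ℝ => expXHat θ₁₂ θ₃₄ (s • k) ψ u)
      (Complex.I * ∑ j, (k j : ℂ) * xHat θ₁₂ θ₃₄ j (expXHat θ₁₂ θ₃₄ (t • k) ψ) u) t := by
  set w : R2 := !₂[θ₁₂ * k 1, θ₃₄ * k 3] with hw
  have hshift : ∀ s : ℝ, (!₂[θ₁₂ * (s * k 1), θ₃₄ * (s * k 3)] : R2) = s • w := by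
    intro s; ext i; fin_cases i <;> simp [hw] <;> ring
  have hwb : w = (θ₁₂ * k 1) • EuclideanSpace.single 0 1 +
      (θ₃₄ * k 3) • EuclideanSpace.single 1 1 := by
    ext i; fin_cases i <;> simp [hw]
  set c : ℝ → ℂ := fun s => Complex.exp (Complex.I *
    (((s * k 0) * (s * k 1) * θ₁₂ + (s * k 2) * (s * k 3) * θ₃₄) / 2 : ℝ)) with hc
  set e : ℝ → R2 → ℂ := fun s v => Complex.exp (Complex.I *
    ((s * k 0) * v 0 + (s * k 2) * v 1 : ℝ)) with he
  have hE : ∀ s : ℝ, expXHat θ₁₂ θ₃₄ (s • k) ψ = fun v => c s * e s v * ψ (v + s • w) := by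
    intro s; funext v
    simp [expXHat, hc, he, hshift]
  have hfd : ∀ d : R2, fderiv ℝ (expXHat θ₁₂ θ₃₄ (t • k) ψ) u d =
      Complex.I * ((t * k 0) * d 0 + (t * k 2) * d 1 : ℝ) * (c t * e t u * ψ (u + t • w)) +
        c t * e t u * fderiv ℝ ψ (u + t • w) d := by
    intro d
    have hlin : HasFDerivAt (fun v : R2 => (t * k 0) * v 0 + (t * k 2) * v 1)
        ((t * k 0) • (EuclideanSpace.proj (𝕜 := ℝ) : Fin 2 → R2 →L[ℝ] ℝ) 0 +
          (t * k 2) • (EuclideanSpace.proj (𝕜 := ℝ) : Fin 2 → R2 →L[ℝ] ℝ) 1) u :=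
      ContinuousLinearMap.hasFDerivAt
        ((t * k 0) • (EuclideanSpace.proj (𝕜 := ℝ) : Fin 2 → R2 →L[ℝ] ℝ) 0 +
          (t * k 2) • (EuclideanSpace.proj (𝕜 := ℝ) : Fin 2 → R2 →L[ℝ] ℝ) 1)
    have h1 := ((Complex.ofRealCLM.hasFDerivAt.comp u hlin).const_mul Complex.I).cexp
    have h2 : HasFDerivAt (fun v : R2 => ψ (v + t • w)) (fderiv ℝ ψ (u + t • w)) u := by
      have h0 : HasFDerivAt (fun v : R2 => v + t • w) (ContinuousLinearMap.id ℝ R2) u :=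
        (hasFDerivAt_id u).add_const (t • w)
      have h := HasFDerivAt.comp u (hψ (u + t • w)).hasFDerivAt h0
      rw [ContinuousLinearMap.comp_id] at h
      exact h
    have h3 := (h1.const_mul (c t)).mul h2
    have hEe : expXHat θ₁₂ θ₃₄ (t • k) ψ =ᶠ[𝓝 u] _ := Eventually.of_forall (congrFun (hE t))
    rw [(h3.congr_of_eventuallyEq hEe).fderiv]
    simp [he]
    ring
  have hc' : HasDerivAt c (Complex.I * (t * (k 0 * k 1 * θ₁₂ + k 2 * k 3 * θ₃₄) : ℝ) * c t) t := by
    have h0 : HasDerivAt (fun s : ℝ =>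
        (((s * k 0) * (s * k 1) * θ₁₂ + (s * k 2) * (s * k 3) * θ₃₄) / 2 : ℝ))
        (t * (k 0 * k 1 * θ₁₂ + k 2 * k 3 * θ₃₄)) t := by
      have h := (((hasDerivAt_id t).mul (hasDerivAt_id t)).mul_const
        ((k 0 * k 1 * θ₁₂ + k 2 * k 3 * θ₃₄) / 2)).congr_deriv
          (show _ = t * (k 0 * k 1 * θ₁₂ + k 2 * k 3 * θ₃₄) by simp; ring)
      refine h.congr_of_eventuallyEq (Eventually.of_forall fun s => ?_)
      simp; ring
    refine (h0.ofReal_comp.const_mul Complex.I).cexp.congr_deriv ?_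
    simp only [hc]; ring
  have he' : HasDerivAt (fun s => e s u)
      (Complex.I * (k 0 * u 0 + k 2 * u 1 : ℝ) * e t u) t := by
    have h0 : HasDerivAt (fun s : ℝ => (s * k 0) * u 0 + (s * k 2) * u 1)
        (k 0 * u 0 + k 2 * u 1) t := by
      have h := ((hasDerivAt_id t).mul_const (k 0 * u 0 + k 2 * u 1)).congr_deriv (one_mul _)
      refine h.congr_of_eventuallyEq (Eventually.of_forall fun s => ?_)
      simp; ring
    refine (h0.ofReal_comp.const_mul Complex.I).cexp.congr_deriv ?_
    simp only [he]; ring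
  have hψ' : HasDerivAt (fun s : ℝ => ψ (u + s • w)) (fderiv ℝ ψ (u + t • w) w) t := by
    have h0 : HasDerivAt (fun s : ℝ => u + s • w) w t := by
      simpa using ((hasDerivAt_id t).smul_const w).const_add u
    exact (hψ (u + t • w)).hasFDerivAt.comp_hasDerivAt t h0
  have hmain := (hc'.mul he').mul hψ'
  have hfun : (fun s : ℝ => expXHat θ₁₂ θ₃₄ (s • k) ψ u) =
      fun s => c s * e s u * ψ (u + s • w) := by
    funext s; rw [hE s]
  rw [hfun]
  refine hmain.congr_deriv ?_
  have hDw : fderiv ℝ ψ (u + t • w) w =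
      (θ₁₂ * k 1 : ℝ) * fderiv ℝ ψ (u + t • w) (EuclideanSpace.single 0 1) +
      (θ₃₄ * k 3 : ℝ) * fderiv ℝ ψ (u + t • w) (EuclideanSpace.single 1 1) := by
    conv_lhs => rw [show fderiv ℝ ψ (u + t • w) w = fderiv ℝ ψ (u + t • w)
      ((θ₁₂ * k 1) • EuclideanSpace.single 0 1 + (θ₃₄ * k 3) • EuclideanSpace.single 1 1) by
        rw [← hwb]]
    simp
  rw [hDw]
  simp only [Fin.sum_univ_four, xHat, hfd]
  rw [hE t]
  simp
  ring_nf
  simp only [Complex.I_sq, mul_assoc]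
  ring_nf
  simp only [Complex.I_pow_three]
  ring

/-! ### The Weyl formula -/

/-- The matrix element `⟨φ, Δ̂(x) ψ⟩` of
`Δ̂(x) = (2π)⁻⁴ ∫ exp(i k·x̂) exp(-i k·x) d⁴k`. -/
def deltaHat (θ₁₂ θ₃₄ : ℝ) (φ ψ : 𝓢(R2, ℂ)) (x : R4) : ℂ :=
  ((2 * Real.pi : ℝ) : ℂ)⁻¹ ^ 4 *
    ∫ k : R4, (∫ u : R2, (starRingEnd ℂ) (φ u) * expXHat θ₁₂ θ₃₄ k ψ u) *
      Complex.exp (-Complex.I * (∑ j, k j * x j : ℝ))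

/-- `T` is the Weyl operator `Ŵ[f] = ∫ f(x) Δ̂(x) d⁴x`, the operator-valued integral being
understood weakly on the Schwartz space of `ℝ²`: for all Schwartz `φ`, `ψ`,
`⟨φ, T ψ⟩ = ∫ f(x) ⟨φ, Δ̂(x) ψ⟩ d⁴x`, with an absolutely convergent integral. -/
def IsWeylOperator (θ₁₂ θ₃₄ : ℝ) (f : R4 → ℂ) (T : L2 →L[ℂ] L2) : Prop :=
  ∀ φ ψ : 𝓢(R2, ℂ),
    Integrable (fun x : R4 => f x * deltaHat θ₁₂ θ₃₄ φ ψ x) ∧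
    ⟪φ.toLp 2, T (ψ.toLp 2)⟫_ℂ = ∫ x : R4, f x * deltaHat θ₁₂ θ₃₄ φ ψ x

/-- The set `Ŵ[F]` of the Weyl operators of the symbols in `F`. -/
def weylImage (θ₁₂ θ₃₄ : ℝ) (F : Set (R4 → ℂ)) : Set (L2 →L[ℂ] L2) :=
  {T | ∃ f ∈ F, IsWeylOperator θ₁₂ θ₃₄ f T}

/-! ### The symbol classes -/

/-- The Schwartz functions on `ℝ⁴`. -/
def schwartzClass : Set (R4 → ℂ) :=
  Set.range (fun f : 𝓢(R4, ℂ) => (f : R4 → ℂ))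

/-- `Γ^m_ρ(ℝ⁴)`; the partial derivatives of order `n` are bounded together, through the norm of
the `n`-th derivative. -/
def gammaClass (m ρ : ℝ) : Set (R4 → ℂ) :=
  {f | ContDiff ℝ ∞ f ∧ ∀ n : ℕ, ∃ C : ℝ, ∀ x : R4,
    ‖iteratedFDeriv ℝ n f x‖ ≤ C * (1 + ‖x‖ ^ 2) ^ ((m - ρ * n) / 2)}

/-- `K^∞(ℝ⁴)`: smooth functions all of whose partial derivatives, of every order `n ≥ 0`, tend to
zero at infinity. -/
def kInftyClass : Set (R4 → ℂ) :=
  {f | ContDiff ℝ ∞ f ∧ ∀ n : ℕ, Tendsto (fun x : R4 => ‖iteratedFDeriv ℝ n f x‖)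
    (cocompact R4) (𝓝 0)}

/-! ### Dense subalgebras of the compact operators -/

/-- The compact operators on `L²(ℝ²)`. -/
def compactOperators : Set (L2 →L[ℂ] L2) := {T | IsCompactOperator T}

/-- `A` is a (non-unital, complex) subalgebra of the compact operators, dense in them for the
operator norm. -/
def IsNormDenseSubalgebra (A : Set (L2 →L[ℂ] L2)) : Prop :=
  (∃ B : NonUnitalSubalgebra ℂ (L2 →L[ℂ] L2), (B : Set (L2 →L[ℂ] L2)) = A) ∧
    A ⊆ compactOperators ∧ compactOperators ⊆ closure A

end WeylQuantization

end

noncomputable section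

open scoped FourierTransform

namespace WeylQuantization

section

/-! ### Linear changes of variables -/

section ChangeOfVariables

variable {E F : Type*} [NormedAddCommGroup E] [NormedSpace ℝ E]
  [MeasurableSpace E] [BorelSpace E] [NormedAddCommGroup F] [NormedSpace ℝ F]
  [FiniteDimensional ℝ F] [MeasurableSpace F] [BorelSpace F]

/-! Up to a positive constant, Δ̂(x) is the parity operator displaced to x (Grossmann–Royer): the
symplectic Fourier transform of the Heisenberg translations is a translation composed with the
reflection (`exists_integral_amb_mul_cexp_symp`, `exists_deltaHat_eq_wig`). After this, θ₁₂ and θ₃₄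
survive only in the linear isomorphism `L` onto phase space. Most normalizing constants are left
unevaluated, since the symbol classes are vector spaces.

Operators are studied through their matrix elements between Gaussian coherent states g_z, which
resolve the identity (`integral_inner_coh`). For the operator of a symbol f, the element ⟨g_z, T
g_w⟩ is, up to a phase, a windowed Fourier transform of f at the midpoint (z + w)/2 and at the
frequency dual to z - w (`cohKernel_eq`). Bounded derivatives of f make it decay faster than any
power of z - w, so a Schur test gives a bounded operator (`exists_isWig`). Uniqueness holds because
the coherent states are Schwartz functions and determine an operator (`ext_coh_coh`).

Compactness: for f in K^∞ the kernel also tends to zero as the midpoint goes to infinity. Cutting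
off the midpoint leaves a norm-convergent integral of rank-one operators, and the Schur test makes
the remainder small (`isCompactOperator_of_isWig`).

Products: the kernel of S T is turned back into a symbol by integrating it against displaced
parities (`opSymbol`). For S, T with symbols f, g this gives the absolutely convergent integral
`moyal`, which satisfies the Leibniz rule (`hasFDerivAt_moyal`). Size estimates therefore pass to
all derivatives by induction, and each of the three classes is closed under it. The orthogonality
relations of the displaced parities show that the operator of `moyal L f g` is a multiple of S T
(`exists_isWig_mul`).

Density: the rank-one operator |g_z⟩⟨g_w| has a Schwartz symbol, a Gaussian times a character. The
coherent states span a dense subspace, so the closure of the algebra contains every rank-one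
operator, hence every compact one. -/

theorem exists_map_eq_smul (e : E ≃L[ℝ] F) (μ : Measure E) [μ.IsAddHaarMeasure]
    (ν : Measure F) [ν.IsAddHaarMeasure] :
    ∃ c : NNReal, 0 < c ∧ Measure.map e μ = c • ν := by
  have : (Measure.map e μ).IsAddHaarMeasure := e.isAddHaarMeasure_map μ
  exact ⟨_, Measure.addHaarScalarFactor_pos_of_isAddHaarMeasure (Measure.map e μ) ν,
    Measure.isAddLeftInvariant_eq_smul (Measure.map e μ) ν⟩

theorem integrable_comp_clequiv_iff (e : E ≃L[ℝ] F) (μ : Measure E) [μ.IsAddHaarMeasure]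
    (ν : Measure F) [ν.IsAddHaarMeasure] {G : Type*} [NormedAddCommGroup G] {f : F → G} :
    Integrable (fun x => f (e x)) μ ↔ Integrable f ν := by
  obtain ⟨c, hc, h⟩ := exists_map_eq_smul e μ ν
  have := (e.toHomeomorph.measurableEmbedding.integrable_map_iff (μ := μ) (g := f))
  change Integrable f (Measure.map e μ) ↔ _ at this
  rw [h] at this
  rw [show (fun x => f (e x)) = f ∘ e.toHomeomorph from rfl, ← this]
  rw [show c • ν = (c : ENNReal) • ν from rfl]
  exact integrable_smul_measure (by simpa using hc.ne') (by simp)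

/-- Uniqueness of Haar measure replaces the Jacobian determinant; only the positivity of the
constant matters later. -/
theorem exists_integral_comp_clequiv (e : E ≃L[ℝ] F) (μ : Measure E) [μ.IsAddHaarMeasure]
    (ν : Measure F) [ν.IsAddHaarMeasure] :
    ∃ c : ℝ, 0 < c ∧ ∀ f : F → ℂ, ∫ x, f (e x) ∂μ = c * ∫ y, f y ∂ν := by
  obtain ⟨c, hc, h⟩ := exists_map_eq_smul e μ ν
  refine ⟨c, hc, fun f => ?_⟩
  have := (e.toHomeomorph.measurableEmbedding.integral_map (μ := μ) f)
  change ∫ y, f y ∂(Measure.map e μ) = _ at this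
  rw [h, integral_smul_nnreal_measure] at this
  exact this.symm.trans (by simp [NNReal.smul_def])

end ChangeOfVariables

/-! ### Polynomial decay -/

section Decay

variable {E : Type*} [NormedAddCommGroup E]

/-- The weight `(1 + ‖x‖)⁻ⁿ`. -/
def invPow (n : ℕ) (x : E) : ℝ := ((1 + ‖x‖) ^ n)⁻¹

theorem invPow_pos (n : ℕ) (x : E) : 0 < invPow n x := by unfold invPow; positivity

theorem invPow_le_one (n : ℕ) (x : E) : invPow n x ≤ 1 :=
  inv_le_one_of_one_le₀ (one_le_pow₀ (by simp))

theorem invPow_add (m n : ℕ) (x : E) : invPow (m + n) x = invPow m x * invPow n x := by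
  simp [invPow, pow_add, mul_comm]

theorem invPow_neg (n : ℕ) (x : E) : invPow n (-x) = invPow n x := by simp [invPow]

theorem integrable_invPow [NormedSpace ℝ E] [FiniteDimensional ℝ E] [MeasurableSpace E]
    [BorelSpace E] {n : ℕ} (hn : Module.finrank ℝ E < n) (μ : Measure E) [μ.IsAddHaarMeasure] :
    Integrable (invPow n : E → ℝ) μ := by
  have := integrable_one_add_norm (μ := μ) (r := n) (by exact_mod_cast hn)
  refine this.congr (Eventually.of_forall fun x => ?_)
  simp [invPow, Real.rpow_neg (show 0 ≤ 1 + ‖x‖ by positivity)]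

/-- The Peetre inequality. -/
theorem one_add_norm_add_le (x y : E) : 1 + ‖x + y‖ ≤ (1 + ‖x‖) * (1 + ‖y‖) := by
  nlinarith [norm_add_le x y, norm_nonneg x, norm_nonneg y]

/-- The reciprocal form of the Peetre inequality: joint decay in `x` and `y` can be traded for decay
in `x + y`. This is the source of all off-diagonal decay below. -/
theorem invPow_mul_le (n : ℕ) (x y : E) : invPow n x * invPow n y ≤ invPow n (x + y) := by
  unfold invPow
  rw [← mul_inv, ← mul_pow]
  gcongr
  exact one_add_norm_add_le x y

theorem le_mul_invPow {a b : ℝ} {n : ℕ} {x : E} (h : (1 + ‖x‖) ^ n * a ≤ b) :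
    a ≤ b * invPow n x := by
  unfold invPow
  rw [← div_eq_mul_inv, le_div_iff₀ (by positivity)]
  linarith

theorem one_add_pow_mul_le {a B : ℝ} {n : ℕ} (x : E) (ha : 0 ≤ a) (h0 : a ≤ B)
    (hn : ‖x‖ ^ n * a ≤ B) : (1 + ‖x‖) ^ n * a ≤ 2 ^ n * (2 * B) := by
  have : (1 + ‖x‖) ^ n ≤ 2 ^ n * (1 + ‖x‖ ^ n) := by
    rcases le_total ‖x‖ 1 with h | h
    · calc (1 + ‖x‖) ^ n ≤ 2 ^ n := by gcongr; linarith
        _ ≤ _ := le_mul_of_one_le_right (by positivity) (by simp)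
    · calc (1 + ‖x‖) ^ n ≤ (2 * ‖x‖) ^ n := by gcongr; linarith
        _ = 2 ^ n * ‖x‖ ^ n := mul_pow _ _ _
        _ ≤ _ := by gcongr; simp
  calc (1 + ‖x‖) ^ n * a ≤ 2 ^ n * (1 + ‖x‖ ^ n) * a := by gcongr
    _ = 2 ^ n * (a + ‖x‖ ^ n * a) := by ring
    _ ≤ _ := by gcongr; linarith

theorem exists_norm_iteratedFDeriv_le_invPow [NormedSpace ℝ E] {F : Type*} [NormedAddCommGroup F]
    [NormedSpace ℝ F] (f : 𝓢(E, F)) (k N : ℕ) :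
    ∃ C : ℝ, 0 ≤ C ∧ ∀ j ≤ N, ∀ x, ‖iteratedFDeriv ℝ j f x‖ ≤ C * invPow k x := by
  refine ⟨_, ?_, fun j hj x => le_mul_invPow
    (SchwartzMap.one_add_le_sup_seminorm_apply (𝕜 := ℝ) (m := (k, N)) le_rfl hj f x)⟩
  positivity

theorem exists_norm_le_invPow [NormedSpace ℝ E] {F : Type*} [NormedAddCommGroup F]
    [NormedSpace ℝ F] (f : 𝓢(E, F)) (k : ℕ) :
    ∃ C : ℝ, 0 ≤ C ∧ ∀ x, ‖f x‖ ≤ C * invPow k x := by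
  obtain ⟨C, hC, h⟩ := exists_norm_iteratedFDeriv_le_invPow f k 0
  exact ⟨C, hC, fun x => by simpa using h 0 le_rfl x⟩

end Decay

/-! ### Oscillatory integrals -/

section Oscillatory

variable {V : Type*} [NormedAddCommGroup V] [InnerProductSpace ℝ V] [FiniteDimensional ℝ V]
  [MeasurableSpace V] [BorelSpace V]

theorem integral_cexp_inner_mul_eq_fourier (F : V → ℂ) (ξ : V) :
    ∫ u, Complex.exp (Complex.I * (⟪ξ, u⟫_ℝ : ℝ)) * F u = 𝓕 F (-((2 * Real.pi)⁻¹ • ξ)) := by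
  rw [Real.fourier_eq']
  refine integral_congr_ae (Eventually.of_forall fun u => ?_)
  simp only [smul_eq_mul]
  congr 2
  rw [inner_neg_right, inner_smul_right, real_inner_comm ξ u]
  push_cast
  field_simp

/-- Integration by parts `N` times. The constant depends only on `N` and linearly on `B`, so the
estimate is uniform over families of amplitudes whose derivatives have controlled L¹ norms. -/
theorem norm_integral_cexp_inner_mul_le (N : ℕ) {F : V → ℂ} (hF : ContDiff ℝ N F) {B : ℝ}
    (hint : ∀ j ≤ N, Integrable (fun u => ‖iteratedFDeriv ℝ j F u‖))
    (hB : ∀ j ≤ N, ∫ u, ‖iteratedFDeriv ℝ j F u‖ ≤ B) (ξ : V) :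
    ‖∫ u, Complex.exp (Complex.I * (⟪ξ, u⟫_ℝ : ℝ)) * F u‖ ≤
      (2 ^ N * (2 * ((4 * Real.pi) ^ N * ((N + 1) * B)))) * invPow N ξ := by
  have hB0 : 0 ≤ B := (integral_nonneg fun u => norm_nonneg _).trans (hB 0 (Nat.zero_le N))
  have hpi : (1 : ℝ) ≤ 4 * Real.pi := by nlinarith [Real.pi_gt_three]
  apply le_mul_invPow
  apply one_add_pow_mul_le ξ (norm_nonneg _)
  · calc _ ≤ ∫ u, ‖Complex.exp (Complex.I * (⟪ξ, u⟫_ℝ : ℝ)) * F u‖ :=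
          norm_integral_le_integral_norm _
      _ = ∫ u, ‖iteratedFDeriv ℝ 0 F u‖ := by
          congr 1; ext u; simp [mul_comm Complex.I, Complex.norm_exp_ofReal_mul_I]
      _ ≤ B := hB 0 (Nat.zero_le N)
      _ ≤ (N + 1) * B := le_mul_of_one_le_left hB0 (by simp)
      _ ≤ _ := le_mul_of_one_le_left (by positivity) (one_le_pow₀ hpi)
  · rw [integral_cexp_inner_mul_eq_fourier]
    have h := Real.pow_mul_norm_iteratedFDeriv_fourier_le (f := F) (K := 0) (N := N)
      (by exact_mod_cast hF)
      (fun k n hk hn => by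
        have : k = 0 := by simpa using hk
        subst this
        simpa using hint n (by exact_mod_cast hn)) (k := 0) (n := N) le_rfl le_rfl
      (-((2 * Real.pi)⁻¹ • ξ))
    simp only [pow_zero, one_mul, norm_iteratedFDeriv_zero, zero_add, Finset.range_one,
      Finset.singleton_product, Finset.sum_map, Function.Embedding.coeFn_mk, norm_neg,
      norm_smul, Nat.cast_zero, mul_zero, Real.norm_eq_abs] at h
    rw [abs_of_pos (by positivity), mul_pow, inv_pow] at h
    have hs : ∑ x ∈ Finset.range (N + 1), ∫ v, ‖iteratedFDeriv ℝ x F v‖ ≤ (N + 1) * B := by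
      calc _ ≤ ∑ x ∈ Finset.range (N + 1), B :=
            Finset.sum_le_sum fun j hj => hB j (Nat.lt_succ_iff.1 (Finset.mem_range.1 hj))
        _ = _ := by simp
    have h2 := h.trans (mul_le_mul_of_nonneg_left hs (by positivity))
    -- The factor `(4π)^N` is `(2π)^N` from rescaling the frequency, times the `2^N` already present
    -- in the Fourier estimate.
    rw [mul_assoc, ← le_div_iff₀' (by positivity), div_inv_eq_mul] at h2
    calc _ ≤ _ := h2
      _ = _ := by
        rw [show (4 * Real.pi) ^ N = 2 ^ N * (2 * Real.pi) ^ N by rw [← mul_pow]; ring_nf]; ring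

end Oscillatory

/-- The character `u ↦ exp (i ⟪ξ, u⟫)` has temperate growth. -/
theorem hasTemperateGrowth_cexp_inner {V : Type*} [NormedAddCommGroup V] [InnerProductSpace ℝ V]
    (ξ : V) :
    Function.HasTemperateGrowth (fun u : V => Complex.exp (Complex.I * (⟪ξ, u⟫_ℝ : ℝ))) := by
  have hline : Function.HasTemperateGrowth (fun t : ℝ => Complex.exp (Complex.I * (t : ℂ))) := by
    have hsm : ContDiff ℝ ∞ (fun t : ℝ => Complex.exp (Complex.I * (t : ℂ))) :=
      (contDiff_const.mul Complex.ofRealCLM.contDiff).cexp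
    refine ⟨hsm, fun n => ⟨0, 1, fun t => ?_⟩⟩
    rw [norm_iteratedFDeriv_eq_norm_iteratedDeriv]
    have : iteratedDeriv n (fun t : ℝ => Complex.exp (Complex.I * (t : ℂ))) =
        fun t : ℝ => Complex.I ^ n * Complex.exp (Complex.I * (t : ℂ)) := by
      induction n with
      | zero => simp
      | succ n ih =>
        rw [iteratedDeriv_succ, ih]
        ext t
        have h1 : HasDerivAt (fun t : ℝ => Complex.exp (Complex.I * (t : ℂ)))
            (Complex.exp (Complex.I * (t : ℂ)) * (Complex.I * 1)) t :=
          ((Complex.ofRealCLM.hasDerivAt (x := t)).const_mul Complex.I).cexp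
        rw [(h1.const_mul (Complex.I ^ n)).deriv]
        ring
    rw [this]
    simp [mul_comm Complex.I, Complex.norm_exp_ofReal_mul_I]
  exact hline.comp (Function.hasTemperateGrowth_inner_right ξ)

end

section

/-! ### Phase space translations of Schwartz functions -/

/-- The `L²` vector of a Schwartz function. -/
abbrev toL2 (φ : 𝓢(R2, ℂ)) : L2 := φ.toLp 2

theorem inner_toL2 (φ ψ : 𝓢(R2, ℂ)) :
    ⟪toL2 φ, toL2 ψ⟫_ℂ = ∫ u, (starRingEnd ℂ) (φ u) * ψ u := by
  refine (SchwartzMap.inner_toL2_toL2_eq φ ψ volume).trans ?_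
  simp [mul_comm]

/-- The Heisenberg translation by `(q, p)`:
`ψ ↦ (u ↦ exp (i (⟪p, u⟫ - ⟪p, q⟫ / 2)) ψ (u - q))`. -/
def weylShift (v : R2 × R2) (ψ : 𝓢(R2, ℂ)) : 𝓢(R2, ℂ) :=
  Complex.exp (Complex.I * (-(⟪v.2, v.1⟫_ℝ / 2) : ℝ)) •
    SchwartzMap.smulLeftCLM ℂ (fun u : R2 => Complex.exp (Complex.I * (⟪v.2, u⟫_ℝ : ℝ)))
      (SchwartzMap.compSubConstCLM ℂ v.1 ψ)

theorem weylShift_apply (v : R2 × R2) (ψ : 𝓢(R2, ℂ)) (u : R2) :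
    weylShift v ψ u =
      Complex.exp (Complex.I * (⟪v.2, u⟫_ℝ - ⟪v.2, v.1⟫_ℝ / 2 : ℝ)) * ψ (u - v.1) := by
  simp only [weylShift, smul_apply, smul_eq_mul,
    SchwartzMap.smulLeftCLM_apply_apply (hasTemperateGrowth_cexp_inner v.2),
    SchwartzMap.compSubConstCLM_apply]
  rw [← mul_assoc, ← Complex.exp_add]
  congr 2
  push_cast
  ring

/-- The symplectic form of `ℝ² × ℝ²`. -/
def symp (v w : R2 × R2) : ℝ := ⟪v.2, w.1⟫_ℝ - ⟪w.2, v.1⟫_ℝ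

/-- The symmetric phase `-⟪p, q⟫ / 2` in the translation makes the cocycle half the antisymmetric
form `symp`; hence `-v` inverts `v` with no extra phase. -/
theorem weylShift_weylShift (v w : R2 × R2) (ψ : 𝓢(R2, ℂ)) :
    weylShift v (weylShift w ψ) =
      Complex.exp (Complex.I * (symp v w / 2 : ℝ)) • weylShift (v + w) ψ := by
  ext u
  simp only [weylShift_apply, smul_apply, smul_eq_mul, Prod.fst_add, Prod.snd_add,
    sub_sub]
  rw [← mul_assoc, ← mul_assoc, ← Complex.exp_add, ← Complex.exp_add]
  congr 2
  rw [← mul_add, ← mul_add, ← Complex.ofReal_add, ← Complex.ofReal_add]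
  congr 2
  simp only [symp, inner_add_left, inner_add_right, inner_sub_right]
  ring

theorem weylShift_zero (ψ : 𝓢(R2, ℂ)) : weylShift 0 ψ = ψ := by
  ext u; simp [weylShift_apply]

theorem symp_self (v : R2 × R2) : symp v v = 0 := by simp [symp]

theorem symp_neg_left (v w : R2 × R2) : symp (-v) w = -symp v w := by
  simp [symp]; ring

theorem symp_neg_right (v w : R2 × R2) : symp v (-w) = -symp v w := by
  simp [symp]; ring

theorem weylShift_neg_weylShift (v : R2 × R2) (ψ : 𝓢(R2, ℂ)) :
    weylShift (-v) (weylShift v ψ) = ψ := by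
  rw [weylShift_weylShift, symp_neg_left, symp_self]
  simp [weylShift_zero]

theorem conj_cexp_I_mul (t : ℝ) :
    (starRingEnd ℂ) (Complex.exp (Complex.I * t)) = Complex.exp (-(Complex.I * t)) := by
  rw [← Complex.exp_conj]; simp

theorem norm_cexp_I_mul (t : ℝ) : ‖Complex.exp (Complex.I * t)‖ = 1 := by
  rw [mul_comm, Complex.norm_exp_ofReal_mul_I]

theorem inner_weylShift_weylShift (v : R2 × R2) (φ ψ : 𝓢(R2, ℂ)) :
    ⟪toL2 (weylShift v φ), toL2 (weylShift v ψ)⟫_ℂ = ⟪toL2 φ, toL2 ψ⟫_ℂ := by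
  rw [inner_toL2, inner_toL2,
    ← integral_sub_right_eq_self (fun u => (starRingEnd ℂ) (φ u) * ψ u) v.1]
  refine integral_congr_ae (Eventually.of_forall fun u => ?_)
  simp only [weylShift_apply, map_mul, conj_cexp_I_mul]
  rw [mul_mul_mul_comm, ← Complex.exp_add]
  simp

theorem inner_weylShift_right (v : R2 × R2) (φ ψ : 𝓢(R2, ℂ)) :
    ⟪toL2 φ, toL2 (weylShift v ψ)⟫_ℂ = ⟪toL2 (weylShift (-v) φ), toL2 ψ⟫_ℂ := by
  rw [← inner_weylShift_weylShift (-v) φ, weylShift_neg_weylShift]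

/-- The parity operator. -/
def reflect (ψ : 𝓢(R2, ℂ)) : 𝓢(R2, ℂ) :=
  SchwartzMap.compCLMOfContinuousLinearEquiv ℂ (ContinuousLinearEquiv.neg ℝ) ψ

@[simp] theorem reflect_apply (ψ : 𝓢(R2, ℂ)) (u : R2) : reflect ψ u = ψ (-u) := rfl

@[simp] theorem reflect_reflect (ψ : 𝓢(R2, ℂ)) : reflect (reflect ψ) = ψ := by
  ext u; simp

theorem inner_reflect_right (φ ψ : 𝓢(R2, ℂ)) :
    ⟪toL2 φ, toL2 (reflect ψ)⟫_ℂ = ⟪toL2 (reflect φ), toL2 ψ⟫_ℂ := by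
  rw [inner_toL2, inner_toL2,
    ← integral_neg_eq_self (fun u => (starRingEnd ℂ) (φ u) * reflect ψ u)]
  simp

theorem reflect_weylShift (v : R2 × R2) (ψ : 𝓢(R2, ℂ)) :
    reflect (weylShift v ψ) = weylShift (-v) (reflect ψ) := by
  ext u
  simp only [weylShift_apply, reflect_apply, Prod.fst_neg, Prod.snd_neg, inner_neg_left,
    inner_neg_right]
  congr 2
  · push_cast; ring
  · abel

/-! ### The Fourier-Wigner transform -/

/-- The matrix coefficient `⟨φ, U(v) ψ⟩` of the Heisenberg translations. -/
def amb (φ ψ : 𝓢(R2, ℂ)) (v : R2 × R2) : ℂ := ⟪toL2 φ, toL2 (weylShift v ψ)⟫_ℂ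

/-- The Schwartz function `u ↦ conj (φ u) * ψ (u - q)`. -/
def crossMul (φ ψ : 𝓢(R2, ℂ)) (q : R2) : 𝓢(R2, ℂ) :=
  SchwartzMap.pairing (𝕜 := ℝ) (ContinuousLinearMap.mul ℝ ℂ)
    (SchwartzMap.postcompCLM (𝕜 := ℝ) (Complex.conjCLE : ℂ →L[ℝ] ℂ) φ)
    (SchwartzMap.compSubConstCLM ℝ q ψ)

@[simp] theorem crossMul_apply (φ ψ : 𝓢(R2, ℂ)) (q u : R2) :
    crossMul φ ψ q u = (starRingEnd ℂ) (φ u) * ψ (u - q) := rfl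

/-- For a fixed position shift this is, up to a phase, a Fourier transform in `u` evaluated at the
momentum. Decay in the momentum, Plancherel and Fourier inversion all enter through this form. -/
theorem amb_eq_integral (φ ψ : 𝓢(R2, ℂ)) (v : R2 × R2) :
    amb φ ψ v = Complex.exp (Complex.I * (-(⟪v.2, v.1⟫_ℝ / 2) : ℝ)) *
      ∫ u, Complex.exp (Complex.I * (⟪v.2, u⟫_ℝ : ℝ)) * crossMul φ ψ v.1 u := by
  rw [amb, inner_toL2, ← integral_const_mul]
  refine integral_congr_ae (Eventually.of_forall fun u => ?_)
  simp only [weylShift_apply, crossMul_apply]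
  rw [show Complex.exp (Complex.I * (⟪v.2, u⟫_ℝ - ⟪v.2, v.1⟫_ℝ / 2 : ℝ)) =
    Complex.exp (Complex.I * (-(⟪v.2, v.1⟫_ℝ / 2) : ℝ)) *
      Complex.exp (Complex.I * (⟪v.2, u⟫_ℝ : ℝ)) by
        rw [← Complex.exp_add]; congr 1; push_cast; ring]
  ring

theorem exists_norm_iteratedFDeriv_crossMul_le (φ ψ : 𝓢(R2, ℂ)) (N : ℕ) :
    ∃ C : ℝ, 0 ≤ C ∧ ∀ j ≤ N, ∀ q u,
      ‖iteratedFDeriv ℝ j (crossMul φ ψ q) u‖ ≤ C * invPow 3 q * invPow 3 u := by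
  set φ' := SchwartzMap.postcompCLM (𝕜 := ℝ) (Complex.conjCLE : ℂ →L[ℝ] ℂ) φ with hφ'
  -- Of the six powers of decay of `φ`, three are combined with those of `ψ (u - q)` to give decay
  -- in `q`, and three remain for `u`. Three suffices for integrability on ℝ².
  obtain ⟨C₁, hC₁, h₁⟩ := exists_norm_iteratedFDeriv_le_invPow φ' 6 N
  obtain ⟨C₂, hC₂, h₂⟩ := exists_norm_iteratedFDeriv_le_invPow ψ 3 N
  refine ⟨2 ^ N * (C₁ * C₂), by positivity, fun j hj q u => ?_⟩
  have hmul := norm_iteratedFDeriv_mul_le (𝕜 := ℝ) (f := φ') (g := fun u => ψ (u - q)) (N := j)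
    (φ'.smooth j) ((ψ.smooth j).comp (contDiff_id.sub contDiff_const)) u (n := j) le_rfl
  have heq : (crossMul φ ψ q : R2 → ℂ) = fun u => φ' u * ψ (u - q) := rfl
  rw [heq]
  refine hmul.trans ?_
  have hq : invPow 3 u * invPow 3 (u - q) ≤ invPow 3 q := by
    have := invPow_mul_le 3 u (-(u - q))
    rw [invPow_neg] at this
    simpa using this
  have hterm : ∀ i ∈ Finset.range (j + 1),
      (j.choose i : ℝ) * ‖iteratedFDeriv ℝ i φ' u‖ *
        ‖iteratedFDeriv ℝ (j - i) (fun u => ψ (u - q)) u‖ ≤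
      (j.choose i : ℝ) * (C₁ * C₂ * invPow 3 q * invPow 3 u) := by
    intro i hi
    rw [iteratedFDeriv_comp_sub, mul_assoc]
    refine mul_le_mul_of_nonneg_left ?_ (by positivity)
    have hi' : i ≤ N := (Nat.lt_succ_iff.1 (Finset.mem_range.1 hi)).trans hj
    calc _ ≤ (C₁ * invPow 6 u) * (C₂ * invPow 3 (u - q)) :=
          mul_le_mul (h₁ i hi' u) (h₂ (j - i) ((Nat.sub_le j i).trans hj) (u - q)) (norm_nonneg _)
            (mul_nonneg hC₁ (invPow_pos _ _).le)
      _ = C₁ * C₂ * (invPow 3 u * invPow 3 (u - q)) * invPow 3 u := by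
          rw [show (6 : ℕ) = 3 + 3 from rfl, invPow_add]; ring
      _ ≤ _ := by
          have := (invPow_pos 3 u).le
          gcongr
  refine (Finset.sum_le_sum hterm).trans ?_
  rw [← Finset.sum_mul]
  have : (∑ i ∈ Finset.range (j + 1), (j.choose i : ℝ)) = 2 ^ j := by
    exact_mod_cast Nat.sum_range_choose j
  rw [this, mul_assoc (2 ^ N * (C₁ * C₂)), mul_assoc (2 ^ N), mul_assoc (C₁ * C₂)]
  have h3 := (invPow_pos 3 u).le
  have h4 := (invPow_pos 3 q).le
  gcongr
  norm_num

theorem exists_norm_integral_crossMul_le (φ ψ : 𝓢(R2, ℂ)) :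
    ∃ C : ℝ, 0 ≤ C ∧ ∀ q p,
      ‖∫ u, Complex.exp (Complex.I * (⟪p, u⟫_ℝ : ℝ)) * crossMul φ ψ q u‖ ≤
        C * (invPow 3 q * invPow 3 p) := by
  obtain ⟨C, hC, h⟩ := exists_norm_iteratedFDeriv_crossMul_le φ ψ 3
  have hint : Integrable (invPow 3 : R2 → ℝ) := integrable_invPow (by simp) volume
  set J := ∫ u : R2, invPow 3 u with hJ
  have hJ0 : 0 ≤ J := integral_nonneg fun u => (invPow_pos 3 u).le
  refine ⟨2 ^ 3 * (2 * ((4 * Real.pi) ^ 3 * ((3 + 1) * (C * J)))), by positivity, fun q p => ?_⟩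
  have := norm_integral_cexp_inner_mul_le 3 (F := crossMul φ ψ q) (B := C * invPow 3 q * J)
    ((crossMul φ ψ q).smooth 3) ?_ ?_ p
  · refine this.trans (le_of_eq ?_)
    push_cast; ring
  · intro j hj
    simpa using (crossMul φ ψ q).integrable_pow_mul_iteratedFDeriv (μ := volume) 0 j
  · intro j hj
    rw [hJ, ← integral_const_mul]
    refine integral_mono ?_ (hint.const_mul _) fun u => h j hj q u
    simpa using (crossMul φ ψ q).integrable_pow_mul_iteratedFDeriv (μ := volume) 0 j

theorem exists_norm_amb_le (φ ψ : 𝓢(R2, ℂ)) :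
    ∃ C : ℝ, 0 ≤ C ∧ ∀ v, ‖amb φ ψ v‖ ≤ C * (invPow 3 v.1 * invPow 3 v.2) := by
  obtain ⟨C, hC, h⟩ := exists_norm_integral_crossMul_le φ ψ
  refine ⟨C, hC, fun v => ?_⟩
  rw [amb_eq_integral, norm_mul, norm_cexp_I_mul, one_mul]
  exact h v.1 v.2

theorem continuous_amb (φ ψ : 𝓢(R2, ℂ)) : Continuous (amb φ ψ) := by
  obtain ⟨C, hC, h⟩ := exists_norm_le_invPow ψ 0
  have : amb φ ψ = fun v => ∫ u, (starRingEnd ℂ) (φ u) *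
      (Complex.exp (Complex.I * (⟪v.2, u⟫_ℝ - ⟪v.2, v.1⟫_ℝ / 2 : ℝ)) * ψ (u - v.1)) := by
    ext v
    simp only [amb, inner_toL2, weylShift_apply]
  rw [this]
  refine continuous_of_dominated (bound := fun u => ‖φ u‖ * C) ?_ ?_ (φ.integrable.norm.mul_const C)
    ?_
  · intro v
    refine Continuous.aestronglyMeasurable ?_
    have h1 := φ.continuous
    have h2 := ψ.continuous
    fun_prop
  · refine fun v => Eventually.of_forall fun u => ?_
    rw [norm_mul, norm_mul, norm_cexp_I_mul, one_mul, RCLike.norm_conj]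
    gcongr
    simpa [invPow] using h (u - v.1)
  · refine Eventually.of_forall fun u => ?_
    have h2 := ψ.continuous
    fun_prop

theorem integrable_invPow_mul_invPow :
    Integrable (fun v : R2 × R2 => invPow 3 v.1 * invPow 3 v.2) :=
  (integrable_invPow (E := R2) (by simp) volume).mul_prod
    (integrable_invPow (E := R2) (by simp) volume)

theorem integrable_amb (φ ψ : 𝓢(R2, ℂ)) : Integrable (amb φ ψ) := by
  obtain ⟨C, hC, h⟩ := exists_norm_amb_le φ ψ
  exact (integrable_invPow_mul_invPow.const_mul C).mono' (continuous_amb φ ψ).aestronglyMeasurable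
    (Eventually.of_forall h)

theorem norm_amb_le (φ ψ : 𝓢(R2, ℂ)) (v : R2 × R2) : ‖amb φ ψ v‖ ≤ ‖toL2 φ‖ * ‖toL2 ψ‖ := by
  have h : ‖toL2 (weylShift v ψ)‖ = ‖toL2 ψ‖ := by
    rw [@norm_eq_sqrt_re_inner ℂ, @norm_eq_sqrt_re_inner ℂ _ _ _ _ (toL2 ψ),
      inner_weylShift_weylShift]
  rw [← h]
  exact norm_inner_le_norm _ _

theorem integrable_amb_mul_conj_amb (φ ψ β α : 𝓢(R2, ℂ)) :
    Integrable (fun v => amb φ ψ v * (starRingEnd ℂ) (amb β α v)) := by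
  refine (integrable_amb φ ψ).mul_bdd (c := ‖toL2 β‖ * ‖toL2 α‖)
    (Complex.continuous_conj.comp (continuous_amb β α)).aestronglyMeasurable
    (Eventually.of_forall fun v => ?_)
  simpa using norm_amb_le β α v

end

/-! ### Orthogonality relations and the symplectic Fourier transform -/

section

/-- Multiplication by a nonzero real number. -/
def homothety {E : Type*} [NormedAddCommGroup E] [NormedSpace ℝ E] (c : ℝ) (hc : c ≠ 0) :
    E ≃L[ℝ] E :=
  ContinuousLinearEquiv.smulLeft (Units.mk0 c hc)

@[simp] theorem homothety_apply {E : Type*} [NormedAddCommGroup E] [NormedSpace ℝ E] (c : ℝ)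
    (hc : c ≠ 0) (x : E) : homothety c hc x = c • x := rfl

/-- Orthogonality relations for the Heisenberg translations. -/
theorem exists_integral_amb_mul_conj_amb :
    ∃ κ : ℝ, 0 < κ ∧ ∀ φ ψ β α : 𝓢(R2, ℂ),
      ∫ v, amb φ ψ v * (starRingEnd ℂ) (amb β α v) =
        κ * (⟪toL2 φ, toL2 β⟫_ℂ * ⟪toL2 α, toL2 ψ⟫_ℂ) := by
  have h2pi : -(2 * Real.pi)⁻¹ ≠ 0 := neg_ne_zero.2 (by positivity)
  let e : R2 ≃L[ℝ] R2 := homothety _ h2pi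
  have he : ∀ p, e p = -((2 * Real.pi)⁻¹ • p) := fun p => by simp [e]
  obtain ⟨c, hc, hcint⟩ := exists_integral_comp_clequiv e volume volume
  refine ⟨c, hc, fun φ ψ β α => ?_⟩
  rw [Measure.volume_eq_prod, integral_prod _ (integrable_amb_mul_conj_amb φ ψ β α)]
  -- For fixed `q`, Plancherel in `p`. The remaining integrand couples `u` and `u - q` only, so
  -- integrating in `q` first splits it into two inner products.
  have hinner : ∀ q : R2, ∫ p : R2, amb φ ψ (q, p) * (starRingEnd ℂ) (amb β α (q, p)) =
      c * ∫ u, ((starRingEnd ℂ) (φ u) * β u) * ((starRingEnd ℂ) (α (u - q)) * ψ (u - q)) := by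
    intro q
    let G : R2 → ℂ := fun ξ => ⟪𝓕 (crossMul β α q) ξ, 𝓕 (crossMul φ ψ q) ξ⟫_ℂ
    have h1 : ∀ p : R2, amb φ ψ (q, p) * (starRingEnd ℂ) (amb β α (q, p)) = G (e p) := by
      intro p
      simp only [G, amb_eq_integral, integral_cexp_inner_mul_eq_fourier, map_mul, conj_cexp_I_mul,
        he, SchwartzMap.fourier_coe, RCLike.inner_apply]
      rw [mul_mul_mul_comm, ← Complex.exp_add]
      simp
    rw [integral_congr_ae (Eventually.of_forall h1), hcint]
    simp only [G, SchwartzMap.integral_inner_fourier_fourier]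
    congr 1
    refine integral_congr_ae (Eventually.of_forall fun u => ?_)
    simp only [RCLike.inner_apply, crossMul_apply, map_mul, RingHomCompTriple.comp_apply,
      RingHom.id_apply]
    ring
  simp_rw [hinner]
  rw [integral_const_mul, integral_integral_swap]
  · congr 1
    simp_rw [integral_const_mul]
    have : ∀ u : R2, ∫ q : R2, (starRingEnd ℂ) (α (u - q)) * ψ (u - q) =
        ⟪toL2 α, toL2 ψ⟫_ℂ := by
      intro u
      rw [integral_sub_left_eq_self (fun w => (starRingEnd ℂ) (α w) * ψ w) volume u, inner_toL2]
    simp_rw [this]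
    rw [integral_mul_const, inner_toL2 φ β]
  · obtain ⟨C₁, hC₁, hb₁⟩ := exists_norm_iteratedFDeriv_crossMul_le φ ψ 0
    obtain ⟨C₂, hC₂, hb₂⟩ := exists_norm_iteratedFDeriv_crossMul_le β α 0
    have hmeas : Continuous (Function.uncurry fun q u : R2 =>
        ((starRingEnd ℂ) (φ u) * β u) * ((starRingEnd ℂ) (α (u - q)) * ψ (u - q))) := by
      have h1 := φ.continuous
      have h2 := ψ.continuous
      have h3 := β.continuous
      have h4 := α.continuous
      unfold Function.uncurry
      fun_prop
    refine (integrable_invPow_mul_invPow.const_mul (C₁ * C₂)).mono' hmeas.aestronglyMeasurable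
      (Eventually.of_forall fun v => ?_)
    have e1 := hb₁ 0 le_rfl v.1 v.2
    have e2 := hb₂ 0 le_rfl v.1 v.2
    simp only [norm_iteratedFDeriv_zero, crossMul_apply, norm_mul, RCLike.norm_conj] at e1 e2
    simp only [Function.uncurry, norm_mul, RCLike.norm_conj]
    have hp := invPow_le_one 3 v.1
    have hp' := invPow_le_one 3 v.2
    have hq := (invPow_pos 3 v.1).le
    have hq' := (invPow_pos 3 v.2).le
    calc _ = (‖φ v.2‖ * ‖ψ (v.2 - v.1)‖) * (‖β v.2‖ * ‖α (v.2 - v.1)‖) := by ring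
      _ ≤ (C₁ * invPow 3 v.1 * invPow 3 v.2) * (C₂ * 1 * 1) := by
          refine mul_le_mul e1 (e2.trans ?_) (by positivity) (by positivity)
          gcongr
      _ = _ := by ring

/-- The symplectic Fourier transform of a matrix coefficient. -/
theorem exists_integral_amb_mul_cexp_symp :
    ∃ c : ℝ, 0 < c ∧ ∀ (φ ψ : 𝓢(R2, ℂ)) (w : R2 × R2),
      ∫ v, amb φ ψ v * Complex.exp (-(Complex.I * (symp v w : ℝ))) =
        c * amb φ (reflect ψ) ((2 : ℝ) • w) := by
  have h2pi : -(2 * Real.pi)⁻¹ ≠ 0 := neg_ne_zero.2 (by positivity)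
  let e : R2 ≃L[ℝ] R2 := homothety _ h2pi
  have he : ∀ p, e p = -((2 * Real.pi)⁻¹ • p) := fun p => by simp [e]
  obtain ⟨c, hc, hcint⟩ := exists_integral_comp_clequiv e volume volume
  obtain ⟨c₂, hc₂, hcint₂⟩ := exists_integral_comp_clequiv
    (homothety (2⁻¹ : ℝ) (by norm_num) : R2 ≃L[ℝ] R2) volume volume
  refine ⟨c * c₂, by positivity, fun φ ψ w => ?_⟩
  have hint : Integrable (fun v => amb φ ψ v * Complex.exp (-(Complex.I * (symp v w : ℝ)))) := by
    refine (integrable_amb φ ψ).mul_bdd (c := 1) (Continuous.aestronglyMeasurable ?_)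
      (Eventually.of_forall fun v => ?_)
    · unfold symp; fun_prop
    · rw [← conj_cexp_I_mul, RCLike.norm_conj, norm_cexp_I_mul]
  rw [Measure.volume_eq_prod, integral_prod _ hint]
  -- The integral over `p` is a Fourier inversion, which evaluates `crossMul φ ψ q` at `w.1 + q /
  -- 2`, that is `conj φ` at `w.1 + q / 2` and `ψ` at `w.1 - q / 2`.
  have hinner : ∀ q : R2, ∫ p : R2, amb φ ψ (q, p) *
        Complex.exp (-(Complex.I * (symp (q, p) w : ℝ))) =
      c * (Complex.exp (Complex.I * (⟪w.2, q⟫_ℝ : ℝ)) * crossMul φ ψ q (w.1 + (2⁻¹ : ℝ) • q)) := by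
    intro q
    let G : R2 → ℂ := fun ξ => Complex.exp (Complex.I * (⟪w.2, q⟫_ℝ : ℝ)) *
      (Complex.exp (((2 * Real.pi * ⟪ξ, w.1 + (2⁻¹ : ℝ) • q⟫_ℝ : ℝ) : ℂ) * Complex.I) •
        𝓕 (crossMul φ ψ q : R2 → ℂ) ξ)
    have h1 : ∀ p : R2, amb φ ψ (q, p) * Complex.exp (-(Complex.I * (symp (q, p) w : ℝ))) =
        G (e p) := by
      intro p
      simp only [G, amb_eq_integral, integral_cexp_inner_mul_eq_fourier, he, smul_eq_mul]
      rw [mul_right_comm, ← Complex.exp_add, ← mul_assoc, ← Complex.exp_add]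
      congr 2
      simp only [symp, inner_neg_left, inner_smul_left, inner_add_right, inner_smul_right]
      push_cast
      simp only [RCLike.conj_to_real]
      push_cast
      field_simp
      ring
    rw [integral_congr_ae (Eventually.of_forall h1), hcint]
    simp only [G]
    rw [integral_const_mul, ← Real.fourierInv_eq', ← SchwartzMap.fourier_coe,
      ← SchwartzMap.fourierInv_coe,
      FourierTransform.fourierInv_fourier_eq]
  simp_rw [hinner]
  rw [integral_const_mul]
  -- With `q = 2t` the arguments `w.1 + t` and `w.1 - t` are exchanged by the reflection about
  -- `w.1`; this is where the parity operator appears.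
  let H : R2 → ℂ := fun t =>
    (starRingEnd ℂ) (φ (w.1 + t)) * weylShift ((2 : ℝ) • w) (reflect ψ) (w.1 + t)
  have h2 : ∀ q : R2, Complex.exp (Complex.I * (⟪w.2, q⟫_ℝ : ℝ)) *
      crossMul φ ψ q (w.1 + (2⁻¹ : ℝ) • q) =
      H (homothety (2⁻¹ : ℝ) (by norm_num) q) := by
    intro q
    simp only [H, homothety_apply, crossMul_apply, weylShift_apply, reflect_apply, Prod.smul_fst,
      Prod.smul_snd]
    rw [mul_left_comm]
    congr 2
    · congr 3
      simp only [inner_smul_left, inner_smul_right, inner_add_right]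
      simp
    · congr 1
      module
  rw [integral_congr_ae (Eventually.of_forall h2), hcint₂]
  simp only [H]
  rw [integral_add_left_eq_self (fun u => (starRingEnd ℂ) (φ u) *
      weylShift ((2 : ℝ) • w) (reflect ψ) u) w.1, amb, inner_toL2]
  push_cast
  ring

end

section

/-! ### The operators `Δ̂(x)` as displaced parity operators -/

/-- The position and momentum components of a point of `ℝ⁴`:
`x ↦ ((x₁, x₃), (x₂ / θ₁₂, x₄ / θ₃₄))`. -/
def phaseEquiv {θ₁₂ θ₃₄ : ℝ} (h₁₂ : θ₁₂ ≠ 0) (h₃₄ : θ₃₄ ≠ 0) : R4 ≃L[ℝ] R2 × R2 :=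
  LinearEquiv.toContinuousLinearEquiv
    { toFun := fun x => (!₂[x 0, x 2], !₂[x 1 / θ₁₂, x 3 / θ₃₄])
      invFun := fun v => !₂[v.1 0, θ₁₂ * v.2 0, v.1 1, θ₃₄ * v.2 1]
      map_add' := fun x y => by
        ext i <;> fin_cases i <;> simp [add_div]
      map_smul' := fun c x => by
        ext i <;> fin_cases i <;> simp [mul_div_assoc]
      left_inv := fun x => by
        ext i; fin_cases i <;> simp <;> field_simp
      right_inv := fun v => by
        ext i <;> fin_cases i <;> simp <;> field_simp }

theorem phaseEquiv_apply {θ₁₂ θ₃₄ : ℝ} (h₁₂ : θ₁₂ ≠ 0) (h₃₄ : θ₃₄ ≠ 0) (x : R4) :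
    phaseEquiv h₁₂ h₃₄ x = (!₂[x 0, x 2], !₂[x 1 / θ₁₂, x 3 / θ₃₄]) := rfl

/-- The Heisenberg translation parameter of `exp (i k·x̂)`. -/
def frequencyEquiv {θ₁₂ θ₃₄ : ℝ} (h₁₂ : θ₁₂ ≠ 0) (h₃₄ : θ₃₄ ≠ 0) : R4 ≃L[ℝ] R2 × R2 :=
  LinearEquiv.toContinuousLinearEquiv
    { toFun := fun k => (!₂[-(θ₁₂ * k 1), -(θ₃₄ * k 3)], !₂[k 0, k 2])
      invFun := fun v => !₂[v.2 0, -(v.1 0 / θ₁₂), v.2 1, -(v.1 1 / θ₃₄)]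
      map_add' := fun x y => by
        ext i <;> fin_cases i <;> simp [mul_add, add_comm]
      map_smul' := fun c x => by
        ext i <;> fin_cases i <;> simp [mul_left_comm]
      left_inv := fun x => by
        ext i; fin_cases i <;> simp <;> field_simp
      right_inv := fun v => by
        ext i <;> fin_cases i <;> simp <;> field_simp }

theorem frequencyEquiv_apply {θ₁₂ θ₃₄ : ℝ} (h₁₂ : θ₁₂ ≠ 0) (h₃₄ : θ₃₄ ≠ 0) (k : R4) :
    frequencyEquiv h₁₂ h₃₄ k = (!₂[-(θ₁₂ * k 1), -(θ₃₄ * k 3)], !₂[k 0, k 2]) := rfl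

theorem expXHat_eq_weylShift {θ₁₂ θ₃₄ : ℝ} (h₁₂ : θ₁₂ ≠ 0) (h₃₄ : θ₃₄ ≠ 0) (k : R4)
    (ψ : 𝓢(R2, ℂ)) (u : R2) :
    expXHat θ₁₂ θ₃₄ k ψ u = weylShift (frequencyEquiv h₁₂ h₃₄ k) ψ u := by
  rw [expXHat, weylShift_apply, ← Complex.exp_add, frequencyEquiv_apply]
  congr 2
  · rw [← mul_add, ← Complex.ofReal_add]
    congr 2
    simp [PiLp.inner_apply, Fin.sum_univ_two]
    ring
  · ext i
    fin_cases i <;> simp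

/-- The division by θ in `phaseEquiv` is chosen for this cancellation: the plane waves `exp (-i
k·x)` become symplectic characters. -/
theorem symp_frequencyEquiv_phaseEquiv {θ₁₂ θ₃₄ : ℝ} (h₁₂ : θ₁₂ ≠ 0) (h₃₄ : θ₃₄ ≠ 0) (k x : R4) :
    symp (frequencyEquiv h₁₂ h₃₄ k) (phaseEquiv h₁₂ h₃₄ x) = ∑ j, k j * x j := by
  simp only [symp, frequencyEquiv_apply, phaseEquiv_apply, PiLp.inner_apply, Fin.sum_univ_two,
    Fin.sum_univ_four]
  simp
  field_simp
  ring

/-- The matrix element `⟨φ, Pₓ ψ⟩` of the parity operator displaced by `x`, where the linear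
isomorphism `L` gives the position and momentum components of `x`. -/
def wig (L : R4 ≃L[ℝ] R2 × R2) (φ ψ : 𝓢(R2, ℂ)) (x : R4) : ℂ :=
  amb φ (reflect ψ) ((2 : ℝ) • L x)

instance : (volume : Measure (R2 × R2)).IsAddHaarMeasure := by
  rw [Measure.volume_eq_prod]; infer_instance

/-- Transporting the `k`-integral to phase space by `frequencyEquiv` turns it into the symplectic
Fourier transform of a matrix coefficient, which is a displaced parity. From here on any linear
isomorphism `L` can replace `phaseEquiv`. -/
theorem exists_deltaHat_eq_wig {θ₁₂ θ₃₄ : ℝ} (h₁₂ : θ₁₂ ≠ 0) (h₃₄ : θ₃₄ ≠ 0) :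
    ∃ c : ℝ, 0 < c ∧ ∀ φ ψ x,
      deltaHat θ₁₂ θ₃₄ φ ψ x = c * wig (phaseEquiv h₁₂ h₃₄) φ ψ x := by
  obtain ⟨c₁, hc₁, hint₁⟩ := exists_integral_amb_mul_cexp_symp
  obtain ⟨c₂, hc₂, hint₂⟩ := exists_integral_comp_clequiv (frequencyEquiv h₁₂ h₃₄)
    (volume : Measure R4) (volume : Measure (R2 × R2))
  refine ⟨(2 * Real.pi)⁻¹ ^ 4 * (c₂ * c₁), by positivity, fun φ ψ x => ?_⟩
  let G : R2 × R2 → ℂ := fun v =>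
    amb φ ψ v * Complex.exp (-(Complex.I * (symp v (phaseEquiv h₁₂ h₃₄ x) : ℝ)))
  have h : ∀ k : R4, (∫ u : R2, (starRingEnd ℂ) (φ u) * expXHat θ₁₂ θ₃₄ k ψ u) *
      Complex.exp (-Complex.I * (∑ j, k j * x j : ℝ)) = G (frequencyEquiv h₁₂ h₃₄ k) := by
    intro k
    simp only [G, expXHat_eq_weylShift h₁₂ h₃₄, symp_frequencyEquiv_phaseEquiv, amb, inner_toL2,
      neg_mul]
  rw [deltaHat, integral_congr_ae (Eventually.of_forall h), hint₂]
  simp only [G]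
  rw [hint₁, wig]
  push_cast
  ring

/-! ### Gaussians as Schwartz functions -/

theorem hasTemperateGrowth_fderiv {E F : Type*} [NormedAddCommGroup E] [NormedSpace ℝ E]
    [NormedAddCommGroup F] [NormedSpace ℝ F] {P : E → F} (hP : P.HasTemperateGrowth) :
    (fderiv ℝ P).HasTemperateGrowth := by
  refine ⟨hP.1.fderiv_right (m := ∞) le_rfl, fun n => ?_⟩
  obtain ⟨k, C, h⟩ := hP.2 (n + 1)
  exact ⟨k, C, fun x => by rw [norm_iteratedFDeriv_fderiv]; exact h x⟩

/-- A derivative of `exp (-Q) • P` is again of this shape, with `P` replaced by `DP - DQ ⊗ P`, still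
of temperate growth. The new `P` takes values in a space of linear maps, so the induction quantifies
over the target. -/
theorem exists_norm_iteratedFDeriv_exp_neg_smul_le {E : Type} [NormedAddCommGroup E]
    [NormedSpace ℝ E] {Q : E → ℝ} (hQ : Q.HasTemperateGrowth) (n : ℕ) :
    ∀ {F : Type} [NormedAddCommGroup F] [NormedSpace ℝ F] {P : E → F},
      P.HasTemperateGrowth → ∃ (k : ℕ) (C : ℝ), ∀ x,
        ‖iteratedFDeriv ℝ n (fun y => Real.exp (-Q y) • P y) x‖ ≤
          C * (1 + ‖x‖) ^ k * Real.exp (-Q x) := by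
  induction n with
  | zero =>
    intro F _ _ P hP
    obtain ⟨k, C, h⟩ := hP.2 0
    refine ⟨k, C, fun x => ?_⟩
    have := h x
    rw [norm_iteratedFDeriv_zero] at this ⊢
    rw [norm_smul, Real.norm_eq_abs, Real.abs_exp, mul_comm]
    gcongr
  | succ n ih =>
    intro F _ _ P hP
    have hfd : fderiv ℝ (fun y => Real.exp (-Q y) • P y) = fun y => Real.exp (-Q y) •
        (fderiv ℝ P y - (fderiv ℝ Q y).smulRight (P y)) := by
      ext1 y
      have hQd : DifferentiableAt ℝ Q y := hQ.1.differentiable (by simp) y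
      have hPd : DifferentiableAt ℝ P y := hP.1.differentiable (by simp) y
      have h : HasFDerivAt (fun y => Real.exp (-Q y) • P y) _ y :=
        hQd.hasFDerivAt.neg.exp.smul hPd.hasFDerivAt
      rw [h.fderiv]
      ext v
      simp [smul_sub, smul_smul]
      abel
    have hP' : Function.HasTemperateGrowth
        (fun y => fderiv ℝ P y - (fderiv ℝ Q y).smulRight (P y)) := by
      refine (hasTemperateGrowth_fderiv hP).sub ?_
      exact (ContinuousLinearMap.smulRightL ℝ E F).bilinear_hasTemperateGrowth
        (hasTemperateGrowth_fderiv hQ) hP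
    obtain ⟨k, C, h⟩ := ih hP'
    refine ⟨k, C, fun x => ?_⟩
    rw [← norm_iteratedFDeriv_fderiv, hfd]
    exact h x

/-- `exp (-Q)` as a Schwartz function, for `Q` of temperate growth growing at least linearly. -/
theorem exists_schwartz_exp_neg {E : Type} [NormedAddCommGroup E] [NormedSpace ℝ E] {Q : E → ℝ}
    (hQ : Q.HasTemperateGrowth) {c : ℝ} (hc : 0 < c) (hle : ∀ x, c * ‖x‖ ≤ 1 + Q x) :
    ∃ f : 𝓢(E, ℂ), ∀ x, f x = (Real.exp (-Q x) : ℂ) := by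
  have hsm : ContDiff ℝ ∞ (fun y => Real.exp (-Q y) • (1 : ℂ)) :=
    hQ.1.neg.exp.smul contDiff_const
  refine ⟨⟨fun y => Real.exp (-Q y) • (1 : ℂ), hsm, fun k n => ?_⟩, fun x => ?_⟩
  · obtain ⟨l, C, h⟩ := exists_norm_iteratedFDeriv_exp_neg_smul_le hQ n
      (Function.HasTemperateGrowth.const (1 : ℂ))
    have hC : 0 ≤ C := by
      have := (norm_nonneg _).trans (h 0)
      simp only [norm_zero, add_zero, one_pow, mul_one] at this
      exact nonneg_of_mul_nonneg_left this (Real.exp_pos _)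
    refine ⟨C * (Nat.factorial (k + l) * (c ^ (k + l))⁻¹ * Real.exp (c + 1)), fun x => ?_⟩
    have hexp : (c * (1 + ‖x‖)) ^ (k + l) / Nat.factorial (k + l) ≤ Real.exp (c * (1 + ‖x‖)) :=
      Real.pow_div_factorial_le_exp _ (by positivity) _
    have h2 : Real.exp (c * (1 + ‖x‖)) ≤ Real.exp (c + 1) * Real.exp (Q x) := by
      rw [← Real.exp_add]
      exact Real.exp_le_exp.2 (by nlinarith [hle x])
    have h3 : (1 + ‖x‖) ^ (k + l) * Real.exp (-Q x) ≤
        Nat.factorial (k + l) * (c ^ (k + l))⁻¹ * Real.exp (c + 1) := by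
      have h4 := hexp.trans h2
      rw [div_le_iff₀ (by positivity), mul_pow] at h4
      rw [Real.exp_neg, ← div_eq_mul_inv, div_le_iff₀ (Real.exp_pos _)]
      rw [← le_div_iff₀' (by positivity)] at h4
      refine h4.trans (le_of_eq ?_)
      field_simp
    calc _ ≤ (1 + ‖x‖) ^ k * (C * (1 + ‖x‖) ^ l * Real.exp (-Q x)) := by
          refine mul_le_mul ?_ (h x) (norm_nonneg _) (by positivity)
          gcongr
          simp
      _ = C * ((1 + ‖x‖) ^ (k + l) * Real.exp (-Q x)) := by rw [pow_add]; ring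
      _ ≤ _ := by gcongr
  · change Real.exp (-Q x) • (1 : ℂ) = _
    simp

end

section

/-! ### Coherent states -/

theorem exists_schwartz_gaussian :
    ∃ f : 𝓢(R2, ℂ), ∀ u, f u = (Real.exp (-(‖u‖ ^ 2 / 2)) : ℂ) := by
  refine exists_schwartz_exp_neg (c := 1) ?_ one_pos fun x => ?_
  · have := (Function.hasTemperateGrowth_norm_sq R2).mul
      (Function.HasTemperateGrowth.const (2⁻¹ : ℝ))
    simpa [div_eq_mul_inv] using! this
  · nlinarith [sq_nonneg (‖x‖ - 1)]

/-- The Gaussian `exp (-‖u‖² / 2)`. -/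
def gauss : 𝓢(R2, ℂ) := exists_schwartz_gaussian.choose

theorem gauss_apply (u : R2) : gauss u = (Real.exp (-(‖u‖ ^ 2 / 2)) : ℂ) :=
  exists_schwartz_gaussian.choose_spec u

theorem reflect_gauss : reflect gauss = gauss := by
  ext u; simp [gauss_apply]

theorem amb_gauss_gauss (v : R2 × R2) :
    amb gauss gauss v = Real.pi * (Real.exp (-((‖v.1‖ ^ 2 + ‖v.2‖ ^ 2) / 4)) : ℂ) := by
  obtain ⟨q, p⟩ := v
  -- Centring at `q / 2` makes the two Gaussians symmetric and cancels the phase `⟪p, q⟫ / 2`,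
  -- leaving the Fourier transform of a single Gaussian.
  rw [amb, inner_toL2, ← integral_add_right_eq_self _ ((2⁻¹ : ℝ) • q)]
  have h : ∀ u : R2, (starRingEnd ℂ) (gauss (u + (2⁻¹ : ℝ) • q)) *
      weylShift (q, p) gauss (u + (2⁻¹ : ℝ) • q) =
      (Real.exp (-(‖q‖ ^ 2 / 4)) : ℂ) *
        Complex.exp (-1 * (‖u‖ : ℂ) ^ 2 + Complex.I * (⟪p, u⟫_ℝ : ℝ)) := by
    intro u
    simp only [weylShift_apply, gauss_apply, Complex.conj_ofReal]
    push_cast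
    rw [mul_left_comm, ← Complex.exp_add, ← Complex.exp_add, ← Complex.exp_add]
    congr 1
    have e1 : ‖u + (2⁻¹ : ℝ) • q‖ ^ 2 = ‖u‖ ^ 2 + ⟪u, q⟫_ℝ + ‖q‖ ^ 2 / 4 := by
      rw [norm_add_sq_real, inner_smul_right, norm_smul]
      norm_num
      ring
    have e2 : ‖u + (2⁻¹ : ℝ) • q - q‖ ^ 2 = ‖u‖ ^ 2 - ⟪u, q⟫_ℝ + ‖q‖ ^ 2 / 4 := by
      rw [show u + (2⁻¹ : ℝ) • q - q = u - (2⁻¹ : ℝ) • q by module, norm_sub_sq_real,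
        inner_smul_right, norm_smul]
      norm_num
      ring
    rw [inner_add_right, inner_smul_right]
    have e1' := congrArg (fun t : ℝ => (t : ℂ)) e1
    have e2' := congrArg (fun t : ℝ => (t : ℂ)) e2
    push_cast at e1' e2' ⊢
    rw [e1', e2']
    ring
  simp_rw [h]
  rw [integral_const_mul, GaussianFourier.integral_cexp_neg_mul_sq_norm_add (by simp)]
  simp
  rw [mul_left_comm, ← Complex.exp_add]
  congr 2
  ring

theorem toL2_smul (c : ℂ) (ψ : 𝓢(R2, ℂ)) : toL2 (c • ψ) = c • toL2 ψ :=
  map_smul (SchwartzMap.toLpCLM ℂ ℂ 2 volume) _ _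

variable (L : R4 ≃L[ℝ] R2 × R2)

/-- The coherent state at the phase space point `z`. -/
def coh (z : R4) : 𝓢(R2, ℂ) := weylShift (L z) gauss

/-- The symplectic form of `ℝ⁴`. -/
def sform (x y : R4) : ℝ := symp (L x) (L y)

theorem sform_add_left (x y z : R4) : sform L (x + y) z = sform L x z + sform L y z := by
  simp [sform, symp, inner_add_left, inner_add_right]; ring

theorem sform_add_right (x y z : R4) : sform L x (y + z) = sform L x y + sform L x z := by
  simp [sform, symp, inner_add_left, inner_add_right]; ring

theorem sform_smul_left (c : ℝ) (x y : R4) : sform L (c • x) y = c * sform L x y := by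
  simp [sform, symp, inner_smul_left, inner_smul_right]; ring

theorem sform_smul_right (c : ℝ) (x y : R4) : sform L x (c • y) = c * sform L x y := by
  simp [sform, symp, inner_smul_left, inner_smul_right]; ring

theorem sform_neg_left (x y : R4) : sform L (-x) y = -sform L x y := by
  simp [sform, symp_neg_left]

theorem sform_neg_right (x y : R4) : sform L x (-y) = -sform L x y := by
  simp [sform, symp_neg_right]

theorem sform_sub_left (x y z : R4) : sform L (x - y) z = sform L x z - sform L y z := by
  rw [sub_eq_add_neg, sform_add_left, sform_neg_left, sub_eq_add_neg]

theorem sform_sub_right (x y z : R4) : sform L x (y - z) = sform L x y - sform L x z := by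
  rw [sub_eq_add_neg, sform_add_right, sform_neg_right, sub_eq_add_neg]

theorem sform_self (x : R4) : sform L x x = 0 := symp_self _

theorem sform_swap (x y : R4) : sform L x y = -sform L y x := by
  simp [sform, symp]

theorem continuous_sform : Continuous (fun z : R4 × R4 => sform L z.1 z.2) := by
  unfold sform symp
  have := L.continuous
  fun_prop

theorem exists_schwartz_phi :
    ∃ f : 𝓢(R4, ℂ), ∀ x, f x =
      Real.pi * (Real.exp (-(‖(L x).1‖ ^ 2 + ‖(L x).2‖ ^ 2)) : ℂ) := by
  have hQ : Function.HasTemperateGrowth (fun v : R2 × R2 => ‖v.1‖ ^ 2 + ‖v.2‖ ^ 2) := by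
    refine Function.HasTemperateGrowth.add ?_ ?_
    · exact (Function.hasTemperateGrowth_norm_sq R2).comp
        (ContinuousLinearMap.fst ℝ R2 R2).hasTemperateGrowth
    · exact (Function.hasTemperateGrowth_norm_sq R2).comp
        (ContinuousLinearMap.snd ℝ R2 R2).hasTemperateGrowth
  obtain ⟨f, hf⟩ := exists_schwartz_exp_neg hQ (c := 1) one_pos fun v => by
    rcases max_cases ‖v.1‖ ‖v.2‖ with ⟨h, _⟩ | ⟨h, _⟩ <;> rw [Prod.norm_def, h] <;>
      nlinarith [sq_nonneg (‖v.1‖ - 1), sq_nonneg (‖v.2‖ - 1)]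
  refine ⟨(Real.pi : ℂ) • SchwartzMap.compCLMOfContinuousLinearEquiv ℂ L f, fun x => ?_⟩
  simp [hf]

/-- The Gaussian `x ↦ ⟨g, Pₓ g⟩` on phase space. -/
def phi : 𝓢(R4, ℂ) := (exists_schwartz_phi L).choose

theorem phi_apply (x : R4) :
    phi L x = Real.pi * (Real.exp (-(‖(L x).1‖ ^ 2 + ‖(L x).2‖ ^ 2)) : ℂ) :=
  (exists_schwartz_phi L).choose_spec x

theorem phi_neg (x : R4) : phi L (-x) = phi L x := by simp [phi_apply]

theorem amb_gauss_gauss_smul (x : R4) : amb gauss gauss ((2 : ℝ) • L x) = phi L x := by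
  rw [amb_gauss_gauss, phi_apply]
  congr 4
  simp [norm_smul]
  ring

theorem inner_coh_coh (z w : R4) :
    ⟪toL2 (coh L z), toL2 (coh L w)⟫_ℂ =
      Complex.exp (Complex.I * (-(sform L z w / 2) : ℝ)) * phi L ((2⁻¹ : ℝ) • (w - z)) := by
  have h := inner_weylShift_right (-(L z)) gauss (weylShift (L w) gauss)
  rw [neg_neg] at h
  rw [coh, coh, ← h, weylShift_weylShift, ← amb_gauss_gauss_smul, amb, map_smul, smul_smul]
  have e : -L z + L w = ((2 : ℝ) * 2⁻¹) • L (w - z) := by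
    rw [map_sub]; norm_num; abel
  rw [← e]
  rw [toL2_smul, inner_smul_right, sform, symp_neg_left]
  congr 4
  ring

theorem norm_toL2_coh (z : R4) : ‖toL2 (coh L z)‖ = ‖toL2 gauss‖ := by
  rw [@norm_eq_sqrt_re_inner ℂ, @norm_eq_sqrt_re_inner ℂ _ _ _ _ (toL2 gauss), coh,
    inner_weylShift_weylShift]

/-- All coherent states have the same norm, so norm continuity reduces to continuity of the overlap,
which is explicit. -/
theorem continuous_toL2_coh : Continuous (fun z => toL2 (coh L z)) := by
  rw [continuous_iff_continuousAt]
  intro w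
  rw [ContinuousAt, tendsto_iff_norm_sub_tendsto_zero]
  have hsq : ∀ z, ‖toL2 (coh L z) - toL2 (coh L w)‖ =
      √(‖toL2 gauss‖ ^ 2 - 2 * RCLike.re (⟪toL2 (coh L z), toL2 (coh L w)⟫_ℂ) +
        ‖toL2 gauss‖ ^ 2) := by
    intro z
    have h := @norm_sub_sq ℂ _ _ _ _ (toL2 (coh L z)) (toL2 (coh L w))
    rw [norm_toL2_coh, norm_toL2_coh] at h
    rw [← h, Real.sqrt_sq (norm_nonneg _)]
  have hcont : Continuous (fun z => ‖toL2 (coh L z) - toL2 (coh L w)‖) := by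
    simp_rw [hsq, inner_coh_coh]
    have h1 := (phi L).continuous
    have h2 : Continuous (fun z => sform L z w) :=
      (continuous_sform L).comp (by fun_prop : Continuous fun z : R4 => (z, w))
    have h3 : Continuous (RCLike.re : ℂ → ℝ) := RCLike.continuous_re
    fun_prop
  have := hcont.tendsto w
  simpa using this

/-- The matrix element of a displaced parity operator between coherent states. -/
theorem wig_coh_coh (z w x : R4) :
    wig L (coh L z) (coh L w) x =
      Complex.exp (Complex.I * (sform L x (z - w) + sform L z w / 2 : ℝ)) *
        phi L (x - (2⁻¹ : ℝ) • (z + w)) := by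
  have h := inner_weylShift_right (-(L z)) gauss
    (weylShift ((2 : ℝ) • L x) (reflect (weylShift (L w) gauss)))
  rw [neg_neg] at h
  rw [wig, amb, coh, coh, ← h, reflect_weylShift, reflect_gauss, weylShift_weylShift,
    ← amb_gauss_gauss_smul, amb]
  have e : -L z + (2 : ℝ) • L x + -L w = (2 : ℝ) • L (x - (2⁻¹ : ℝ) • (z + w)) := by
    simp only [map_sub, map_smul, map_add]
    module
  rw [weylShift_weylShift, e, toL2_smul, toL2_smul, inner_smul_right, inner_smul_right,
    ← mul_assoc, ← Complex.exp_add, ← mul_add, ← Complex.ofReal_add]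
  congr 4
  simp only [sform, symp, map_sub, Prod.fst_add, Prod.snd_add, Prod.fst_neg, Prod.snd_neg,
    Prod.smul_fst, Prod.smul_snd, Prod.fst_sub, Prod.snd_sub, inner_add_left, inner_add_right,
    inner_sub_left, inner_sub_right, inner_neg_left, inner_neg_right, inner_smul_left,
    inner_smul_right, RCLike.conj_to_real]
  ring

end

section

variable (L : R4 ≃L[ℝ] R2 × R2)

/-! ### Displaced parity operators -/

/-- The parity operator displaced by `x`. -/
def dispParity (x : R4) (ψ : 𝓢(R2, ℂ)) : 𝓢(R2, ℂ) := weylShift ((2 : ℝ) • L x) (reflect ψ)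

theorem wig_eq_inner (φ ψ : 𝓢(R2, ℂ)) (x : R4) :
    wig L φ ψ x = ⟪toL2 φ, toL2 (dispParity L x ψ)⟫_ℂ := rfl

theorem inner_dispParity_right (φ ψ : 𝓢(R2, ℂ)) (x : R4) :
    ⟪toL2 φ, toL2 (dispParity L x ψ)⟫_ℂ = ⟪toL2 (dispParity L x φ), toL2 ψ⟫_ℂ := by
  rw [dispParity, inner_weylShift_right, inner_reflect_right, reflect_weylShift, neg_neg,
    dispParity]

theorem conj_wig (φ ψ : 𝓢(R2, ℂ)) (x : R4) : (starRingEnd ℂ) (wig L φ ψ x) = wig L ψ φ x := by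
  rw [wig_eq_inner, inner_conj_symm, ← inner_dispParity_right, wig_eq_inner]

theorem continuous_wig (φ ψ : 𝓢(R2, ℂ)) : Continuous (wig L φ ψ) :=
  (continuous_amb _ _).comp (L.continuous.const_smul (2 : ℝ))

/-- The linear isomorphism `x ↦ 2 L x`. -/
def doubleEquiv : R4 ≃L[ℝ] R2 × R2 := L.trans (homothety (2 : ℝ) two_ne_zero)

theorem integrable_wig (φ ψ : 𝓢(R2, ℂ)) : Integrable (wig L φ ψ) :=
  (integrable_comp_clequiv_iff (doubleEquiv L) volume volume).2 (integrable_amb φ (reflect ψ))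

/-- Displaced parities are self-adjoint, so the second factor is a conjugate matrix coefficient and
the orthogonality relations apply. Both the symbol of a rank-one operator and the recovery of an
operator from `opSymbol` rest on this. -/
theorem exists_integral_wig_mul_wig :
    ∃ κ : ℝ, 0 < κ ∧ ∀ φ ψ α β : 𝓢(R2, ℂ),
      ∫ x, wig L φ ψ x * wig L α β x =
        κ * (⟪toL2 φ, toL2 β⟫_ℂ * ⟪toL2 α, toL2 ψ⟫_ℂ) := by
  obtain ⟨c₁, hc₁, h₁⟩ := exists_integral_amb_mul_conj_amb
  obtain ⟨c₂, hc₂, h₂⟩ := exists_integral_comp_clequiv (doubleEquiv L)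
    (volume : Measure R4) (volume : Measure (R2 × R2))
  refine ⟨c₂ * c₁, by positivity, fun φ ψ α β => ?_⟩
  have h : ∀ x, wig L φ ψ x * wig L α β x = (fun v => amb φ (reflect ψ) v *
      (starRingEnd ℂ) (amb β (reflect α) v)) (doubleEquiv L x) := by
    intro x
    rw [← conj_wig L β α]
    rfl
  rw [integral_congr_ae (Eventually.of_forall h),
    h₂ (fun v => amb φ (reflect ψ) v * (starRingEnd ℂ) (amb β (reflect α) v)), h₁,
    inner_reflect_right, reflect_reflect]
  push_cast
  ring

/-- The constant of the orthogonality relations of the displaced parity operators. -/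
def wigConst : ℝ := (exists_integral_wig_mul_wig L).choose

theorem wigConst_pos : 0 < wigConst L := (exists_integral_wig_mul_wig L).choose_spec.1

theorem integral_wig_mul_wig (φ ψ α β : 𝓢(R2, ℂ)) :
    ∫ x, wig L φ ψ x * wig L α β x =
      wigConst L * (⟪toL2 φ, toL2 β⟫_ℂ * ⟪toL2 α, toL2 ψ⟫_ℂ) :=
  (exists_integral_wig_mul_wig L).choose_spec.2 φ ψ α β

/-! ### The resolution of the identity -/

theorem toL2_gauss_ne_zero : toL2 gauss ≠ 0 := by
  intro h
  have h0 : toL2 gauss = toL2 0 := by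
    rw [h]; exact (map_zero (SchwartzMap.toLpCLM ℂ ℂ 2 (volume : Measure R2))).symm
  have h1 : gauss = 0 := SchwartzMap.injective_toLp 2 volume h0
  have h2 := gauss_apply 0
  rw [h1] at h2
  simp at h2

/-- The orthogonality relations with both windows equal to the Gaussian. -/
theorem exists_integral_inner_coh_mul_inner_coh :
    ∃ κ : ℝ, 0 < κ ∧ ∀ φ ψ : 𝓢(R2, ℂ),
      ∫ z, ⟪toL2 φ, toL2 (coh L z)⟫_ℂ * ⟪toL2 (coh L z), toL2 ψ⟫_ℂ =
        κ * ⟪toL2 φ, toL2 ψ⟫_ℂ := by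
  obtain ⟨c₁, hc₁, h₁⟩ := exists_integral_amb_mul_conj_amb
  obtain ⟨c₂, hc₂, h₂⟩ := exists_integral_comp_clequiv L
    (volume : Measure R4) (volume : Measure (R2 × R2))
  have hg : 0 < ‖toL2 gauss‖ := norm_pos_iff.2 toL2_gauss_ne_zero
  refine ⟨c₂ * c₁ * ‖toL2 gauss‖ ^ 2, by positivity, fun φ ψ => ?_⟩
  have h : ∀ z, ⟪toL2 φ, toL2 (coh L z)⟫_ℂ * ⟪toL2 (coh L z), toL2 ψ⟫_ℂ =
      (fun v => amb φ gauss v * (starRingEnd ℂ) (amb ψ gauss v)) (L z) := by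
    intro z
    simp only [amb, coh, inner_conj_symm]
  rw [integral_congr_ae (Eventually.of_forall h),
    h₂ (fun v => amb φ gauss v * (starRingEnd ℂ) (amb ψ gauss v)), h₁,
    inner_self_eq_norm_sq_to_K]
  push_cast
  simp
  ring

/-- The constant of the resolution of the identity. -/
def frameConst : ℝ := (exists_integral_inner_coh_mul_inner_coh L).choose

theorem frameConst_pos : 0 < frameConst L :=
  (exists_integral_inner_coh_mul_inner_coh L).choose_spec.1

theorem integral_inner_coh_mul_inner_coh (φ ψ : 𝓢(R2, ℂ)) :
    ∫ z, ⟪toL2 φ, toL2 (coh L z)⟫_ℂ * ⟪toL2 (coh L z), toL2 ψ⟫_ℂ =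
      frameConst L * ⟪toL2 φ, toL2 ψ⟫_ℂ :=
  (exists_integral_inner_coh_mul_inner_coh L).choose_spec.2 φ ψ

theorem continuous_inner_coh (φ : L2) : Continuous (fun z => ⟪toL2 (coh L z), φ⟫_ℂ) :=
  (continuous_toL2_coh L).inner continuous_const

theorem integrable_inner_coh (φ : 𝓢(R2, ℂ)) :
    Integrable (fun z => ⟪toL2 (coh L z), toL2 φ⟫_ℂ) := by
  have h : Integrable (fun z => amb φ gauss (L z)) :=
    (integrable_comp_clequiv_iff L volume volume).2 (integrable_amb φ gauss)
  refine h.norm.mono' (continuous_inner_coh L _).aestronglyMeasurable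
    (Eventually.of_forall fun z => ?_)
  rw [amb, norm_inner_symm]
  rfl

theorem integrable_norm_sq_inner_coh_schwartz (φ : 𝓢(R2, ℂ)) :
    Integrable (fun z => ‖⟪toL2 (coh L z), toL2 φ⟫_ℂ‖ ^ 2) := by
  simp_rw [sq]
  refine (integrable_inner_coh L φ).norm.mul_bdd (c := ‖toL2 gauss‖ * ‖toL2 φ‖)
    (continuous_inner_coh L _).norm.aestronglyMeasurable (Eventually.of_forall fun z => ?_)
  rw [norm_norm, ← norm_toL2_coh L z]
  exact norm_inner_le_norm _ _

theorem integral_norm_sq_inner_coh_schwartz (φ : 𝓢(R2, ℂ)) :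
    ∫ z, ‖⟪toL2 (coh L z), toL2 φ⟫_ℂ‖ ^ 2 = frameConst L * ‖toL2 φ‖ ^ 2 := by
  have h := integral_inner_coh_mul_inner_coh L φ φ
  rw [inner_self_eq_norm_sq_to_K] at h
  have h2 : ∀ z, ⟪toL2 φ, toL2 (coh L z)⟫_ℂ * ⟪toL2 (coh L z), toL2 φ⟫_ℂ =
      ((‖⟪toL2 (coh L z), toL2 φ⟫_ℂ‖ ^ 2 : ℝ) : ℂ) := by
    intro z
    rw [← inner_conj_symm, RCLike.conj_mul]
    simp
  rw [integral_congr_ae (Eventually.of_forall h2), integral_complex_ofReal] at h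
  apply Complex.ofReal_injective
  rw [h]
  simp

theorem dense_range_toL2 : DenseRange toL2 := by
  have := SchwartzMap.denseRange_toLpCLM (E := R2) (F := ℂ) (p := 2) (μ := volume) (by simp)
  exact this

/-- Fatou along Schwartz functions converging to `φ`. Lower integrals are used because integrability
for general `φ` is not yet known; it is a consequence. -/
theorem lintegral_norm_sq_inner_coh_le (φ : L2) :
    ∫⁻ z, ENNReal.ofReal (‖⟪toL2 (coh L z), φ⟫_ℂ‖ ^ 2) ≤
      ENNReal.ofReal (frameConst L * ‖φ‖ ^ 2) := by
  obtain ⟨a, ha, hlim⟩ := mem_closure_iff_seq_limit.1 (dense_range_toL2 φ)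
  choose ψ hψ using ha
  have hlim' : Tendsto (fun n => toL2 (ψ n)) atTop (𝓝 φ) := by simpa [hψ] using hlim
  have h1 : ∀ z, ENNReal.ofReal (‖⟪toL2 (coh L z), φ⟫_ℂ‖ ^ 2) =
      liminf (fun n => ENNReal.ofReal (‖⟪toL2 (coh L z), toL2 (ψ n)⟫_ℂ‖ ^ 2)) atTop := by
    intro z
    refine (Tendsto.liminf_eq ?_).symm
    exact (ENNReal.continuous_ofReal.tendsto _).comp
      ((tendsto_const_nhds.inner hlim').norm.pow 2)
  simp_rw [h1]
  refine (lintegral_liminf_le fun n => ?_).trans (le_of_eq ?_)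
  · exact (ENNReal.continuous_ofReal.comp
      ((continuous_inner_coh L (toL2 (ψ n))).norm.pow 2)).measurable
  · refine Tendsto.liminf_eq ?_
    have h2 : ∀ n, ∫⁻ z, ENNReal.ofReal (‖⟪toL2 (coh L z), toL2 (ψ n)⟫_ℂ‖ ^ 2) =
        ENNReal.ofReal (frameConst L * ‖toL2 (ψ n)‖ ^ 2) := by
      intro n
      rw [← integral_norm_sq_inner_coh_schwartz, ofReal_integral_eq_lintegral_ofReal
        (integrable_norm_sq_inner_coh_schwartz L (ψ n))
        (Eventually.of_forall fun z => by positivity)]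
    simp_rw [h2]
    exact (ENNReal.continuous_ofReal.tendsto _).comp ((hlim'.norm.pow 2).const_mul _)

theorem integrable_norm_sq_inner_coh (φ : L2) :
    Integrable (fun z => ‖⟪toL2 (coh L z), φ⟫_ℂ‖ ^ 2) := by
  refine ⟨((continuous_inner_coh L φ).norm.pow 2).aestronglyMeasurable, ?_⟩
  rw [hasFiniteIntegral_iff_ofReal (Eventually.of_forall fun z => by positivity)]
  exact (lintegral_norm_sq_inner_coh_le L φ).trans_lt ENNReal.ofReal_lt_top

theorem integral_norm_sq_inner_coh_le (φ : L2) :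
    ∫ z, ‖⟪toL2 (coh L z), φ⟫_ℂ‖ ^ 2 ≤ frameConst L * ‖φ‖ ^ 2 := by
  rw [integral_eq_lintegral_of_nonneg_ae (Eventually.of_forall fun z => by positivity)
    (integrable_norm_sq_inner_coh L φ).aestronglyMeasurable]
  exact ENNReal.toReal_le_of_le_ofReal
    (mul_nonneg (frameConst_pos L).le (by positivity)) (lintegral_norm_sq_inner_coh_le L φ)

theorem memLp_inner_coh (φ : L2) : MemLp (fun z => ⟪toL2 (coh L z), φ⟫_ℂ) 2 :=
  (memLp_two_iff_integrable_sq_norm (continuous_inner_coh L φ).aestronglyMeasurable).2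
    (integrable_norm_sq_inner_coh L φ)

theorem norm_toLp_two_sq {α : Type*} {m : MeasurableSpace α} {μ : Measure α} {f : α → ℂ}
    (hf : MemLp f 2 μ) : ‖hf.toLp f‖ ^ 2 = ∫ x, ‖f x‖ ^ 2 ∂μ := by
  rw [← @inner_self_eq_norm_sq ℂ, L2.inner_def, ← integral_re (L2.integrable_inner _ _)]
  refine integral_congr_ae ?_
  filter_upwards [hf.coeFn_toLp] with z hz
  rw [inner_self_eq_norm_sq, hz]

theorem norm_toLp_inner_coh_le (φ : L2) :
    ‖(memLp_inner_coh L φ).toLp _‖ ≤ √(frameConst L) * ‖φ‖ := by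
  refine (sq_le_sq₀ (norm_nonneg _) (by positivity)).1 ?_
  rw [mul_pow, Real.sq_sqrt (frameConst_pos L).le, norm_toLp_two_sq]
  exact integral_norm_sq_inner_coh_le L φ

/-- The coherent state transform `φ ↦ (z ↦ ⟨g_z, φ⟩)`, as a linear map. -/
def cohTransformₗ : L2 →ₗ[ℂ] Lp ℂ 2 (volume : Measure R4) where
  toFun := fun φ => (memLp_inner_coh L φ).toLp _
  map_add' := fun φ ψ => by
    rw [← MemLp.toLp_add]
    congr 1
    ext z
    simp [inner_add_right]
  map_smul' := fun c φ => by
    rw [RingHom.id_apply, ← MemLp.toLp_const_smul]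
    congr 1
    ext z
    simp [inner_smul_right]

/-- The coherent state transform `φ ↦ (z ↦ ⟨g_z, φ⟩)`. -/
def cohTransform : L2 →L[ℂ] Lp ℂ 2 (volume : Measure R4) :=
  (cohTransformₗ L).mkContinuous (√(frameConst L)) (norm_toLp_inner_coh_le L)

theorem coeFn_cohTransform (φ : L2) :
    cohTransform L φ =ᵐ[volume] fun z => ⟪toL2 (coh L z), φ⟫_ℂ :=
  (memLp_inner_coh L φ).coeFn_toLp

theorem inner_cohTransform_eq_integral (φ ψ : L2) :
    ⟪cohTransform L φ, cohTransform L ψ⟫_ℂ =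
      ∫ z, ⟪φ, toL2 (coh L z)⟫_ℂ * ⟪toL2 (coh L z), ψ⟫_ℂ := by
  rw [L2.inner_def]
  refine integral_congr_ae ?_
  filter_upwards [coeFn_cohTransform L φ, coeFn_cohTransform L ψ] with z h1 h2
  rw [h1, h2, RCLike.inner_apply, inner_conj_symm, mul_comm]

/-- Both sides are continuous in the two vectors, which is the purpose of `cohTransform` as a
bounded map, and they agree on the dense set of Schwartz functions. -/
theorem inner_cohTransform (φ ψ : L2) :
    ⟪cohTransform L φ, cohTransform L ψ⟫_ℂ = frameConst L * ⟪φ, ψ⟫_ℂ := by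
  refine dense_range_toL2.induction_on₂
    (p := fun φ ψ => ⟪cohTransform L φ, cohTransform L ψ⟫_ℂ = frameConst L * ⟪φ, ψ⟫_ℂ) ?_ ?_ φ ψ
  · exact isClosed_eq (by fun_prop) (by fun_prop)
  · intro φ ψ
    rw [inner_cohTransform_eq_integral, integral_inner_coh_mul_inner_coh]

/-- The resolution of the identity in `L²`. -/
theorem integral_inner_coh (φ ψ : L2) :
    ∫ z, ⟪φ, toL2 (coh L z)⟫_ℂ * ⟪toL2 (coh L z), ψ⟫_ℂ = frameConst L * ⟪φ, ψ⟫_ℂ := by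
  rw [← inner_cohTransform_eq_integral, inner_cohTransform]

theorem ext_inner_coh {φ ψ : L2} (h : ∀ z, ⟪toL2 (coh L z), φ⟫_ℂ = ⟪toL2 (coh L z), ψ⟫_ℂ) :
    φ = ψ := by
  refine ext_inner_left ℂ fun χ => ?_
  have hκ : (frameConst L : ℂ) ≠ 0 := by exact_mod_cast (frameConst_pos L).ne'
  refine mul_left_cancel₀ hκ ?_
  rw [← integral_inner_coh, ← integral_inner_coh]
  simp_rw [h]

/-- Coherent states separate vectors; this is applied first to the images of coherent states, then
through the adjoints to arbitrary vectors. -/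
theorem ext_coh_coh {S T : L2 →L[ℂ] L2}
    (h : ∀ z w, ⟪toL2 (coh L z), S (toL2 (coh L w))⟫_ℂ = ⟪toL2 (coh L z), T (toL2 (coh L w))⟫_ℂ) :
    S = T := by
  have h1 : ∀ w, S (toL2 (coh L w)) = T (toL2 (coh L w)) := fun w =>
    ext_inner_coh L fun z => h z w
  ext1 φ
  refine ext_inner_right ℂ fun χ => ?_
  rw [← ContinuousLinearMap.adjoint_inner_right, ← ContinuousLinearMap.adjoint_inner_right]
  congr 1
  refine ext_inner_coh L fun z => ?_
  rw [ContinuousLinearMap.adjoint_inner_right, ContinuousLinearMap.adjoint_inner_right, h1]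

end

section

variable (L : R4 ≃L[ℝ] R2 × R2)

/-! ### Order functions -/

/-- The order function `(1 + ‖x‖²) ^ (m / 2)`. -/
def wt (m : ℝ) (x : R4) : ℝ := (1 + ‖x‖ ^ 2) ^ (m / 2)

theorem wt_pos (m : ℝ) (x : R4) : 0 < wt m x := by unfold wt; positivity

theorem wt_anti {m m' : ℝ} (h : m ≤ m') (x : R4) : wt m x ≤ wt m' x := by
  unfold wt
  exact Real.rpow_le_rpow_of_exponent_le (by nlinarith [sq_nonneg ‖x‖]) (by linarith)

theorem wt_add (m m' : ℝ) (x : R4) : wt (m + m') x = wt m x * wt m' x := by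
  unfold wt
  rw [add_div, Real.rpow_add (by positivity)]

theorem wt_zero (x : R4) : wt 0 x = 1 := by simp [wt]

/-- The Peetre inequality for negative powers: moving the base point by `y` costs a polynomial in
`y`, which the Gaussian window or the decay of `kern` absorbs. -/
theorem exists_wt_add_le {m : ℝ} (hm : m ≤ 0) :
    ∃ (C : ℝ) (K : ℕ), 0 ≤ C ∧ ∀ c y : R4, wt m (c + y) ≤ C * (1 + ‖y‖) ^ K * wt m c := by
  refine ⟨2 ^ (-m / 2), ⌈-m⌉₊, by positivity, fun c y => ?_⟩
  have h1 : 1 + ‖c‖ ^ 2 ≤ (2 * (1 + ‖y‖) ^ 2) * (1 + ‖c + y‖ ^ 2) := by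
    have h : ‖c‖ ≤ ‖c + y‖ + ‖y‖ := by
      simpa using norm_sub_le (c + y) y
    nlinarith [norm_nonneg c, norm_nonneg y, norm_nonneg (c + y), sq_nonneg (‖c + y‖ - ‖y‖),
      mul_nonneg (norm_nonneg y) (sq_nonneg ‖c + y‖), mul_self_nonneg (‖y‖ * ‖c + y‖),
      mul_le_mul h h (norm_nonneg c) (by positivity)]
  have hm2 : m / 2 ≤ 0 := by linarith
  have h2 : (2 * (1 + ‖y‖) ^ 2) ^ (m / 2) * wt m (c + y) ≤ wt m c := by
    unfold wt
    rw [← Real.mul_rpow (by positivity) (by positivity)]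
    exact Real.rpow_le_rpow_of_nonpos (by positivity) h1 hm2
  have h3 : wt m (c + y) = (2 * (1 + ‖y‖) ^ 2) ^ (-m / 2) *
      ((2 * (1 + ‖y‖) ^ 2) ^ (m / 2) * wt m (c + y)) := by
    rw [← mul_assoc, ← Real.rpow_add (by positivity)]
    simp [neg_div]
  have h4 : (2 * (1 + ‖y‖) ^ 2) ^ (-m / 2) ≤ 2 ^ (-m / 2) * (1 + ‖y‖) ^ ⌈-m⌉₊ := by
    rw [Real.mul_rpow (by norm_num) (by positivity)]
    gcongr
    rw [← Real.rpow_natCast, ← Real.rpow_natCast, ← Real.rpow_mul (by positivity)]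
    refine Real.rpow_le_rpow_of_exponent_le (by simp) ?_
    push_cast
    have := Nat.le_ceil (-m)
    linarith
  rw [h3]
  exact mul_le_mul h4 h2 (mul_nonneg (by positivity) (wt_pos _ _).le) (by positivity)

/-! ### The windowed Fourier transform of a symbol -/

/-- The vector representing `y ↦ sform y d`. -/
def sformVec (d : R4) : R4 :=
  (InnerProductSpace.toDual ℝ R4).symm
    (((innerSL ℝ (L d).1).comp ((ContinuousLinearMap.snd ℝ R2 R2).comp (L : R4 →L[ℝ] R2 × R2))) -
      ((innerSL ℝ (L d).2).comp ((ContinuousLinearMap.fst ℝ R2 R2).comp (L : R4 →L[ℝ] R2 × R2))))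

theorem inner_sformVec (d y : R4) : ⟪sformVec L d, y⟫_ℝ = sform L y d := by
  rw [sformVec, InnerProductSpace.toDual_symm_apply]
  simp [sform, symp, real_inner_comm]

theorem exists_norm_le_sformVec : ∃ K : ℝ, 1 ≤ K ∧ ∀ d, ‖d‖ ≤ K * ‖sformVec L d‖ := by
  set M := ‖(L.symm : R2 × R2 →L[ℝ] R4)‖ with hM
  have hL : ∀ v, ‖L.symm v‖ ≤ M * ‖v‖ := fun v => (L.symm : R2 × R2 →L[ℝ] R4).le_opNorm v
  refine ⟨M * M + 1, by nlinarith [mul_self_nonneg M], fun d => ?_⟩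
  have h1 : ‖d‖ ≤ M * ‖L d‖ := by simpa using hL (L d)
  have hnn := norm_nonneg (sformVec L d)
  have hM0 : 0 ≤ M := norm_nonneg _
  have h2 : ‖L d‖ ≤ M * ‖sformVec L d‖ := by
    -- The complex structure `(q, p) ↦ (-p, q)` applied to `L d`; pairing it with `d` gives the
    -- squared length, which expresses nondegeneracy of the form quantitatively.
    set y := L.symm (-(L d).2, (L d).1) with hy
    have e1 : ⟪sformVec L d, y⟫_ℝ = ‖(L d).1‖ ^ 2 + ‖(L d).2‖ ^ 2 := by
      rw [inner_sformVec]
      simp [sform, symp, hy]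
    have e2 : ‖y‖ ≤ M * ‖L d‖ := by
      refine (hL _).trans (le_of_eq ?_)
      rw [Prod.norm_def, Prod.norm_def, norm_neg, max_comm]
    have e3 : ‖L d‖ ^ 2 ≤ ‖(L d).1‖ ^ 2 + ‖(L d).2‖ ^ 2 := by
      rcases max_cases ‖(L d).1‖ ‖(L d).2‖ with ⟨h, _⟩ | ⟨h, _⟩ <;> rw [Prod.norm_def, h] <;>
        nlinarith [sq_nonneg ‖(L d).1‖, sq_nonneg ‖(L d).2‖]
    have e4 : ‖L d‖ ^ 2 ≤ ‖sformVec L d‖ * (M * ‖L d‖) :=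
      (e3.trans e1.ge).trans ((real_inner_le_norm _ _).trans (by gcongr))
    rcases (norm_nonneg (L d)).eq_or_lt with h | h
    · rw [← h]; positivity
    · nlinarith
  calc ‖d‖ ≤ M * (M * ‖sformVec L d‖) := h1.trans (by gcongr)
    _ ≤ _ := by nlinarith

theorem exists_invPow_sformVec_le (N : ℕ) :
    ∃ C : ℝ, 0 ≤ C ∧ ∀ d, invPow N (sformVec L d) ≤ C * invPow N d := by
  obtain ⟨K, hK, h⟩ := exists_norm_le_sformVec L
  have hK0 : 0 < K := by linarith
  refine ⟨K ^ N, by positivity, fun d => ?_⟩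
  unfold invPow
  rw [← div_eq_mul_inv, le_div_iff₀ (by positivity), ← inv_pow, ← mul_pow]
  gcongr
  rw [inv_mul_le_iff₀ (by positivity)]
  nlinarith [h d, norm_nonneg (sformVec L d)]

/-- The windowed Fourier transform of a symbol, at the point `c` and the frequency dual to `d`. -/
def kern (f : R4 → ℂ) (c d : R4) : ℂ :=
  ∫ y, f (c + y) * Complex.exp (Complex.I * (sform L y d : ℝ)) * phi L y

/-- All derivatives of `y ↦ f (c + y) * phi L y` up to order `N` are bounded by `wt m c` times an
integrable function, so integration by parts gives decay in the frequency, comparable to decay in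
`d` by nondegeneracy. -/
theorem exists_norm_kern_le {f : R4 → ℂ} {m : ℝ} (hm : m ≤ 0) (hf : ContDiff ℝ ∞ f)
    (hb : ∀ n : ℕ, ∃ C : ℝ, ∀ x, ‖iteratedFDeriv ℝ n f x‖ ≤ C * wt m x) (N : ℕ) :
    ∃ C : ℝ, 0 ≤ C ∧ ∀ c d, ‖kern L f c d‖ ≤ C * (wt m c * invPow N d) := by
  choose Cf hCf using hb
  obtain ⟨Cw, K, hCw, hw⟩ := exists_wt_add_le hm
  -- `K` powers pay for moving the weight from `c + y` to `c`; the other five exceed the dimension 4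
  -- and give integrability.
  obtain ⟨Cφ, hCφ, hφ⟩ := exists_norm_iteratedFDeriv_le_invPow (phi L) (K + 5) N
  obtain ⟨Cs, hCs, hs⟩ := exists_invPow_sformVec_le L N
  have hCf0 : ∀ n, 0 ≤ Cf n := fun n =>
    nonneg_of_mul_nonneg_left ((norm_nonneg _).trans (hCf n 0)) (wt_pos m 0)
  set CF := ∑ i ∈ Finset.range (N + 1), Cf i with hCF
  have hCF0 : 0 ≤ CF := Finset.sum_nonneg fun i _ => hCf0 i
  have hCFle : ∀ i ≤ N, Cf i ≤ CF := fun i hi =>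
    Finset.single_le_sum (fun j _ => hCf0 j) (Finset.mem_range.2 (Nat.lt_succ_of_le hi))
  have hint : Integrable (invPow 5 : R4 → ℝ) := integrable_invPow (by simp) volume
  set J := ∫ u : R4, invPow 5 u with hJ
  have hJ0 : 0 ≤ J := integral_nonneg fun u => (invPow_pos 5 u).le
  set A := 2 ^ N * (CF * Cw * Cφ) with hA
  have hF : ∀ c, ContDiff ℝ N (fun y => f (c + y) * phi L y) := fun c =>
    ((hf.of_le (by exact_mod_cast le_top)).comp (contDiff_const.add contDiff_id)).mul
      ((phi L).smooth N)
  have hder : ∀ j ≤ N, ∀ c y, ‖iteratedFDeriv ℝ j (fun y => f (c + y) * phi L y) y‖ ≤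
      A * wt m c * invPow 5 y := by
    intro j hj c y
    have hmul := norm_iteratedFDeriv_mul_le (𝕜 := ℝ) (f := fun y => f (c + y)) (g := phi L)
      (N := j) ((hf.of_le (by exact_mod_cast le_top)).comp (contDiff_const.add contDiff_id))
      ((phi L).smooth j) y (n := j) le_rfl
    refine hmul.trans ?_
    have hterm : ∀ i ∈ Finset.range (j + 1),
        (j.choose i : ℝ) * ‖iteratedFDeriv ℝ i (fun y => f (c + y)) y‖ *
          ‖iteratedFDeriv ℝ (j - i) (phi L) y‖ ≤
        (j.choose i : ℝ) * (CF * Cw * Cφ * wt m c * invPow 5 y) := by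
      intro i hi
      rw [iteratedFDeriv_comp_add_left, mul_assoc]
      refine mul_le_mul_of_nonneg_left ?_ (by positivity)
      have hi' : i ≤ N := (Nat.lt_succ_iff.1 (Finset.mem_range.1 hi)).trans hj
      have hw0 := (wt_pos m c).le
      calc _ ≤ (CF * (Cw * (1 + ‖y‖) ^ K * wt m c)) * (Cφ * invPow (K + 5) y) := by
            refine mul_le_mul ?_ (hφ (j - i) ((Nat.sub_le j i).trans hj) y) (norm_nonneg _)
              (by positivity)
            exact (hCf i (c + y)).trans
              (mul_le_mul (hCFle i hi') (hw c y) (wt_pos _ _).le hCF0)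
        _ = CF * Cw * Cφ * wt m c * invPow 5 y * ((1 + ‖y‖) ^ K * invPow K y) := by
            rw [invPow_add]; ring
        _ = _ := by
            have : (1 + ‖y‖) ^ K * invPow K y = 1 := mul_inv_cancel₀ (by positivity)
            rw [this, mul_one]
    refine (Finset.sum_le_sum hterm).trans ?_
    rw [← Finset.sum_mul]
    have : (∑ i ∈ Finset.range (j + 1), (j.choose i : ℝ)) = 2 ^ j := by
      exact_mod_cast Nat.sum_range_choose j
    rw [this, hA]
    have h3 := (invPow_pos 5 y).le
    have h4 := (wt_pos m c).le
    calc (2 : ℝ) ^ j * (CF * Cw * Cφ * wt m c * invPow 5 y)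
        ≤ 2 ^ N * (CF * Cw * Cφ * wt m c * invPow 5 y) := by gcongr; norm_num
      _ = _ := by ring
  have hintd : ∀ j ≤ N, ∀ c,
      Integrable (fun y => ‖iteratedFDeriv ℝ j (fun y => f (c + y) * phi L y) y‖) := by
    intro j hj c
    refine (hint.const_mul (A * wt m c)).mono' ?_ (Eventually.of_forall fun y => ?_)
    · exact ((hF c).continuous_iteratedFDeriv (by exact_mod_cast hj)).norm.aestronglyMeasurable
    · rw [norm_norm]; exact hder j hj c y
  refine ⟨2 ^ N * (2 * ((4 * Real.pi) ^ N * ((N + 1) * (A * J)))) * Cs, by positivity,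
    fun c d => ?_⟩
  have hmain := norm_integral_cexp_inner_mul_le N (hF c) (B := A * wt m c * J)
    (fun j hj => hintd j hj c)
    (fun j hj => by
      rw [hJ, ← integral_const_mul]
      exact integral_mono (hintd j hj c) (hint.const_mul _) fun y => hder j hj c y)
    (sformVec L d)
  have heq : kern L f c d = ∫ y, Complex.exp (Complex.I * (⟪sformVec L d, y⟫_ℝ : ℝ)) *
      (f (c + y) * phi L y) := by
    unfold kern
    refine integral_congr_ae (Eventually.of_forall fun y => ?_)
    simp only [inner_sformVec]
    ring
  rw [heq]
  refine hmain.trans ?_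
  have hw0 := (wt_pos m c).le
  calc _ ≤ 2 ^ N * (2 * ((4 * Real.pi) ^ N * ((N + 1) * (A * wt m c * J)))) *
        (Cs * invPow N d) := by
        refine mul_le_mul_of_nonneg_left (hs d) ?_
        positivity
    _ = _ := by ring

/-- The matrix element of the Weyl operator of `f` between coherent states, up to the
normalization of `Δ̂`. -/
def cohKernel (f : R4 → ℂ) (z w : R4) : ℂ := ∫ x, f x * wig L (coh L z) (coh L w) x

/-- The displaced parity matrix element is a Gaussian in `x` centred at the midpoint, times a
character whose frequency is given by `z - w`. Translating the integral to the midpoint leaves only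
a phase outside. -/
theorem cohKernel_eq (f : R4 → ℂ) (z w : R4) :
    cohKernel L f z w = Complex.exp (Complex.I * (-(sform L z w / 2) : ℝ)) *
      kern L f ((2⁻¹ : ℝ) • (z + w)) (z - w) := by
  rw [cohKernel, kern, ← integral_const_mul,
    ← integral_add_left_eq_self _ ((2⁻¹ : ℝ) • (z + w))]
  refine integral_congr_ae (Eventually.of_forall fun y => ?_)
  simp only [wig_coh_coh, add_sub_cancel_left]
  have : Complex.exp (Complex.I * (sform L ((2⁻¹ : ℝ) • (z + w) + y) (z - w) +
      sform L z w / 2 : ℝ)) = Complex.exp (Complex.I * (-(sform L z w / 2) : ℝ)) *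
        Complex.exp (Complex.I * (sform L y (z - w) : ℝ)) := by
    rw [← Complex.exp_add, ← mul_add, ← Complex.ofReal_add]
    congr 3
    simp only [sform_add_left, sform_smul_left, sform_sub_right, sform_self]
    rw [sform_swap L w z]
    ring
  rw [this]
  ring

end

section

variable (L : R4 ≃L[ℝ] R2 × R2)

/-! ### Integrals of sheared products -/

section Shear

variable {X : Type*} [MeasurableSpace X] {μ : Measure X} [SFinite μ] {t : X → R4}

theorem measurePreserving_shear (ht : Measurable t) :
    MeasurePreserving (fun p : X × R4 => (p.1, p.2 - t p.1)) (μ.prod volume) (μ.prod volume) :=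
  (MeasurePreserving.id μ).skew_product (g := fun x y => y - t x)
    (measurable_snd.sub (ht.comp measurable_fst))
    (Eventually.of_forall fun x => (measurePreserving_sub_right volume (t x)).map_eq)

theorem integrable_mul_shear (ht : Measurable t) {a : X → ℝ} (ha : Integrable a μ) {b : R4 → ℝ}
    (hb : Integrable b) :
    Integrable (fun p : X × R4 => a p.1 * b (p.2 - t p.1)) (μ.prod volume) :=
  (measurePreserving_shear ht).integrable_comp_of_integrable (ha.mul_prod hb)

theorem integral_mul_shear (ht : Measurable t) {a : X → ℝ} (ha : Integrable a μ) {b : R4 → ℝ}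
    (hb : Integrable b) :
    ∫ p : X × R4, a p.1 * b (p.2 - t p.1) ∂(μ.prod volume) = (∫ x, a x ∂μ) * ∫ y, b y := by
  rw [integral_prod _ (integrable_mul_shear ht ha hb)]
  simp_rw [integral_const_mul]
  have : ∀ x, ∫ y, b (y - t x) = ∫ y, b y := fun x => integral_sub_right_eq_self b (t x)
  simp_rw [this, integral_mul_const]

end Shear

/-! ### Operators with off-diagonal decay in the coherent state representation -/

/-- The form `∫∫ ⟨φ, g_z⟩ K(z, w) ⟨g_w, ψ⟩ dz dw`. -/
def kernelForm (K : R4 × R4 → ℂ) (φ ψ : L2) : ℂ :=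
  ∫ p : R4 × R4, ⟪φ, toL2 (coh L p.1)⟫_ℂ * K p * ⟪toL2 (coh L p.2), ψ⟫_ℂ

/-- Cauchy–Schwarz recovered from its weighted arithmetic-geometric form: take `t = q / p`, or a
limit in `t` when `p` or `q` vanishes. -/
theorem le_mul_of_forall_le_amgm {X M p q : ℝ} (hp : 0 ≤ p) (hq : 0 ≤ q)
    (h : ∀ t : ℝ, 0 < t → X ≤ M / 2 * (t * p ^ 2 + t⁻¹ * q ^ 2)) : X ≤ M * p * q := by
  have hlim : Tendsto (fun t : ℝ => M / 2 * (t * p ^ 2 + t⁻¹ * q ^ 2)) (𝓝 1)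
    (𝓝 (M / 2 * (1 * p ^ 2 + 1⁻¹ * q ^ 2))) := by
    refine Tendsto.const_mul _ (Tendsto.add (tendsto_id.mul_const _) (Tendsto.mul_const _ ?_))
    exact tendsto_inv₀ one_ne_zero
  rcases hp.eq_or_lt with rfl | hp
  · have h0 : Tendsto (fun t : ℝ => M / 2 * (t * 0 ^ 2 + t⁻¹ * q ^ 2)) atTop
        (𝓝 (M / 2 * (0 + 0 * q ^ 2))) := by
      refine Tendsto.const_mul _ (Tendsto.add (by simp) (tendsto_inv_atTop_zero.mul_const _))
    have := ge_of_tendsto h0 ((eventually_gt_atTop 0).mono fun t ht => h t ht)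
    simpa using this
  rcases hq.eq_or_lt with rfl | hq
  · have h0 : Tendsto (fun t : ℝ => M / 2 * (t⁻¹ * p ^ 2 + t⁻¹⁻¹ * 0 ^ 2)) atTop
        (𝓝 (M / 2 * (0 * p ^ 2 + 0))) := by
      refine Tendsto.const_mul _ (Tendsto.add (tendsto_inv_atTop_zero.mul_const _) (by simp))
    have := ge_of_tendsto h0 ((eventually_gt_atTop 0).mono fun t ht => h t⁻¹ (inv_pos.2 ht))
    simpa using this
  · refine (h (q / p) (by positivity)).trans (le_of_eq ?_)
    field_simp
    ring

/-! ### The Schur test in the coherent state representation -/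

section Schur

variable {K : R4 × R4 → ℂ} {B : ℝ} {η : R4 → ℝ}

theorem integrable_norm_sq_fst_mul (hη : Integrable η) (φ : L2) :
    Integrable (fun p : R4 × R4 => ‖⟪toL2 (coh L p.1), φ⟫_ℂ‖ ^ 2 * η (p.1 - p.2)) := by
  have h := integrable_mul_shear (X := R4) (μ := volume) (t := id) measurable_id
    (integrable_norm_sq_inner_coh L φ) hη.comp_neg
  simpa using! h

theorem integral_norm_sq_fst_mul_le (hη : Integrable η) (hη0 : ∀ x, 0 ≤ η x) (φ : L2) :
    ∫ p : R4 × R4, ‖⟪toL2 (coh L p.1), φ⟫_ℂ‖ ^ 2 * η (p.1 - p.2) ≤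
      frameConst L * ‖φ‖ ^ 2 * ∫ y, η y := by
  have h := integral_mul_shear (X := R4) (μ := volume) (t := id) measurable_id
    (integrable_norm_sq_inner_coh L φ) hη.comp_neg
  simp only [id, neg_sub] at h
  rw [Measure.volume_eq_prod, h, integral_neg_eq_self]
  exact mul_le_mul_of_nonneg_right (integral_norm_sq_inner_coh_le L φ) (integral_nonneg hη0)

theorem integrable_norm_sq_snd_mul (hη : Integrable η) (φ : L2) :
    Integrable (fun p : R4 × R4 => ‖⟪toL2 (coh L p.2), φ⟫_ℂ‖ ^ 2 * η (p.1 - p.2)) := by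
  have h := (integrable_norm_sq_fst_mul L hη.comp_neg φ).swap
  simpa [Function.comp_def] using! h

theorem integral_norm_sq_snd_mul_le (hη : Integrable η) (hη0 : ∀ x, 0 ≤ η x) (φ : L2) :
    ∫ p : R4 × R4, ‖⟪toL2 (coh L p.2), φ⟫_ℂ‖ ^ 2 * η (p.1 - p.2) ≤
      frameConst L * ‖φ‖ ^ 2 * ∫ y, η y := by
  have h := integral_norm_sq_fst_mul_le L hη.comp_neg (fun x => hη0 _) φ
  rw [integral_neg_eq_self] at h
  refine le_trans (le_of_eq ?_) h
  rw [Measure.volume_eq_prod, ← integral_prod_swap]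
  simp

theorem norm_kernelForm_integrand_le (hK : ∀ p, ‖K p‖ ≤ B * η (p.1 - p.2))
    (φ ψ : L2) {t : ℝ} (ht : 0 < t) (p : R4 × R4) :
    ‖⟪φ, toL2 (coh L p.1)⟫_ℂ * K p * ⟪toL2 (coh L p.2), ψ⟫_ℂ‖ ≤
      B / 2 * (t * (‖⟪toL2 (coh L p.1), φ⟫_ℂ‖ ^ 2 * η (p.1 - p.2)) +
        t⁻¹ * (‖⟪toL2 (coh L p.2), ψ⟫_ℂ‖ ^ 2 * η (p.1 - p.2))) := by
  rw [norm_mul, norm_mul, norm_inner_symm]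
  set a := ‖⟪toL2 (coh L p.1), φ⟫_ℂ‖
  set b := ‖⟪toL2 (coh L p.2), ψ⟫_ℂ‖
  have ha : 0 ≤ a := norm_nonneg _
  have hb : 0 ≤ b := norm_nonneg _
  have hab : a * b ≤ (t * a ^ 2 + t⁻¹ * b ^ 2) / 2 := by
    have h : 0 ≤ t⁻¹ * (t * a - b) ^ 2 := by positivity
    have h' : t⁻¹ * (t * a - b) ^ 2 = t * a ^ 2 - 2 * (a * b) + t⁻¹ * b ^ 2 := by
      field_simp
      ring
    linarith
  calc a * ‖K p‖ * b = (a * b) * ‖K p‖ := by ring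
    _ ≤ ((t * a ^ 2 + t⁻¹ * b ^ 2) / 2) * (B * η (p.1 - p.2)) :=
        mul_le_mul hab (hK p) (norm_nonneg _) (by positivity)
    _ = _ := by ring

theorem integrable_kernelForm_integrand (hKm : AEStronglyMeasurable K volume)
    (hK : ∀ p, ‖K p‖ ≤ B * η (p.1 - p.2)) (hη : Integrable η)
    (φ ψ : L2) :
    Integrable (fun p : R4 × R4 =>
      ⟪φ, toL2 (coh L p.1)⟫_ℂ * K p * ⟪toL2 (coh L p.2), ψ⟫_ℂ) := by
  have hc := continuous_toL2_coh L
  refine Integrable.mono' (((integrable_norm_sq_fst_mul L hη φ).const_mul 1).add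
    ((integrable_norm_sq_snd_mul L hη ψ).const_mul 1⁻¹) |>.const_mul (B / 2)) ?_
    (Eventually.of_forall fun p => norm_kernelForm_integrand_le L hK φ ψ one_pos p)
  refine AEStronglyMeasurable.mul (AEStronglyMeasurable.mul ?_ hKm) ?_
  · exact (continuous_const.inner (hc.comp continuous_fst)).aestronglyMeasurable
  · exact ((hc.comp continuous_snd).inner continuous_const).aestronglyMeasurable

/-- Schur's test: split the product of the two coherent amplitudes by weighted AM–GM, integrate `η
(z - w)` in the free variable, and optimize the weight. -/
theorem norm_kernelForm_le
    (hK : ∀ p, ‖K p‖ ≤ B * η (p.1 - p.2)) (hB : 0 ≤ B) (hη : Integrable η) (hη0 : ∀ x, 0 ≤ η x)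
    (φ ψ : L2) :
    ‖kernelForm L K φ ψ‖ ≤ B * (frameConst L * ∫ y, η y) * ‖φ‖ * ‖ψ‖ := by
  refine le_mul_of_forall_le_amgm (norm_nonneg _) (norm_nonneg _) fun t ht => ?_
  have hi1 := (integrable_norm_sq_fst_mul L hη φ).const_mul t
  have hi2 := (integrable_norm_sq_snd_mul L hη ψ).const_mul t⁻¹
  calc ‖kernelForm L K φ ψ‖ ≤ ∫ p : R4 × R4, B / 2 *
        (t * (‖⟪toL2 (coh L p.1), φ⟫_ℂ‖ ^ 2 * η (p.1 - p.2)) +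
          t⁻¹ * (‖⟪toL2 (coh L p.2), ψ⟫_ℂ‖ ^ 2 * η (p.1 - p.2))) :=
        norm_integral_le_of_norm_le ((hi1.add hi2).const_mul _)
          (Eventually.of_forall fun p => norm_kernelForm_integrand_le L hK φ ψ ht p)
    _ = B / 2 * (t * (∫ p : R4 × R4, ‖⟪toL2 (coh L p.1), φ⟫_ℂ‖ ^ 2 * η (p.1 - p.2)) +
          t⁻¹ * ∫ p : R4 × R4, ‖⟪toL2 (coh L p.2), ψ⟫_ℂ‖ ^ 2 * η (p.1 - p.2)) := by
        rw [integral_const_mul, integral_add hi1 hi2, integral_const_mul, integral_const_mul]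
    _ ≤ B / 2 * (t * (frameConst L * ‖φ‖ ^ 2 * ∫ y, η y) +
          t⁻¹ * (frameConst L * ‖ψ‖ ^ 2 * ∫ y, η y)) := by
        gcongr
        · exact integral_norm_sq_fst_mul_le L hη hη0 φ
        · exact integral_norm_sq_snd_mul_le L hη hη0 ψ
    _ = _ := by ring

/-- A kernel with integrable off-diagonal decay in the coherent state representation defines a
bounded operator. -/
theorem exists_operator_of_kernel (hKm : AEStronglyMeasurable K volume)
    (hK : ∀ p, ‖K p‖ ≤ B * η (p.1 - p.2)) (hB : 0 ≤ B) (hη : Integrable η)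
    (hη0 : ∀ x, 0 ≤ η x) :
    ∃ T : L2 →L[ℂ] L2, ∀ φ ψ, ⟪φ, T ψ⟫_ℂ = kernelForm L K φ ψ := by
  have hi := integrable_kernelForm_integrand L hKm hK hη
  let Λ : L2 →ₗ⋆[ℂ] L2 →ₗ[ℂ] ℂ := LinearMap.mk₂'ₛₗ (starRingEnd ℂ) (RingHom.id ℂ)
    (kernelForm L K)
    (fun φ φ' ψ => by
      rw [kernelForm, kernelForm, kernelForm, ← integral_add (hi φ ψ) (hi φ' ψ)]
      refine integral_congr_ae (Eventually.of_forall fun p => ?_)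
      simp only [inner_add_left]
      ring)
    (fun c φ ψ => by
      rw [kernelForm, kernelForm, smul_eq_mul, ← integral_const_mul]
      refine integral_congr_ae (Eventually.of_forall fun p => ?_)
      simp only [inner_smul_left]
      ring)
    (fun φ ψ ψ' => by
      rw [kernelForm, kernelForm, kernelForm, ← integral_add (hi φ ψ) (hi φ ψ')]
      refine integral_congr_ae (Eventually.of_forall fun p => ?_)
      simp only [inner_add_right]
      ring)
    (fun c φ ψ => by
      rw [kernelForm, kernelForm, RingHom.id_apply, smul_eq_mul, ← integral_const_mul]
      refine integral_congr_ae (Eventually.of_forall fun p => ?_)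
      simp only [inner_smul_right]
      ring)
  let Λc : L2 →L⋆[ℂ] L2 →L[ℂ] ℂ := Λ.mkContinuous₂ (B * (frameConst L * ∫ y, η y))
    (norm_kernelForm_le L hK hB hη hη0)
  refine ⟨ContinuousLinearMap.adjoint (InnerProductSpace.continuousLinearMapOfBilin Λc),
    fun φ ψ => ?_⟩
  rw [ContinuousLinearMap.adjoint_inner_right,
    InnerProductSpace.continuousLinearMapOfBilin_apply]
  rfl

end Schur

theorem norm_le_of_inner_eq_kernelForm {K : R4 × R4 → ℂ} {B : ℝ} {η : R4 → ℝ}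
    (hK : ∀ p, ‖K p‖ ≤ B * η (p.1 - p.2)) (hB : 0 ≤ B) (hη : Integrable η)
    (hη0 : ∀ x, 0 ≤ η x) {T : L2 →L[ℂ] L2} (hT : ∀ φ ψ, ⟪φ, T ψ⟫_ℂ = kernelForm L K φ ψ) :
    ‖T‖ ≤ B * (frameConst L * ∫ y, η y) := by
  have hJ : 0 ≤ ∫ y, η y := integral_nonneg hη0
  have hκ := (frameConst_pos L).le
  refine T.opNorm_le_bound (by positivity) fun ψ => ?_
  have h := norm_kernelForm_le L hK hB hη hη0 (T ψ) ψ
  rw [← hT, inner_self_eq_norm_sq_to_K] at h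
  simp only [norm_pow, RCLike.norm_ofReal, abs_norm] at h
  rcases (norm_nonneg (T ψ)).eq_or_lt with h0 | h0
  · rw [← h0]; positivity
  · nlinarith

/-! ### Existence of Weyl operators -/

/-- The resolution of the identity inserted on both sides of the displaced parity. -/
theorem frameConst_sq_mul_wig (φ ψ : 𝓢(R2, ℂ)) (x : R4) :
    (frameConst L : ℂ) ^ 2 * wig L φ ψ x = ∫ z, ∫ w, ⟪toL2 φ, toL2 (coh L z)⟫_ℂ *
      wig L (coh L z) (coh L w) x * ⟪toL2 (coh L w), toL2 ψ⟫_ℂ := by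
  rw [sq, mul_assoc, wig_eq_inner, ← integral_inner_coh_mul_inner_coh L φ, ← integral_const_mul]
  refine integral_congr_ae (Eventually.of_forall fun z => ?_)
  simp only
  rw [inner_dispParity_right, mul_left_comm, ← integral_inner_coh_mul_inner_coh L,
    ← integral_const_mul]
  refine integral_congr_ae (Eventually.of_forall fun w => ?_)
  simp only [wig_eq_inner, inner_dispParity_right, mul_assoc]

theorem continuous_wig_coh :
    Continuous (fun p : (R4 × R4) × R4 => wig L (coh L p.1.1) (coh L p.1.2) p.2) := by
  simp_rw [wig_coh_coh]
  have h1 := (phi L).continuous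
  have h2 : Continuous (fun p : (R4 × R4) × R4 => sform L p.2 (p.1.1 - p.1.2)) :=
    (continuous_sform L).comp
      (by fun_prop : Continuous fun p : (R4 × R4) × R4 => (p.2, p.1.1 - p.1.2))
  have h3 : Continuous (fun p : (R4 × R4) × R4 => sform L p.1.1 p.1.2) :=
    (continuous_sform L).comp continuous_fst
  fun_prop

theorem norm_wig_coh_coh (z w x : R4) :
    ‖wig L (coh L z) (coh L w) x‖ = ‖phi L (x - (2⁻¹ : ℝ) • (z + w))‖ := by
  rw [wig_coh_coh, norm_mul, norm_cexp_I_mul, one_mul]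

/-- The weak integral of `f` against the displaced parity operators, in the coherent state
representation. -/
theorem integral_mul_wig {f : R4 → ℂ} (hf : Continuous f) {B : ℝ} (hB : ∀ x, ‖f x‖ ≤ B)
    (φ ψ : 𝓢(R2, ℂ)) :
    (frameConst L : ℂ) ^ 2 * ∫ x, f x * wig L φ ψ x =
      kernelForm L (fun p => cohKernel L f p.1 p.2) (toL2 φ) (toL2 ψ) := by
  have hB0 : 0 ≤ B := (norm_nonneg _).trans (hB 0)
  have hc := continuous_toL2_coh L
  let G : (R4 × R4) × R4 → ℂ := fun p => ⟪toL2 φ, toL2 (coh L p.1.1)⟫_ℂ *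
    (f p.2 * wig L (coh L p.1.1) (coh L p.1.2) p.2) * ⟪toL2 (coh L p.1.2), toL2 ψ⟫_ℂ
  have hGc : Continuous G := by
    refine Continuous.mul (Continuous.mul ?_ ?_) ?_
    · exact continuous_const.inner (hc.comp (continuous_fst.comp continuous_fst))
    · exact (hf.comp continuous_snd).mul (continuous_wig_coh L)
    · exact (hc.comp (continuous_snd.comp continuous_fst)).inner continuous_const
  have hab : Integrable (fun p : R4 × R4 =>
      ‖⟪toL2 (coh L p.1), toL2 φ⟫_ℂ‖ * ‖⟪toL2 (coh L p.2), toL2 ψ⟫_ℂ‖) :=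
    (integrable_inner_coh L φ).norm.mul_prod (integrable_inner_coh L ψ).norm
  have hG : Integrable G (volume.prod volume) := by
    -- Absolute convergence of the triple integral: the overlaps with Schwartz vectors are
    -- integrable in `z` and `w`, and for fixed `z`, `w` the rest is a bounded function times a
    -- Gaussian in `x` centred at the midpoint.
    have hsh := integrable_mul_shear (t := fun p : R4 × R4 => (2⁻¹ : ℝ) • (p.1 + p.2))
      (by fun_prop) hab ((phi L).integrable (μ := volume)).norm
    refine (hsh.const_mul B).mono' hGc.aestronglyMeasurable (Eventually.of_forall fun p => ?_)
    simp only [G, norm_mul, norm_wig_coh_coh, norm_inner_symm (toL2 φ)]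
    calc _ = ‖f p.2‖ * (‖⟪toL2 (coh L p.1.1), toL2 φ⟫_ℂ‖ * ‖⟪toL2 (coh L p.1.2), toL2 ψ⟫_ℂ‖ *
          ‖phi L (p.2 - (2⁻¹ : ℝ) • (p.1.1 + p.1.2))‖) := by ring
      _ ≤ _ := mul_le_mul_of_nonneg_right (hB p.2) (by positivity)
  have h1 : ∫ p, G p ∂(volume.prod volume) =
      kernelForm L (fun p => cohKernel L f p.1 p.2) (toL2 φ) (toL2 ψ) := by
    rw [integral_prod _ hG, kernelForm]
    refine integral_congr_ae (Eventually.of_forall fun p => ?_)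
    simp only [G, cohKernel]
    rw [integral_mul_const, integral_const_mul]
  rw [← h1, integral_prod_symm _ hG, ← integral_const_mul]
  refine integral_congr_ae ?_
  filter_upwards [hG.prod_left_ae] with x hx
  rw [mul_left_comm, frameConst_sq_mul_wig, Measure.volume_eq_prod, integral_prod _ hx,
    ← integral_const_mul]
  refine integral_congr_ae (Eventually.of_forall fun z => ?_)
  simp only [← integral_const_mul]
  refine integral_congr_ae (Eventually.of_forall fun w => ?_)
  simp only [G]
  ring

end

section

variable (L : R4 ≃L[ℝ] R2 × R2)

/-! ### Symbols and their partial derivatives -/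

/-- Symbols all of whose derivatives are bounded by the order function `(1 + ‖x‖²) ^ (m / 2)`. -/
def IsSymbol (m : ℝ) (f : R4 → ℂ) : Prop :=
  ContDiff ℝ ∞ f ∧ ∀ n : ℕ, ∃ C : ℝ, ∀ x, ‖iteratedFDeriv ℝ n f x‖ ≤ C * wt m x

/-- The `j`-th partial derivative. -/
def partialD (j : Fin 4) (f : R4 → ℂ) (x : R4) : ℂ := fderiv ℝ f x (EuclideanSpace.single j 1)

/-- The `j`-th coordinate functional, with complex values. -/
def coordC (j : Fin 4) : R4 →L[ℝ] ℂ :=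
  Complex.ofRealCLM.comp (EuclideanSpace.proj j : R4 →L[ℝ] ℝ)

theorem coordC_apply (j : Fin 4) (x : R4) : coordC j x = x j := rfl

theorem norm_coordC_le (j : Fin 4) : ‖coordC j‖ ≤ 1 := by
  refine ContinuousLinearMap.opNorm_le_bound _ zero_le_one fun x => ?_
  rw [coordC_apply, Complex.norm_real, one_mul]
  exact PiLp.norm_apply_le x j

theorem eq_sum_coordC (M : R4 →L[ℝ] ℂ) :
    M = ∑ j, M (EuclideanSpace.single j 1) • coordC j := by
  ext x
  conv_lhs => rw [← (EuclideanSpace.basisFun (Fin 4) ℝ).sum_repr x]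
  simp [coordC_apply, mul_comm]

theorem norm_iteratedFDeriv_partialD_le {f : R4 → ℂ} (hf : ContDiff ℝ ∞ f) (j : Fin 4) (n : ℕ)
    (x : R4) : ‖iteratedFDeriv ℝ n (partialD j f) x‖ ≤ ‖iteratedFDeriv ℝ (n + 1) f x‖ := by
  have hfd : ContDiff ℝ ∞ (fderiv ℝ f) := hf.fderiv_right (m := ∞) le_rfl
  have h := (ContinuousLinearMap.apply ℝ ℂ
    (EuclideanSpace.single j (1 : ℝ) : R4)).norm_iteratedFDeriv_comp_left
    (hfd.contDiffAt (x := x)) (n := n) (by exact_mod_cast le_top)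
  refine h.trans ?_
  rw [norm_iteratedFDeriv_fderiv]
  refine mul_le_of_le_one_left (norm_nonneg _) ?_
  refine ContinuousLinearMap.opNorm_le_bound _ zero_le_one fun M => ?_
  simpa using M.le_opNorm (EuclideanSpace.single j (1 : ℝ) : R4)

theorem contDiff_partialD {f : R4 → ℂ} (hf : ContDiff ℝ ∞ f) (j : Fin 4) :
    ContDiff ℝ ∞ (partialD j f) :=
  (hf.fderiv_right (m := ∞) le_rfl).clm_apply contDiff_const

theorem IsSymbol.partialD {m : ℝ} {f : R4 → ℂ} (hf : IsSymbol m f) (j : Fin 4) :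
    IsSymbol m (partialD j f) := by
  refine ⟨contDiff_partialD hf.1 j, fun n => ?_⟩
  obtain ⟨C, hC⟩ := hf.2 (n + 1)
  exact ⟨C, fun x => (norm_iteratedFDeriv_partialD_le hf.1 j n x).trans (hC x)⟩

theorem IsSymbol.mono {m m' : ℝ} (h : m ≤ m') {f : R4 → ℂ} (hf : IsSymbol m f) :
    IsSymbol m' f := by
  refine ⟨hf.1, fun n => ?_⟩
  obtain ⟨C, hC⟩ := hf.2 n
  have hC0 : 0 ≤ C := nonneg_of_mul_nonneg_left ((norm_nonneg _).trans (hC 0)) (wt_pos m 0)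
  exact ⟨C, fun x => (hC x).trans (mul_le_mul_of_nonneg_left (wt_anti h x) hC0)⟩

theorem IsSymbol.exists_norm_le {f : R4 → ℂ} (hf : IsSymbol 0 f) : ∃ B : ℝ, ∀ x, ‖f x‖ ≤ B := by
  obtain ⟨C, hC⟩ := hf.2 0
  exact ⟨C, fun x => by simpa [wt_zero] using hC x⟩

theorem IsSymbol.continuous {m : ℝ} {f : R4 → ℂ} (hf : IsSymbol m f) : Continuous f :=
  hf.1.continuous

/-- Estimate of higher derivatives through the derivatives of the partial derivatives. -/
theorem norm_iteratedFDeriv_succ_le {F : R4 → ℂ} {A : Fin 4 → R4 → ℂ}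
    (hF : ∀ x, HasFDerivAt F (∑ j, A j x • coordC j) x) {n : ℕ} (hA : ∀ j, ContDiff ℝ n (A j))
    (x : R4) : ‖iteratedFDeriv ℝ (n + 1) F x‖ ≤ ∑ j, ‖iteratedFDeriv ℝ n (A j) x‖ := by
  have hfd : fderiv ℝ F = fun x => ∑ j, A j x • coordC j := by
    ext1 x; exact (hF x).fderiv
  have hsm : ∀ j, ContDiff ℝ n (fun x => A j x • coordC j) := fun j =>
    (hA j).smul contDiff_const
  rw [← norm_iteratedFDeriv_fderiv, hfd, iteratedFDeriv_fun_sum_apply fun j _ => (hsm j).contDiffAt]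
  refine (norm_sum_le _ _).trans (Finset.sum_le_sum fun j _ => ?_)
  have h := (((ContinuousLinearMap.id ℝ ℂ).smulRight (coordC j) :
    ℂ →L[ℝ] R4 →L[ℝ] ℂ)).norm_iteratedFDeriv_comp_left
    ((hA j).contDiffAt (x := x)) (n := n) le_rfl
  refine h.trans (mul_le_of_le_one_left (norm_nonneg _) ?_)
  refine ContinuousLinearMap.opNorm_le_bound _ zero_le_one fun a => ?_
  rw [ContinuousLinearMap.smulRight_apply, norm_smul, one_mul]
  exact mul_le_of_le_one_right (norm_nonneg _) (norm_coordC_le j)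

/-! ### Regularity of the windowed Fourier transform -/

theorem continuous_kern {f : R4 → ℂ} (hf : Continuous f) {B : ℝ} (hB : ∀ x, ‖f x‖ ≤ B) :
    Continuous (fun p : R4 × R4 => kern L f p.1 p.2) := by
  unfold kern
  have hφ := (phi L).continuous
  have hs : ∀ y, Continuous (fun p : R4 × R4 => sform L y p.2) := fun y =>
    (continuous_sform L).comp (by fun_prop : Continuous fun p : R4 × R4 => (y, p.2))
  have hs' : ∀ d, Continuous (fun y : R4 => sform L y d) := fun d =>
    (continuous_sform L).comp (by fun_prop : Continuous fun y : R4 => (y, d))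
  refine continuous_of_dominated (bound := fun y => B * ‖phi L y‖) (fun p => ?_)
    (fun p => Eventually.of_forall fun y => ?_)
    (((phi L).integrable (μ := volume)).norm.const_mul B) (Eventually.of_forall fun y => ?_)
  · have := hs' p.2
    exact Continuous.aestronglyMeasurable (by fun_prop)
  · rw [norm_mul, norm_mul, norm_cexp_I_mul, mul_one]
    exact mul_le_mul_of_nonneg_right (hB _) (norm_nonneg _)
  · have := hs y
    fun_prop

/-- The point `c` enters only through `f (c + y)`, so differentiation under the integral falls on
the symbol alone and stays within windowed transforms of symbols. -/
theorem hasFDerivAt_kern {f : R4 → ℂ} (hf : IsSymbol 0 f) (c d : R4) :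
    HasFDerivAt (fun c => kern L f c d) (∑ j, kern L (partialD j f) c d • coordC j) c := by
  obtain ⟨B, hB⟩ := hf.exists_norm_le
  obtain ⟨B', hB'⟩ := hf.2 1
  simp only [wt_zero, mul_one, norm_iteratedFDeriv_one] at hB'
  have hφ := (phi L).continuous
  have hfc := hf.continuous
  have hfd : Continuous (fderiv ℝ f) := hf.1.continuous_fderiv (by simp)
  have hs' : Continuous (fun y : R4 => sform L y d) :=
    (continuous_sform L).comp (by fun_prop : Continuous fun y : R4 => (y, d))
  let E : R4 → ℂ := fun y => Complex.exp (Complex.I * (sform L y d : ℝ)) * phi L y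
  have hE : Continuous E := by unfold E; fun_prop
  have hEn : ∀ y, ‖E y‖ = ‖phi L y‖ := fun y => by
    simp only [E]; rw [norm_mul, norm_cexp_I_mul, one_mul]
  have hEi : Integrable E := ((phi L).integrable (μ := volume)).norm.mono'
    hE.aestronglyMeasurable (Eventually.of_forall fun y => (hEn y).le)
  have hi : ∀ c, Integrable (fun y => E y * f (c + y)) := fun c =>
    hEi.mul_bdd (c := B) (Continuous.aestronglyMeasurable (by fun_prop))
      (Eventually.of_forall fun y => hB _)
  have hcm : ∀ c, Continuous (fun y => E y • fderiv ℝ f (c + y)) := fun c => by fun_prop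
  have hbd : ∀ y c, ‖E y • fderiv ℝ f (c + y)‖ ≤ B' * ‖E y‖ := fun y c => by
    rw [norm_smul, mul_comm]
    exact mul_le_mul_of_nonneg_right (hB' _) (norm_nonneg _)
  have hi' : Integrable (fun y => E y • fderiv ℝ f (c + y)) :=
    (hEi.norm.const_mul B').mono' (hcm c).aestronglyMeasurable
      (Eventually.of_forall fun y => hbd y c)
  have h := hasFDerivAt_integral_of_dominated_of_fderiv_le (𝕜 := ℝ) (μ := volume)
    (F := fun c y => E y * f (c + y)) (F' := fun c y => E y • fderiv ℝ f (c + y)) (x₀ := c)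
    (bound := fun y => B' * ‖E y‖) (s := Set.univ) Filter.univ_mem
    (Eventually.of_forall fun c => (hi c).aestronglyMeasurable) (hi c)
    (hcm c).aestronglyMeasurable
    (Eventually.of_forall fun y c _ => hbd y c) (hEi.norm.const_mul B')
    (Eventually.of_forall fun y c _ => by
      have h1 : HasFDerivAt (fun c => f (c + y)) (fderiv ℝ f (c + y)) c :=
        (hasFDerivAt_comp_add_right y).2 (hf.1.differentiable (by simp) (c + y)).hasFDerivAt
      exact h1.const_mul (E y))
  have e1 : (fun c => kern L f c d) = fun c => ∫ y, E y * f (c + y) := by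
    funext c
    exact integral_congr_ae (Eventually.of_forall fun y => by simp only [E]; ring)
  rw [e1]
  refine h.congr_fderiv ?_
  rw [eq_sum_coordC (∫ y, E y • fderiv ℝ f (c + y))]
  refine Finset.sum_congr rfl fun j _ => ?_
  rw [ContinuousLinearMap.integral_apply hi']
  congr 1
  exact integral_congr_ae (Eventually.of_forall fun y => by
    simp only [E, partialD, smul_apply, smul_eq_mul]; ring)

end

section

variable (L : R4 ≃L[ℝ] R2 × R2)

/-! ### The composition of symbols -/

/-- The integrand of the composition formula for symbols, in the variables `((c, d), e)`. -/
def moyalIntegrand (f g : R4 → ℂ) (x : R4) (q : (R4 × R4) × R4) : ℂ :=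
  Complex.exp (Complex.I * (sform L q.1.1 q.1.2 - sform L q.2 q.1.2 / 2 : ℝ)) * phi L q.1.1 *
    (kern L f (x + (q.1.1 + (2⁻¹ : ℝ) • (q.1.2 - q.2))) q.2 *
      kern L g (x + (q.1.1 - (2⁻¹ : ℝ) • q.2)) (q.1.2 - q.2))

/-- The composition of symbols, up to normalization. -/
def moyal (f g : R4 → ℂ) (x : R4) : ℂ := ∫ q : (R4 × R4) × R4, moyalIntegrand L f g x q

/-- The integrable function dominating the integrand of the composition formula. -/
def moyalBound (q : (R4 × R4) × R4) : ℝ := invPow 5 q.1.1 * invPow 5 q.1.2 * invPow 5 q.2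

theorem integrable_moyalBound : Integrable moyalBound := by
  have h : Integrable (invPow 5 : R4 → ℝ) := integrable_invPow (by simp) volume
  exact (h.mul_prod h).mul_prod h

theorem one_add_norm_add_half_le (c u : R4) :
    1 + ‖c + (2⁻¹ : ℝ) • u‖ ≤ (1 + ‖c‖) * (1 + ‖u‖) := by
  refine (one_add_norm_add_le c _).trans ?_
  refine mul_le_mul_of_nonneg_left ?_ (by positivity)
  rw [norm_smul]
  norm_num
  nlinarith [norm_nonneg u]

/-- Half of the decay in `e` and `d - e` is converted to decay in `d`; the other half of the decay
in `e` is kept for integrating over the intermediate point. -/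
theorem invPow_ten_mul_le (d e : R4) :
    invPow 10 e * invPow 10 (d - e) ≤ invPow 5 d * invPow 5 e := by
  have h : invPow 5 e * invPow 5 (d - e) ≤ invPow 5 d := by
    simpa using invPow_mul_le 5 e (d - e)
  have h1 := invPow_le_one 5 (d - e)
  have h2 := invPow_pos 5 (d - e)
  have h3 := invPow_pos 5 e
  have h4 := invPow_pos 5 d
  rw [show (10 : ℕ) = 5 + 5 from rfl, invPow_add, invPow_add]
  calc invPow 5 e * invPow 5 e * (invPow 5 (d - e) * invPow 5 (d - e))
      = (invPow 5 e * invPow 5 (d - e)) * (invPow 5 e * invPow 5 (d - e)) := by ring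
    _ ≤ invPow 5 d * (invPow 5 e * 1) := by gcongr
    _ = _ := by ring

theorem one_add_pow_mul_invPow_add (K N : ℕ) (y : R4) :
    (1 + ‖y‖) ^ K * invPow (K + N) y = invPow N y := by
  have : (1 + ‖y‖) ^ K * invPow K y = 1 := mul_inv_cancel₀ (by positivity)
  rw [invPow_add, ← mul_assoc, this, one_mul]

theorem exists_norm_moyalIntegrand_le {m₁ m₂ : ℝ} (hm₁ : m₁ ≤ 0) (hm₂ : m₂ ≤ 0) {f g : R4 → ℂ}
    (hf : IsSymbol m₁ f) (hg : IsSymbol m₂ g) :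
    ∃ C : ℝ, 0 ≤ C ∧ ∀ x q, ‖moyalIntegrand L f g x q‖ ≤ C * wt (m₁ + m₂) x * moyalBound q := by
  obtain ⟨W₁, K₁, hW₁, hw₁⟩ := exists_wt_add_le hm₁
  obtain ⟨W₂, K₂, hW₂, hw₂⟩ := exists_wt_add_le hm₂
  -- The exponents are crossed. Moving the weight of `f` to `x` costs `K₁` powers of `d - e`, paid
  -- by the transform of `g`; moving that of `g` costs `K₂` powers of `e`, paid by the transform of
  -- `f`. Both losses in `c` are paid by the Gaussian.
  obtain ⟨C₁, hC₁, hk₁⟩ := exists_norm_kern_le L hm₁ hf.1 hf.2 (K₂ + 10)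
  obtain ⟨C₂, hC₂, hk₂⟩ := exists_norm_kern_le L hm₂ hg.1 hg.2 (K₁ + 10)
  obtain ⟨C₃, hC₃, hφ⟩ := exists_norm_le_invPow (phi L) (K₁ + (K₂ + 5))
  refine ⟨C₃ * (C₁ * W₁) * (C₂ * W₂), by positivity, ?_⟩
  rintro x ⟨⟨c, d⟩, e⟩
  have p1 := (wt_pos m₁ x).le
  have p2 := (wt_pos m₂ x).le
  have q1 := fun N => (invPow_pos N c).le
  have q2 := fun N => (invPow_pos N d).le
  have q3 := fun N => (invPow_pos N e).le
  have q4 := fun N => (invPow_pos N (d - e)).le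
  have h1 : ‖kern L f (x + (c + (2⁻¹ : ℝ) • (d - e))) e‖ ≤
      C₁ * ((W₁ * ((1 + ‖c‖) * (1 + ‖d - e‖)) ^ K₁ * wt m₁ x) * invPow (K₂ + 10) e) := by
    refine (hk₁ _ _).trans ?_
    have := q3 (K₂ + 10)
    gcongr
    refine (hw₁ _ _).trans ?_
    gcongr
    exact one_add_norm_add_half_le _ _
  have h2 : ‖kern L g (x + (c - (2⁻¹ : ℝ) • e)) (d - e)‖ ≤
      C₂ * ((W₂ * ((1 + ‖c‖) * (1 + ‖e‖)) ^ K₂ * wt m₂ x) * invPow (K₁ + 10) (d - e)) := by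
    refine (hk₂ _ _).trans ?_
    have := q4 (K₁ + 10)
    gcongr
    refine (hw₂ _ _).trans ?_
    gcongr
    simpa [sub_eq_add_neg] using one_add_norm_add_half_le c (-e)
  simp only [moyalIntegrand, moyalBound]
  rw [norm_mul, norm_mul, norm_mul, norm_cexp_I_mul, one_mul, wt_add]
  have hq3 := q3 (K₂ + 10)
  have hq4 := q4 (K₁ + 10)
  calc _ ≤ (C₃ * invPow (K₁ + (K₂ + 5)) c) *
        ((C₁ * ((W₁ * ((1 + ‖c‖) * (1 + ‖d - e‖)) ^ K₁ * wt m₁ x) * invPow (K₂ + 10) e)) *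
        (C₂ * ((W₂ * ((1 + ‖c‖) * (1 + ‖e‖)) ^ K₂ * wt m₂ x) * invPow (K₁ + 10) (d - e)))) := by
        refine mul_le_mul (hφ c) (mul_le_mul h1 h2 (norm_nonneg _) ?_)
          (by positivity) (mul_nonneg hC₃ (q1 _))
        positivity
    _ = C₃ * (C₁ * W₁) * (C₂ * W₂) * (wt m₁ x * wt m₂ x) *
        (((1 + ‖c‖) ^ K₂ * ((1 + ‖c‖) ^ K₁ * invPow (K₁ + (K₂ + 5)) c)) *
          (((1 + ‖e‖) ^ K₂ * invPow (K₂ + 10) e) *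
            ((1 + ‖d - e‖) ^ K₁ * invPow (K₁ + 10) (d - e)))) := by
        rw [mul_pow, mul_pow]; ring
    _ = C₃ * (C₁ * W₁) * (C₂ * W₂) * (wt m₁ x * wt m₂ x) *
        (invPow 5 c * (invPow 10 e * invPow 10 (d - e))) := by
        simp only [one_add_pow_mul_invPow_add]
    _ ≤ C₃ * (C₁ * W₁) * (C₂ * W₂) * (wt m₁ x * wt m₂ x) *
        (invPow 5 c * (invPow 5 d * invPow 5 e)) := by
        have := q1 5
        have := invPow_ten_mul_le d e
        refine mul_le_mul_of_nonneg_left (mul_le_mul_of_nonneg_left this (q1 5)) (by positivity)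
    _ = _ := by ring

theorem continuous_moyalIntegrand {f g : R4 → ℂ} (hf : IsSymbol 0 f) (hg : IsSymbol 0 g) :
    Continuous (fun p : R4 × ((R4 × R4) × R4) => moyalIntegrand L f g p.1 p.2) := by
  obtain ⟨B, hB⟩ := hf.exists_norm_le
  obtain ⟨B', hB'⟩ := hg.exists_norm_le
  have hφ := (phi L).continuous
  have h1 : Continuous (fun p : R4 × ((R4 × R4) × R4) => sform L p.2.1.1 p.2.1.2) :=
    (continuous_sform L).comp
      (by fun_prop : Continuous fun p : R4 × ((R4 × R4) × R4) => (p.2.1.1, p.2.1.2))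
  have h2 : Continuous (fun p : R4 × ((R4 × R4) × R4) => sform L p.2.2 p.2.1.2) :=
    (continuous_sform L).comp
      (by fun_prop : Continuous fun p : R4 × ((R4 × R4) × R4) => (p.2.2, p.2.1.2))
  have h3 := (continuous_kern L hf.continuous hB).comp
    (by fun_prop : Continuous fun p : R4 × ((R4 × R4) × R4) =>
      (p.1 + (p.2.1.1 + (2⁻¹ : ℝ) • (p.2.1.2 - p.2.2)), p.2.2))
  have h4 := (continuous_kern L hg.continuous hB').comp
    (by fun_prop : Continuous fun p : R4 × ((R4 × R4) × R4) =>
      (p.1 + (p.2.1.1 - (2⁻¹ : ℝ) • p.2.2), p.2.1.2 - p.2.2))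
  refine Continuous.mul ?_ (h3.mul h4)
  fun_prop

theorem aestronglyMeasurable_moyalIntegrand {f g : R4 → ℂ} (hf : IsSymbol 0 f)
    (hg : IsSymbol 0 g) (x : R4) : AEStronglyMeasurable (moyalIntegrand L f g x) volume :=
  ((continuous_moyalIntegrand L hf hg).comp (by fun_prop : Continuous fun q : (R4 × R4) × R4 =>
    (x, q))).aestronglyMeasurable

theorem integrable_moyalIntegrand {f g : R4 → ℂ} (hf : IsSymbol 0 f) (hg : IsSymbol 0 g)
    (x : R4) : Integrable (moyalIntegrand L f g x) := by
  obtain ⟨C, -, h⟩ := exists_norm_moyalIntegrand_le L le_rfl le_rfl hf hg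
  exact (integrable_moyalBound.const_mul _).mono' (aestronglyMeasurable_moyalIntegrand L hf hg x)
    (Eventually.of_forall (h x))

theorem exists_norm_moyal_le {m₁ m₂ : ℝ} (hm₁ : m₁ ≤ 0) (hm₂ : m₂ ≤ 0) {f g : R4 → ℂ}
    (hf : IsSymbol m₁ f) (hg : IsSymbol m₂ g) :
    ∃ C : ℝ, ∀ x, ‖moyal L f g x‖ ≤ C * wt (m₁ + m₂) x := by
  obtain ⟨C, -, h⟩ := exists_norm_moyalIntegrand_le L hm₁ hm₂ hf hg
  refine ⟨C * ∫ q, moyalBound q, fun x => ?_⟩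
  refine (norm_integral_le_of_norm_le (integrable_moyalBound.const_mul _)
    (Eventually.of_forall (h x))).trans (le_of_eq ?_)
  rw [integral_const_mul]
  ring

theorem hasFDerivAt_moyalIntegrand {f g : R4 → ℂ} (hf : IsSymbol 0 f) (hg : IsSymbol 0 g)
    (q : (R4 × R4) × R4) (x : R4) :
    HasFDerivAt (fun x => moyalIntegrand L f g x q)
      (∑ j, (moyalIntegrand L (partialD j f) g x q + moyalIntegrand L f (partialD j g) x q) •
        coordC j) x := by
  have h1 := (hasFDerivAt_comp_add_right (q.1.1 + (2⁻¹ : ℝ) • (q.1.2 - q.2))).2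
    (hasFDerivAt_kern L hf (x + (q.1.1 + (2⁻¹ : ℝ) • (q.1.2 - q.2))) q.2)
  have h2 := (hasFDerivAt_comp_add_right (q.1.1 - (2⁻¹ : ℝ) • q.2)).2
    (hasFDerivAt_kern L hg (x + (q.1.1 - (2⁻¹ : ℝ) • q.2)) (q.1.2 - q.2))
  refine ((h1.mul h2).const_mul (Complex.exp (Complex.I * (sform L q.1.1 q.1.2 -
    sform L q.2 q.1.2 / 2 : ℝ)) * phi L q.1.1)).congr_fderiv ?_
  simp only [Finset.smul_sum, ← Finset.sum_add_distrib, smul_smul, moyalIntegrand]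
  refine Finset.sum_congr rfl fun j _ => ?_
  ext u
  simp only [smul_apply, add_apply, smul_eq_mul]
  ring

/-- In the variables `c`, `d`, `e` relative to `x`, the point `x` occurs only as a translation of
both symbols, so the composition satisfies the Leibniz rule. Membership in a symbol class thus
reduces, by induction on the order, to estimates without derivatives. -/
theorem hasFDerivAt_moyal {f g : R4 → ℂ} (hf : IsSymbol 0 f) (hg : IsSymbol 0 g) (x : R4) :
    HasFDerivAt (moyal L f g)
      (∑ j, (moyal L (partialD j f) g x + moyal L f (partialD j g) x) • coordC j) x := by
  choose C _ hC using fun j =>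
    exists_norm_moyalIntegrand_le L le_rfl le_rfl (hf.partialD j) hg
  choose C' _ hC' using fun j =>
    exists_norm_moyalIntegrand_le L le_rfl le_rfl hf (hg.partialD j)
  simp only [add_zero, wt_zero, mul_one] at hC hC'
  let F' : R4 → (R4 × R4) × R4 → R4 →L[ℝ] ℂ := fun x q =>
    ∑ j, (moyalIntegrand L (partialD j f) g x q + moyalIntegrand L f (partialD j g) x q) •
        coordC j
  have hbd : ∀ q x, ‖F' x q‖ ≤ (∑ j, (C j + C' j)) * moyalBound q := by
    intro q x
    rw [Finset.sum_mul]
    refine (norm_sum_le _ _).trans (Finset.sum_le_sum fun j _ => ?_)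
    rw [norm_smul]
    refine (mul_le_of_le_one_right (norm_nonneg _) (norm_coordC_le j)).trans ?_
    refine (norm_add_le _ _).trans ?_
    rw [add_mul]
    exact add_le_add (hC j x q) (hC' j x q)
  have hm : ∀ x, AEStronglyMeasurable (F' x) volume := fun x =>
    Finset.aestronglyMeasurable_fun_sum _ fun j _ =>
      ((aestronglyMeasurable_moyalIntegrand L (hf.partialD j) hg x).add
        (aestronglyMeasurable_moyalIntegrand L hf (hg.partialD j) x)).smul
          aestronglyMeasurable_const
  have h := hasFDerivAt_integral_of_dominated_of_fderiv_le (𝕜 := ℝ) (μ := volume)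
    (F := moyalIntegrand L f g) (F' := F') (x₀ := x)
    (bound := fun q => (∑ j, (C j + C' j)) * moyalBound q) (s := Set.univ) Filter.univ_mem
    (Eventually.of_forall fun x => aestronglyMeasurable_moyalIntegrand L hf hg x)
    (integrable_moyalIntegrand L hf hg x) (hm x)
    (Eventually.of_forall fun q x _ => hbd q x) (integrable_moyalBound.const_mul _)
    (Eventually.of_forall fun q x _ => hasFDerivAt_moyalIntegrand L hf hg q x)
  refine h.congr_fderiv ?_
  have i1 := fun j => integrable_moyalIntegrand L (hf.partialD j) hg x
  have i2 := fun j => integrable_moyalIntegrand L hf (hg.partialD j) x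
  simp only [F']
  rw [integral_finsetSum _ fun j _ => Integrable.smul_const (f := fun q =>
    moyalIntegrand L (partialD j f) g x q + moyalIntegrand L f (partialD j g) x q)
    ((i1 j).add (i2 j)) _]
  refine Finset.sum_congr rfl fun j _ => ?_
  rw [integral_smul_const, integral_add (i1 j) (i2 j)]
  rfl

theorem contDiff_of_hasFDerivAt_sum {F : R4 → ℂ} {A : Fin 4 → R4 → ℂ}
    (hF : ∀ x, HasFDerivAt F (∑ j, A j x • coordC j) x) {n : ℕ} (hA : ∀ j, ContDiff ℝ n (A j)) :
    ContDiff ℝ (n + 1) F := by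
  refine contDiff_succ_iff_hasFDerivAt.2 ⟨_, ?_, hF⟩
  exact ContDiff.sum fun j _ => (hA j).smul contDiff_const

theorem contDiff_moyal {f g : R4 → ℂ} (hf : IsSymbol 0 f) (hg : IsSymbol 0 g) :
    ContDiff ℝ ∞ (moyal L f g) := by
  refine contDiff_infty.2 fun n => ?_
  induction n generalizing f g with
  | zero =>
    refine contDiff_zero.2 ?_
    exact continuous_iff_continuousAt.2 fun x => (hasFDerivAt_moyal L hf hg x).continuousAt
  | succ n ih =>
    exact contDiff_of_hasFDerivAt_sum (hasFDerivAt_moyal L hf hg) fun j =>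
      (ih (hf.partialD j) hg).add (ih hf (hg.partialD j))

theorem norm_iteratedFDeriv_succ_moyal_le {f g : R4 → ℂ} (hf : IsSymbol 0 f) (hg : IsSymbol 0 g)
    (n : ℕ) (x : R4) : ‖iteratedFDeriv ℝ (n + 1) (moyal L f g) x‖ ≤
      ∑ j, (‖iteratedFDeriv ℝ n (moyal L (partialD j f) g) x‖ +
        ‖iteratedFDeriv ℝ n (moyal L f (partialD j g)) x‖) := by
  have h1 := fun j => (contDiff_moyal L (hf.partialD j) hg).of_le
    (show (n : WithTop ℕ∞) ≤ ∞ by exact_mod_cast le_top)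
  have h2 := fun j => (contDiff_moyal L hf (hg.partialD j)).of_le
    (show (n : WithTop ℕ∞) ≤ ∞ by exact_mod_cast le_top)
  refine (norm_iteratedFDeriv_succ_le (hasFDerivAt_moyal L hf hg)
    (fun j => (h1 j).add (h2 j)) x).trans (Finset.sum_le_sum fun j _ => ?_)
  have := iteratedFDeriv_add_apply (h1 j).contDiffAt (h2 j).contDiffAt (x := x)
  exact (congrArg norm this).le.trans (norm_add_le _ _)

/-! ### Symbol classes -/

theorem IsSymbol.of_mem_gammaClass {m ρ : ℝ} (hρ : 0 ≤ ρ) {f : R4 → ℂ}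
    (hf : f ∈ gammaClass m ρ) : IsSymbol m f := by
  refine ⟨hf.1, fun n => ?_⟩
  obtain ⟨C, hC⟩ := hf.2 n
  have hC0 : 0 ≤ C := nonneg_of_mul_nonneg_left ((norm_nonneg _).trans (hC 0)) (by positivity)
  refine ⟨C, fun x => (hC x).trans (mul_le_mul_of_nonneg_left ?_ hC0)⟩
  exact wt_anti (m := m - ρ * n) (by nlinarith [mul_nonneg hρ n.cast_nonneg]) x

theorem gammaClass_mono {m m' ρ : ℝ} (h : m ≤ m') : gammaClass m ρ ⊆ gammaClass m' ρ := by
  refine fun f hf => ⟨hf.1, fun n => ?_⟩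
  obtain ⟨C, hC⟩ := hf.2 n
  have hC0 : 0 ≤ C := nonneg_of_mul_nonneg_left ((norm_nonneg _).trans (hC 0)) (by positivity)
  refine ⟨C, fun x => (hC x).trans (mul_le_mul_of_nonneg_left ?_ hC0)⟩
  exact wt_anti (m := m - ρ * n) (by linarith) x

theorem partialD_mem_gammaClass {m ρ : ℝ} {f : R4 → ℂ} (hf : f ∈ gammaClass m ρ) (j : Fin 4) :
    partialD j f ∈ gammaClass (m - ρ) ρ := by
  refine ⟨contDiff_partialD hf.1 j, fun n => ?_⟩
  obtain ⟨C, hC⟩ := hf.2 (n + 1)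
  refine ⟨C, fun x => (norm_iteratedFDeriv_partialD_le hf.1 j n x).trans ((hC x).trans_eq ?_)⟩
  push_cast
  ring_nf

/-- By the Leibniz rule each derivative lowers the order of one of the factors by `ρ`; this is why
the orders vary in the induction. -/
theorem exists_norm_iteratedFDeriv_moyal_le {ρ : ℝ} (hρ : 0 ≤ ρ) (n : ℕ) {m₁ m₂ : ℝ}
    (hm₁ : m₁ ≤ 0) (hm₂ : m₂ ≤ 0) {f g : R4 → ℂ} (hf : f ∈ gammaClass m₁ ρ)
    (hg : g ∈ gammaClass m₂ ρ) :
    ∃ C : ℝ, ∀ x, ‖iteratedFDeriv ℝ n (moyal L f g) x‖ ≤ C * wt (m₁ + m₂ - ρ * n) x := by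
  induction n generalizing m₁ m₂ f g with
  | zero =>
    simpa using exists_norm_moyal_le L hm₁ hm₂ (.of_mem_gammaClass hρ hf)
      (.of_mem_gammaClass hρ hg)
  | succ n ih =>
    choose C hC using fun j => ih (m₁ := m₁ - ρ) (by linarith) hm₂ (partialD_mem_gammaClass hf j) hg
    choose C' hC' using fun j =>
      ih (m₂ := m₂ - ρ) hm₁ (by linarith) hf (partialD_mem_gammaClass hg j)
    refine ⟨∑ j, (C j + C' j), fun x => ?_⟩
    refine (norm_iteratedFDeriv_succ_moyal_le L ((IsSymbol.of_mem_gammaClass hρ hf).mono hm₁)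
      ((IsSymbol.of_mem_gammaClass hρ hg).mono hm₂) n x).trans ?_
    rw [Finset.sum_mul]
    refine Finset.sum_le_sum fun j _ => ?_
    have e1 : m₁ + m₂ - ρ * (n + 1 : ℕ) = m₁ - ρ + m₂ - ρ * n := by push_cast; ring
    have e2 : m₁ + m₂ - ρ * (n + 1 : ℕ) = m₁ + (m₂ - ρ) - ρ * n := by push_cast; ring
    rw [add_mul]
    exact add_le_add (e1 ▸ hC j x) (e2 ▸ hC' j x)

theorem moyal_mem_gammaClass {ρ m₁ m₂ : ℝ} (hρ : 0 ≤ ρ) (hm₁ : m₁ ≤ 0) (hm₂ : m₂ ≤ 0)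
    {f g : R4 → ℂ} (hf : f ∈ gammaClass m₁ ρ) (hg : g ∈ gammaClass m₂ ρ) :
    moyal L f g ∈ gammaClass (m₁ + m₂) ρ :=
  ⟨contDiff_moyal L ((IsSymbol.of_mem_gammaClass hρ hf).mono hm₁)
    ((IsSymbol.of_mem_gammaClass hρ hg).mono hm₂),
    fun n => exists_norm_iteratedFDeriv_moyal_le L hρ n hm₁ hm₂ hf hg⟩

/-! ### Symbols vanishing at infinity, and Schwartz symbols -/

theorem exists_norm_le_of_tendsto_cocompact {E : Type*} [NormedAddCommGroup E] {F : R4 → E}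
    (hF : Continuous F) (h : Tendsto (fun x => ‖F x‖) (cocompact R4) (𝓝 0)) :
    ∃ C, ∀ x, ‖F x‖ ≤ C := by
  obtain ⟨K, hK, hKs⟩ := mem_cocompact.1 (h.eventually (gt_mem_nhds one_pos))
  obtain ⟨C, hC⟩ := hK.exists_bound_of_continuousOn hF.continuousOn
  refine ⟨max C 1, fun x => ?_⟩
  by_cases hx : x ∈ K
  · exact (hC x hx).trans (le_max_left _ _)
  · exact (hKs hx).le.trans (le_max_right _ _)

theorem IsSymbol.of_mem_kInftyClass {f : R4 → ℂ} (hf : f ∈ kInftyClass) : IsSymbol 0 f := by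
  refine ⟨hf.1, fun n => ?_⟩
  obtain ⟨C, hC⟩ := exists_norm_le_of_tendsto_cocompact
    (hf.1.continuous_iteratedFDeriv (m := n) (by exact_mod_cast le_top)) (hf.2 n)
  exact ⟨C, fun x => by simpa [wt_zero] using hC x⟩

theorem partialD_mem_kInftyClass {f : R4 → ℂ} (hf : f ∈ kInftyClass) (j : Fin 4) :
    partialD j f ∈ kInftyClass :=
  ⟨contDiff_partialD hf.1 j, fun n => squeeze_zero (fun _ => norm_nonneg _)
    (norm_iteratedFDeriv_partialD_le hf.1 j n) (hf.2 (n + 1))⟩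

theorem tendsto_of_mem_kInftyClass {f : R4 → ℂ} (hf : f ∈ kInftyClass) :
    Tendsto f (cocompact R4) (𝓝 0) := by
  rw [tendsto_zero_iff_norm_tendsto_zero]
  simpa using hf.2 0

/-- A bound for the windowed Fourier transform uniform in the frequency. -/
def windowAvg (f : R4 → ℂ) (c : R4) : ℝ := ∫ y, ‖f (c + y)‖ * ‖phi L y‖

theorem norm_kern_le_windowAvg (f : R4 → ℂ) (c d : R4) : ‖kern L f c d‖ ≤ windowAvg L f c := by
  refine (norm_integral_le_integral_norm _).trans (le_of_eq ?_)
  refine integral_congr_ae (Eventually.of_forall fun y => ?_)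
  simp only [norm_mul, norm_cexp_I_mul, mul_one]

/-- Required by dominated convergence along this filter. -/
instance : (cocompact R4).IsCountablyGenerated := by
  rw [← Metric.cobounded_eq_cocompact, ← comap_norm_atTop]
  infer_instance

theorem tendsto_comp_add_right_cocompact (y : R4) :
    Tendsto (fun c : R4 => c + y) (cocompact R4) (cocompact R4) :=
  (Homeomorph.addRight y).isClosedEmbedding.tendsto_cocompact

theorem tendsto_windowAvg {f : R4 → ℂ} (hf : f ∈ kInftyClass) :
    Tendsto (windowAvg L f) (cocompact R4) (𝓝 0) := by
  obtain ⟨B, hB⟩ := (IsSymbol.of_mem_kInftyClass hf).exists_norm_le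
  have hfc := hf.1.continuous
  have hφ := (phi L).continuous
  have h := tendsto_integral_filter_of_dominated_convergence (μ := volume) (l := cocompact R4)
    (F := fun c y => ‖f (c + y)‖ * ‖phi L y‖) (f := fun _ => (0 : ℝ))
    (fun y => B * ‖phi L y‖)
    (Eventually.of_forall fun c => Continuous.aestronglyMeasurable (by fun_prop))
    (Eventually.of_forall fun c => Eventually.of_forall fun y => by
      rw [norm_mul, norm_norm, norm_norm]
      exact mul_le_mul_of_nonneg_right (hB _) (norm_nonneg _))
    (((phi L).integrable (μ := volume)).norm.const_mul B)
    (Eventually.of_forall fun y => by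
      have := ((tendsto_of_mem_kInftyClass hf).comp (tendsto_comp_add_right_cocompact y)).norm
      simpa using this.mul_const ‖phi L y‖)
  simpa using! h

theorem tendsto_moyal {f g : R4 → ℂ} (hf : f ∈ kInftyClass) (hg : g ∈ kInftyClass) :
    Tendsto (fun x => ‖moyal L f g x‖) (cocompact R4) (𝓝 0) := by
  have hf' := IsSymbol.of_mem_kInftyClass hf
  have hg' := IsSymbol.of_mem_kInftyClass hg
  obtain ⟨C, -, hC⟩ := exists_norm_moyalIntegrand_le L le_rfl le_rfl hf' hg'
  -- Order 0 suffices: for fixed `q` the factor of `g` needs only to be bounded, and the factor of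
  -- `f` supplies the convergence to zero.
  obtain ⟨C', hC'0, hC'⟩ := exists_norm_kern_le L le_rfl hg'.1 hg'.2 0
  simp only [add_zero, wt_zero, mul_one] at hC
  have h := tendsto_integral_filter_of_dominated_convergence (μ := volume) (l := cocompact R4)
    (F := moyalIntegrand L f g) (f := fun _ => (0 : ℂ)) (fun q => C * moyalBound q)
    (Eventually.of_forall fun x => aestronglyMeasurable_moyalIntegrand L hf' hg' x)
    (Eventually.of_forall fun x => Eventually.of_forall (hC x))
    (integrable_moyalBound.const_mul C)
    (Eventually.of_forall fun q => by
      have h1 := (tendsto_windowAvg L hf).comp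
        (tendsto_comp_add_right_cocompact (q.1.1 + (2⁻¹ : ℝ) • (q.1.2 - q.2)))
      refine squeeze_zero_norm (a := fun x => ‖phi L q.1.1‖ *
        (windowAvg L f (x + (q.1.1 + (2⁻¹ : ℝ) • (q.1.2 - q.2))) * C')) (fun x => ?_) ?_
      · rw [moyalIntegrand, norm_mul, norm_mul, norm_mul, norm_cexp_I_mul, one_mul]
        refine mul_le_mul_of_nonneg_left (mul_le_mul (norm_kern_le_windowAvg L _ _ _) ?_
          (norm_nonneg _) ((norm_nonneg _).trans (norm_kern_le_windowAvg L f _ 0)))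
          (norm_nonneg _)
        simpa [wt_zero, invPow] using hC' (x + (q.1.1 - (2⁻¹ : ℝ) • q.2)) (q.1.2 - q.2)
      · simpa using! (h1.mul_const C').const_mul ‖phi L q.1.1‖)
  simpa using! h.norm

theorem moyal_mem_kInftyClass {f g : R4 → ℂ} (hf : f ∈ kInftyClass) (hg : g ∈ kInftyClass) :
    moyal L f g ∈ kInftyClass := by
  refine ⟨contDiff_moyal L (.of_mem_kInftyClass hf) (.of_mem_kInftyClass hg), fun n => ?_⟩
  induction n generalizing f g with
  | zero => simpa using tendsto_moyal L hf hg
  | succ n ih =>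
    refine squeeze_zero (fun _ => norm_nonneg _) (norm_iteratedFDeriv_succ_moyal_le L
      (.of_mem_kInftyClass hf) (.of_mem_kInftyClass hg) n) ?_
    have : Tendsto (fun x => ∑ j, (‖iteratedFDeriv ℝ n (moyal L (partialD j f) g) x‖ +
        ‖iteratedFDeriv ℝ n (moyal L f (partialD j g)) x‖)) (cocompact R4)
        (𝓝 (∑ _j : Fin 4, ((0 : ℝ) + 0))) :=
      tendsto_finsetSum _ fun j _ =>
        (ih (partialD_mem_kInftyClass hf j) hg).add (ih hf (partialD_mem_kInftyClass hg j))
    simpa using this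

theorem gammaClass_subset_kInftyClass {m ρ : ℝ} (hm : m < 0) (hρ : 0 ≤ ρ) :
    gammaClass m ρ ⊆ kInftyClass := by
  intro f hf
  refine ⟨hf.1, fun n => ?_⟩
  obtain ⟨C, hC⟩ := (IsSymbol.of_mem_gammaClass hρ hf).2 n
  refine squeeze_zero (fun _ => norm_nonneg _) hC ?_
  have h1 : Tendsto (fun x : R4 => 1 + ‖x‖ ^ 2) (cocompact R4) atTop :=
    tendsto_atTop_add_const_left _ _
      ((tendsto_pow_atTop two_ne_zero).comp tendsto_norm_cocompact_atTop)
  have h2 := (tendsto_rpow_neg_atTop (y := -(m / 2)) (by linarith)).comp h1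
  simpa [wt, Function.comp_def] using h2.const_mul C

/-- With `ρ = 0` all derivatives share the same decay, so Schwartz functions form an intersection of
gamma classes and inherit closure under composition from them. -/
theorem mem_schwartzClass_iff {f : R4 → ℂ} :
    f ∈ schwartzClass ↔ ∀ k : ℕ, f ∈ gammaClass (-k) 0 := by
  constructor
  · rintro ⟨f, rfl⟩ k
    refine ⟨f.smooth', fun n => ?_⟩
    obtain ⟨C, hC0, hC⟩ := exists_norm_iteratedFDeriv_le_invPow f k n
    refine ⟨C, fun x => (hC n le_rfl x).trans (mul_le_mul_of_nonneg_left ?_ hC0)⟩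
    rw [zero_mul, sub_zero, invPow, neg_div, Real.rpow_neg (by positivity)]
    gcongr
    have : (1 + ‖x‖) ^ k = ((1 + ‖x‖) ^ 2) ^ ((k : ℝ) / 2) := by
      rw [← Real.rpow_natCast, ← Real.rpow_natCast, ← Real.rpow_mul (by positivity)]
      congr 1
      push_cast
      ring
    rw [this]
    refine Real.rpow_le_rpow (by positivity) ?_ (by positivity)
    nlinarith [norm_nonneg x]
  · intro hf
    refine ⟨⟨f, (hf 0).1, fun k n => ?_⟩, rfl⟩
    obtain ⟨C, hC⟩ := (hf k).2 n
    have hC0 : 0 ≤ C := nonneg_of_mul_nonneg_left ((norm_nonneg _).trans (hC 0)) (by positivity)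
    refine ⟨C, fun x => ?_⟩
    have h1 : ‖x‖ ^ k ≤ (1 + ‖x‖ ^ 2) ^ ((k : ℝ) / 2) := by
      have : ‖x‖ ^ k = (‖x‖ ^ 2) ^ ((k : ℝ) / 2) := by
        rw [← Real.rpow_natCast, ← Real.rpow_natCast, ← Real.rpow_mul (by positivity)]
        congr 1
        push_cast
        ring
      rw [this]
      exact Real.rpow_le_rpow (by positivity) (by linarith) (by positivity)
    calc ‖x‖ ^ k * ‖iteratedFDeriv ℝ n f x‖
        ≤ (1 + ‖x‖ ^ 2) ^ ((k : ℝ) / 2) * (C * (1 + ‖x‖ ^ 2) ^ ((-(k : ℝ) - 0 * n) / 2)) := by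
          gcongr
          exact hC x
      _ = C := by
          rw [mul_left_comm, ← Real.rpow_add (by positivity)]
          ring_nf
          simp

theorem moyal_mem_schwartzClass {f g : R4 → ℂ} (hf : f ∈ schwartzClass)
    (hg : g ∈ schwartzClass) : moyal L f g ∈ schwartzClass := by
  rw [mem_schwartzClass_iff] at *
  intro k
  -- All the decay is taken from `f`; `g` enters with order 0.
  have := moyal_mem_gammaClass L le_rfl (by simp) (by simp) (hf k) (hg 0)
  simpa using this

theorem schwartzClass_subset_gammaClass (m ρ : ℝ) : schwartzClass ⊆ gammaClass m ρ := by
  intro f hf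
  rw [mem_schwartzClass_iff] at hf
  refine ⟨(hf 0).1, fun n => ?_⟩
  obtain ⟨k, hk⟩ := exists_nat_ge (-(m - ρ * n))
  obtain ⟨C, hC⟩ := (gammaClass_mono (m' := m - ρ * n) (by linarith) (hf k)).2 n
  exact ⟨C, fun x => by simpa using hC x⟩

end

section

variable (L : R4 ≃L[ℝ] R2 × R2)

/-! ### Weyl operators in the displaced parity normalization -/

/-- `T` is the weak integral of `f` against the displaced parity operators. -/
def IsWig (f : R4 → ℂ) (T : L2 →L[ℂ] L2) : Prop :=
  ∀ φ ψ : 𝓢(R2, ℂ), ⟪toL2 φ, T (toL2 ψ)⟫_ℂ = ∫ x, f x * wig L φ ψ x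

theorem integrable_mul_wig {f : R4 → ℂ} (hf : IsSymbol 0 f) (φ ψ : 𝓢(R2, ℂ)) :
    Integrable (fun x => f x * wig L φ ψ x) := by
  obtain ⟨B, hB⟩ := hf.exists_norm_le
  exact (integrable_wig L φ ψ).bdd_mul hf.continuous.aestronglyMeasurable
    (Eventually.of_forall hB)

variable {L} in
theorem IsWig.unique {f : R4 → ℂ} {S T : L2 →L[ℂ] L2} (hS : IsWig L f S) (hT : IsWig L f T) :
    S = T :=
  ext_coh_coh L fun _ _ => (hS _ _).trans (hT _ _).symm

variable {L} in
theorem IsWig.add {f g : R4 → ℂ} {S T : L2 →L[ℂ] L2} (hf : IsSymbol 0 f) (hg : IsSymbol 0 g)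
    (hS : IsWig L f S) (hT : IsWig L g T) : IsWig L (fun x => f x + g x) (S + T) := by
  intro φ ψ
  simp only [add_apply, inner_add_right, add_mul]
  rw [integral_add (integrable_mul_wig L hf φ ψ) (integrable_mul_wig L hg φ ψ), hS, hT]

variable {L} in
theorem IsWig.smul {f : R4 → ℂ} {T : L2 →L[ℂ] L2} (hT : IsWig L f T) (c : ℂ) :
    IsWig L (fun x => c * f x) (c • T) := by
  intro φ ψ
  simp only [smul_apply, inner_smul_right, mul_assoc, integral_const_mul]
  rw [hT]

theorem continuous_cohKernel {f : R4 → ℂ} (hf : IsSymbol 0 f) :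
    Continuous (fun p : R4 × R4 => cohKernel L f p.1 p.2) := by
  obtain ⟨B, hB⟩ := hf.exists_norm_le
  simp_rw [cohKernel_eq]
  have h1 := continuous_sform L
  have h2 := (continuous_kern L hf.continuous hB).comp
    (by fun_prop : Continuous fun p : R4 × R4 => ((2⁻¹ : ℝ) • (p.1 + p.2), p.1 - p.2))
  refine Continuous.mul ?_ h2
  fun_prop

theorem norm_cohKernel (f : R4 → ℂ) (z w : R4) :
    ‖cohKernel L f z w‖ = ‖kern L f ((2⁻¹ : ℝ) • (z + w)) (z - w)‖ := by
  rw [cohKernel_eq, norm_mul, norm_cexp_I_mul, one_mul]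

theorem exists_norm_cohKernel_le {f : R4 → ℂ} (hf : IsSymbol 0 f) (N : ℕ) :
    ∃ C : ℝ, 0 ≤ C ∧ ∀ z w, ‖cohKernel L f z w‖ ≤ C * invPow N (z - w) := by
  obtain ⟨C, hC, h⟩ := exists_norm_kern_le L le_rfl hf.1 hf.2 N
  refine ⟨C, hC, fun z w => ?_⟩
  rw [norm_cohKernel]
  simpa [wt_zero] using h ((2⁻¹ : ℝ) • (z + w)) (z - w)

theorem integrable_invPow_five : Integrable (invPow 5 : R4 → ℝ) :=
  integrable_invPow (by simp) volume

/-- A Calderón–Vaillancourt theorem: off-diagonal decay of order 5, more than the dimension 4, is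
enough for the Schur test. The form of the kernel carries a factor `frameConst L ^ 2`, one for each
resolution of the identity. -/
theorem exists_isWig {f : R4 → ℂ} (hf : IsSymbol 0 f) : ∃ T, IsWig L f T := by
  obtain ⟨B, hB⟩ := hf.exists_norm_le
  obtain ⟨C, hC, h⟩ := exists_norm_cohKernel_le L hf 5
  obtain ⟨T, hT⟩ := exists_operator_of_kernel L (continuous_cohKernel L hf).aestronglyMeasurable
    (fun p => h p.1 p.2) hC integrable_invPow_five (fun x => (invPow_pos 5 x).le)
  have hκ : (frameConst L : ℂ) ≠ 0 := by exact_mod_cast (frameConst_pos L).ne'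
  refine ⟨((frameConst L : ℂ) ^ 2)⁻¹ • T, fun φ ψ => ?_⟩
  rw [smul_apply, inner_smul_right, hT, ← integral_mul_wig L hf.continuous hB,
    inv_mul_cancel_left₀ (pow_ne_zero 2 hκ)]

/-! ### Composition of operators -/

instance : (volume : Measure (R4 × R4)).IsAddHaarMeasure := by
  rw [Measure.volume_eq_prod]; infer_instance

instance : (volume : Measure ((R4 × R4) × R4)).IsAddHaarMeasure := by
  rw [Measure.volume_eq_prod]; exact Measure.prod.instIsAddHaarMeasure _ _

/-- The kernel of an operator in the coherent state representation. -/
def opKernel (T : L2 →L[ℂ] L2) (p : R4 × R4) : ℂ :=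
  ⟪toL2 (coh L p.1), T (toL2 (coh L p.2))⟫_ℂ

theorem continuous_opKernel (T : L2 →L[ℂ] L2) : Continuous (opKernel L T) := by
  have hc := continuous_toL2_coh L
  exact (hc.comp continuous_fst).inner (T.continuous.comp (hc.comp continuous_snd))

variable {L} in
theorem IsWig.opKernel_eq {f : R4 → ℂ} {T : L2 →L[ℂ] L2} (hT : IsWig L f T) (p : R4 × R4) :
    opKernel L T p = cohKernel L f p.1 p.2 := hT _ _

/-- The resolution of the identity on both sides of `T`, which applies to an operator already known
to be bounded. -/
theorem kernelForm_opKernel {T : L2 →L[ℂ] L2} {B : ℝ} {η : R4 → ℝ}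
    (hK : ∀ p, ‖opKernel L T p‖ ≤ B * η (p.1 - p.2)) (hη : Integrable η) (φ ψ : L2) :
    kernelForm L (opKernel L T) φ ψ = (frameConst L : ℂ) ^ 2 * ⟪φ, T ψ⟫_ℂ := by
  rw [kernelForm, Measure.volume_eq_prod, integral_prod _ (integrable_kernelForm_integrand L
    (continuous_opKernel L T).aestronglyMeasurable hK hη φ ψ), sq, mul_assoc,
    ← integral_inner_coh, ← integral_const_mul]
  refine integral_congr_ae (Eventually.of_forall fun z => ?_)
  simp only [opKernel, mul_assoc]
  rw [integral_const_mul, mul_left_comm]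
  congr 1
  rw [← ContinuousLinearMap.adjoint_inner_left, ← integral_inner_coh]
  simp only [ContinuousLinearMap.adjoint_inner_left]

theorem frameConst_mul_opKernel_mul (S T : L2 →L[ℂ] L2) (z w : R4) :
    (frameConst L : ℂ) * opKernel L (S * T) (z, w) =
      ∫ y, opKernel L S (z, y) * opKernel L T (y, w) := by
  simp only [opKernel, show (S * T) (toL2 (coh L w)) = S (T (toL2 (coh L w))) from rfl]
  rw [← ContinuousLinearMap.adjoint_inner_left, ← integral_inner_coh]
  simp only [ContinuousLinearMap.adjoint_inner_left]

theorem exists_norm_opKernel_mul_le {S T : L2 →L[ℂ] L2} {B B' : ℝ} (hB : 0 ≤ B) (hB' : 0 ≤ B')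
    (hS : ∀ p, ‖opKernel L S p‖ ≤ B * invPow 10 (p.1 - p.2))
    (hT : ∀ p, ‖opKernel L T p‖ ≤ B' * invPow 10 (p.1 - p.2)) :
    ∃ C : ℝ, ∀ p, ‖opKernel L (S * T) p‖ ≤ C * invPow 5 (p.1 - p.2) := by
  have hκ := frameConst_pos L
  refine ⟨(frameConst L)⁻¹ * (B * B' * ∫ y : R4, invPow 5 y), fun ⟨z, w⟩ => ?_⟩
  have h1 : ‖(frameConst L : ℂ) * opKernel L (S * T) (z, w)‖ ≤
      ∫ y : R4, B * B' * invPow 5 (z - w) * invPow 5 (z - y) := by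
    rw [frameConst_mul_opKernel_mul]
    refine norm_integral_le_of_norm_le
      ((integrable_invPow_five.comp_sub_left z).const_mul _) (Eventually.of_forall fun y => ?_)
    rw [norm_mul]
    calc _ ≤ (B * invPow 10 (z - y)) * (B' * invPow 10 (y - w)) :=
          mul_le_mul (hS (z, y)) (hT (y, w)) (norm_nonneg _)
            (mul_nonneg hB (invPow_pos _ _).le)
      _ = B * B' * (invPow 10 (z - y) * invPow 10 (z - w - (z - y))) := by
          rw [show z - w - (z - y) = y - w by abel]; ring
      _ ≤ B * B' * (invPow 5 (z - w) * invPow 5 (z - y)) :=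
          mul_le_mul_of_nonneg_left (invPow_ten_mul_le _ _) (by positivity)
      _ = _ := by ring
  rw [integral_const_mul, integral_sub_left_eq_self (fun y : R4 => invPow 5 y), norm_mul,
    Complex.norm_real, Real.norm_of_nonneg hκ.le] at h1
  rw [mul_assoc, ← div_eq_inv_mul, le_div_iff₀' hκ] at *
  refine h1.trans (le_of_eq ?_)
  ring

/-- The symbol of an operator, up to normalization. -/
def opSymbol (T : L2 →L[ℂ] L2) (x : R4) : ℂ :=
  ∫ p : R4 × R4, opKernel L T p * wig L (coh L p.2) (coh L p.1) x

/-- The linear change of variables `((z, w), x) ↦ ((x, z - w), z)`. -/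
def differenceEquiv : ((R4 × R4) × R4) ≃L[ℝ] (R4 × R4) × R4 :=
  ContinuousLinearEquiv.equivOfInverse
    (((ContinuousLinearMap.snd ℝ (R4 × R4) R4).prod
      ((ContinuousLinearMap.fst ℝ R4 R4 - ContinuousLinearMap.snd ℝ R4 R4).comp
        (ContinuousLinearMap.fst ℝ (R4 × R4) R4))).prod
      ((ContinuousLinearMap.fst ℝ R4 R4).comp (ContinuousLinearMap.fst ℝ (R4 × R4) R4)))
    (((ContinuousLinearMap.snd ℝ (R4 × R4) R4).prod
      (ContinuousLinearMap.snd ℝ (R4 × R4) R4 - (ContinuousLinearMap.snd ℝ R4 R4).comp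
        (ContinuousLinearMap.fst ℝ (R4 × R4) R4))).prod
      ((ContinuousLinearMap.fst ℝ R4 R4).comp (ContinuousLinearMap.fst ℝ (R4 × R4) R4)))
    (fun p => by simp) (fun p => by simp)

theorem differenceEquiv_apply (p : (R4 × R4) × R4) :
    differenceEquiv p = ((p.2, p.1.1 - p.1.2), p.1.1) := rfl

theorem continuous_wig_coh_swap :
    Continuous (fun p : (R4 × R4) × R4 => wig L (coh L p.1.2) (coh L p.1.1) p.2) := by
  have h := Complex.continuous_conj.comp (continuous_wig_coh L)
  refine h.congr fun p => ?_
  rw [Function.comp_apply, conj_wig]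

/-- Integrating over `x` first, the orthogonality relations replace the two displaced parities by
overlaps of coherent states, and the remaining double integral is a resolution of the identity
around `T`. Hence `opSymbol` inverts quantization up to a constant. -/
theorem integral_opSymbol_mul_wig {T : L2 →L[ℂ] L2} {B : ℝ}
    (hK : ∀ p, ‖opKernel L T p‖ ≤ B * invPow 5 (p.1 - p.2)) (a b : R4) :
    cohKernel L (opSymbol L T) a b =
      wigConst L * ((frameConst L : ℂ) ^ 2 * opKernel L T (a, b)) := by
  let G : (R4 × R4) × R4 → ℂ := fun p => opKernel L T p.1 *
    (wig L (coh L p.1.2) (coh L p.1.1) p.2 * wig L (coh L a) (coh L b) p.2)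
  have hGc : Continuous G := by
    have h1 := (continuous_opKernel L T).comp (continuous_fst (X := R4 × R4) (Y := R4))
    have h2 := (continuous_wig L (coh L a) (coh L b)).comp
      (continuous_snd (X := R4 × R4) (Y := R4))
    exact h1.mul ((continuous_wig_coh_swap L).mul h2)
  have hG : Integrable G := by
    have h1 : Integrable (fun q : R4 × R4 => ‖wig L (coh L a) (coh L b) q.1‖ * invPow 5 q.2) :=
      (integrable_wig L _ _).norm.mul_prod integrable_invPow_five
    -- In the coordinates `(x, z - w, z)` the dominating function is integrable in the first two
    -- variables and a translate of a Gaussian in `z`.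
    have h2 := integrable_mul_shear (t := fun q : R4 × R4 => q.1 + (2⁻¹ : ℝ) • q.2)
      (by fun_prop) h1 ((phi L).integrable (μ := volume)).norm
    have h3 := ((integrable_comp_clequiv_iff differenceEquiv volume volume).2 h2).const_mul B
    refine h3.mono' hGc.aestronglyMeasurable (Eventually.of_forall fun p => ?_)
    simp only [G, norm_mul, norm_wig_coh_coh L p.1.2, differenceEquiv_apply]
    have e : p.1.1 - (p.2 + (2⁻¹ : ℝ) • (p.1.1 - p.1.2)) =
        -(p.2 - (2⁻¹ : ℝ) • (p.1.2 + p.1.1)) := by module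
    rw [e, phi_neg]
    calc _ ≤ B * invPow 5 (p.1.1 - p.1.2) * (‖phi L (p.2 - (2⁻¹ : ℝ) • (p.1.2 + p.1.1))‖ *
          ‖wig L (coh L a) (coh L b) p.2‖) :=
          mul_le_mul_of_nonneg_right (hK p.1) (by positivity)
      _ = _ := by ring
  have e1 : ∫ p, G p = wigConst L * ((frameConst L : ℂ) ^ 2 * opKernel L T (a, b)) := by
    rw [Measure.volume_eq_prod, integral_prod _ hG, opKernel, ← kernelForm_opKernel L hK
      integrable_invPow_five, kernelForm, ← integral_const_mul]
    refine integral_congr_ae (Eventually.of_forall fun p => ?_)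
    simp only [G]
    rw [integral_const_mul]
    simp_rw [mul_comm (wig L (coh L p.2) (coh L p.1) _)]
    rw [integral_wig_mul_wig]
    ring
  rw [← e1, Measure.volume_eq_prod, integral_prod_symm _ hG, cohKernel]
  refine integral_congr_ae (Eventually.of_forall fun x => ?_)
  simp only [G, opSymbol, ← integral_mul_const, mul_assoc]

/-- The linear change of variables `(c, d) ↦ (c + d / 2, c - d / 2)`. -/
def midpointEquiv : (R4 × R4) ≃L[ℝ] R4 × R4 :=
  ContinuousLinearEquiv.equivOfInverse
    ((ContinuousLinearMap.fst ℝ R4 R4 + (2⁻¹ : ℝ) • ContinuousLinearMap.snd ℝ R4 R4).prod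
      (ContinuousLinearMap.fst ℝ R4 R4 - (2⁻¹ : ℝ) • ContinuousLinearMap.snd ℝ R4 R4))
    (((2⁻¹ : ℝ) • (ContinuousLinearMap.fst ℝ R4 R4 + ContinuousLinearMap.snd ℝ R4 R4)).prod
      (ContinuousLinearMap.fst ℝ R4 R4 - ContinuousLinearMap.snd ℝ R4 R4))
    (fun p => by ext1 <;> simp <;> module) (fun p => by ext1 <;> simp <;> module)

theorem midpointEquiv_apply (p : R4 × R4) :
    midpointEquiv p = (p.1 + (2⁻¹ : ℝ) • p.2, p.1 - (2⁻¹ : ℝ) • p.2) := rfl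

/-- The variables are geometric: for outer points `z`, `w` and intermediate point `y`, `c` is the
midpoint of `z` and `w` minus `x`, `d = z - w` and `e = z - y`. The three phases add up to one
depending on `c`, `d`, `e` only. -/
theorem moyalIntegrand_eq (f g : R4 → ℂ) (x c d e : R4) :
    moyalIntegrand L f g x ((c, d), e) =
      cohKernel L f (x + (c + (2⁻¹ : ℝ) • d)) (x + (c + (2⁻¹ : ℝ) • d) - e) *
        cohKernel L g (x + (c + (2⁻¹ : ℝ) • d) - e) (x + (c - (2⁻¹ : ℝ) • d)) *
        wig L (coh L (x + (c - (2⁻¹ : ℝ) • d))) (coh L (x + (c + (2⁻¹ : ℝ) • d))) x := by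
  rw [cohKernel_eq, cohKernel_eq, wig_coh_coh, moyalIntegrand]
  have e1 : (2⁻¹ : ℝ) • (x + (c + (2⁻¹ : ℝ) • d) + (x + (c + (2⁻¹ : ℝ) • d) - e)) =
      x + (c + (2⁻¹ : ℝ) • (d - e)) := by module
  have e2 : x + (c + (2⁻¹ : ℝ) • d) - (x + (c + (2⁻¹ : ℝ) • d) - e) = e := by abel
  have e3 : (2⁻¹ : ℝ) • (x + (c + (2⁻¹ : ℝ) • d) - e + (x + (c - (2⁻¹ : ℝ) • d))) =
      x + (c - (2⁻¹ : ℝ) • e) := by module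
  have e4 : x + (c + (2⁻¹ : ℝ) • d) - e - (x + (c - (2⁻¹ : ℝ) • d)) = d - e := by module
  have e5 : x - (2⁻¹ : ℝ) • (x + (c - (2⁻¹ : ℝ) • d) + (x + (c + (2⁻¹ : ℝ) • d))) = -c := by
    module
  rw [e1, e2, e3, e4, e5, phi_neg]
  have hph : ∀ r s t u : ℝ, u = r + s + t → Complex.exp (Complex.I * (u : ℝ)) =
      Complex.exp (Complex.I * (r : ℝ)) * Complex.exp (Complex.I * (s : ℝ)) *
        Complex.exp (Complex.I * (t : ℝ)) := by
    rintro r s t u rfl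
    rw [← Complex.exp_add, ← Complex.exp_add]
    push_cast
    ring_nf
  simp only
  rw [hph (-(sform L (x + (c + (2⁻¹ : ℝ) • d)) (x + (c + (2⁻¹ : ℝ) • d) - e) / 2))
    (-(sform L (x + (c + (2⁻¹ : ℝ) • d) - e) (x + (c - (2⁻¹ : ℝ) • d)) / 2))
    (sform L x (x + (c - (2⁻¹ : ℝ) • d) - (x + (c + (2⁻¹ : ℝ) • d))) +
      sform L (x + (c - (2⁻¹ : ℝ) • d)) (x + (c + (2⁻¹ : ℝ) • d)) / 2)]
  · ring
  · simp only [sform_add_left, sform_add_right, sform_sub_left, sform_sub_right,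
      sform_smul_left, sform_smul_right, sform_self]
    rw [sform_swap L c x, sform_swap L d x, sform_swap L e x, sform_swap L d c, sform_swap L e c,
      sform_swap L e d]
    ring

/-- The composition of symbols is the symbol of the composition. -/
theorem exists_moyal_eq_opSymbol : ∃ C : ℝ, 0 < C ∧ ∀ {f g : R4 → ℂ} {S T : L2 →L[ℂ] L2},
    IsSymbol 0 f → IsSymbol 0 g → IsWig L f S → IsWig L g T →
      ∀ x, moyal L f g x = C * opSymbol L (S * T) x := by
  obtain ⟨c, hc, h⟩ := exists_integral_comp_clequiv midpointEquiv volume volume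
  refine ⟨c * frameConst L, mul_pos hc (frameConst_pos L), ?_⟩
  intro f g S T hf hg hS hT x
  let G : R4 × R4 → ℂ := fun p => frameConst L * (opKernel L (S * T) p *
    wig L (coh L p.2) (coh L p.1) x)
  -- Integrating over the intermediate point removes a resolution of the identity between `S` and
  -- `T`.
  have e1 : ∀ p : R4 × R4, ∫ e, moyalIntegrand L f g x (p, e) =
      G ((x, x) + midpointEquiv p) := by
    rintro ⟨c, d⟩
    simp only [moyalIntegrand_eq, G, midpointEquiv_apply, Prod.mk_add_mk]
    rw [integral_mul_const, integral_sub_left_eq_self (fun y =>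
      cohKernel L f (x + (c + (2⁻¹ : ℝ) • d)) y * cohKernel L g y (x + (c - (2⁻¹ : ℝ) • d))),
      ← mul_assoc, frameConst_mul_opKernel_mul]
    simp only [hS.opKernel_eq, hT.opKernel_eq]
  rw [moyal, Measure.volume_eq_prod, integral_prod _ (integrable_moyalIntegrand L hf hg x)]
  simp_rw [e1]
  rw [h (fun p => G ((x, x) + p)), integral_add_left_eq_self]
  simp only [G, integral_const_mul, opSymbol]
  push_cast
  ring

/-- The composed function is a bounded symbol, so it has an operator; the inversion formula shows
that its coherent matrix elements are a constant multiple of those of `S * T`. -/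
theorem exists_isWig_mul : ∃ C : ℂ, ∀ {f g : R4 → ℂ} {S T : L2 →L[ℂ] L2},
    IsSymbol 0 f → IsSymbol 0 g → IsWig L f S → IsWig L g T →
      IsWig L (fun x => C * moyal L f g x) (S * T) := by
  obtain ⟨c, hc, h⟩ := exists_moyal_eq_opSymbol L
  let D : ℂ := c * (wigConst L * (frameConst L : ℂ) ^ 2)
  have hD : D ≠ 0 := by
    have h1 := (wigConst_pos L).ne'
    have h2 := (frameConst_pos L).ne'
    have h3 := hc.ne'
    simp [D, h1, h2, h3]
  refine ⟨D⁻¹, ?_⟩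
  intro f g S T hf hg hS hT
  obtain ⟨B, hB, hSB⟩ := exists_norm_cohKernel_le L hf 10
  obtain ⟨B', hB', hTB⟩ := exists_norm_cohKernel_le L hg 10
  obtain ⟨C, hC⟩ := exists_norm_opKernel_mul_le L hB hB'
    (fun p => (congrArg norm (hS.opKernel_eq p)).trans_le (hSB p.1 p.2))
    (fun p => (congrArg norm (hT.opKernel_eq p)).trans_le (hTB p.1 p.2))
  have hm : IsSymbol 0 (moyal L f g) := by
    refine ⟨contDiff_moyal L hf hg, fun n => ?_⟩
    -- Bounded symbols are exactly the class with `m = ρ = 0`, to which the derivative estimate for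
    -- compositions applies.
    have hf' : f ∈ gammaClass 0 0 := ⟨hf.1, fun n => by simpa [wt_zero] using hf.2 n⟩
    have hg' : g ∈ gammaClass 0 0 := ⟨hg.1, fun n => by simpa [wt_zero] using hg.2 n⟩
    simpa using exists_norm_iteratedFDeriv_moyal_le L le_rfl n le_rfl le_rfl hf' hg'
  obtain ⟨R, hR⟩ := exists_isWig L hm
  have hRe : R = D • (S * T) := by
    refine ext_coh_coh L fun a b => ?_
    have h1 : cohKernel L (moyal L f g) a b = c * cohKernel L (opSymbol L (S * T)) a b := by
      simp only [cohKernel, h hf hg hS hT, mul_assoc, integral_const_mul]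
    have h2 := hR.opKernel_eq (a, b)
    rw [h1, integral_opSymbol_mul_wig L hC] at h2
    rw [smul_apply, inner_smul_right]
    refine h2.trans ?_
    simp only [opKernel, D]
    ring
  have := hR.smul D⁻¹
  rwa [hRe, smul_smul, inv_mul_cancel₀ hD, one_smul] at this

end

section

/-! ### Compact operators on Hilbert spaces -/

section Compact

variable {H : Type*} [NormedAddCommGroup H] [InnerProductSpace ℂ H]

/-- The operator `|x⟩⟨y|` of rank one. -/
def ketBra (x y : H) : H →L[ℂ] H := InnerProductSpace.rankOne ℂ x y

theorem ketBra_apply (x y u : H) : ketBra x y u = ⟪y, u⟫_ℂ • x := rfl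

theorem norm_ketBra (x y : H) : ‖ketBra x y‖ = ‖x‖ * ‖y‖ :=
  InnerProductSpace.norm_rankOne x y

theorem isCompactOperator_ketBra (x y : H) : IsCompactOperator (ketBra x y) := by
  rw [ketBra, InnerProductSpace.rankOne_def']
  have h : IsCompactOperator (innerSL ℂ y) := isCompactOperator_of_locallyCompactSpace_dom _
  exact h.clm_comp (ContinuousLinearMap.toSpanSingleton ℂ x)

theorem continuous_ketBra : Continuous fun p : H × H => ketBra p.1 p.2 :=
  (ContinuousLinearMap.smulRightL ℂ H H).continuous₂.comp
    (((innerSL ℂ (E := H)).continuous.comp continuous_snd).prodMk continuous_fst)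

theorem continuous_ketBra_prod {X : Type*} [TopologicalSpace X] {g : X → H} (hg : Continuous g) :
    Continuous fun p : X × X => ketBra (g p.1) (g p.2) :=
  continuous_ketBra.comp ((hg.comp continuous_fst).prodMk (hg.comp continuous_snd))

theorem ketBra_add_left (x x' y : H) : ketBra (x + x') y = ketBra x y + ketBra x' y := by
  ext u; simp [ketBra_apply]

theorem ketBra_add_right (x y y' : H) : ketBra x (y + y') = ketBra x y + ketBra x y' := by
  ext u; simp [ketBra_apply, add_smul]

theorem ketBra_smul_left (c : ℂ) (x y : H) : ketBra (c • x) y = c • ketBra x y := by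
  ext u
  simp only [ketBra_apply, smul_apply]
  exact smul_comm _ _ _

theorem ketBra_smul_right (c : ℂ) (x y : H) :
    ketBra x (c • y) = (starRingEnd ℂ) c • ketBra x y := by
  ext u
  simp only [ketBra_apply, smul_apply, inner_smul_left, mul_smul]

theorem ketBra_zero_left (y : H) : ketBra 0 y = 0 := by
  ext u; simp [ketBra_apply]

theorem ketBra_zero_right (x : H) : ketBra x 0 = 0 := by
  ext u; simp [ketBra_apply]

/-- The compact operators form a closed, hence complete, subspace, in which the Bochner integral can
be taken. -/
theorem isCompactOperator_integral [CompleteSpace H] {X : Type*} [MeasurableSpace X]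
    {μ : Measure X} {F : X → H →L[ℂ] H} (hF : Integrable F μ)
    (h : ∀ x, IsCompactOperator (F x)) : IsCompactOperator (∫ x, F x ∂μ : H →L[ℂ] H) := by
  let S := compactOperator (RingHom.id ℂ) H H
  have hS : IsClosed (S : Set (H →L[ℂ] H)) := isClosed_setOfPred_isCompactOperator
  have : CompleteSpace S := hS.completeSpace_coe
  let G : X → S := fun x => ⟨F x, h x⟩
  have hG : Integrable G μ := by
    refine Integrable.mono' hF.norm ?_ (Eventually.of_forall fun x => le_rfl)
    exact (Topology.IsEmbedding.subtypeVal.aestronglyMeasurable_comp_iff (f := G)).1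
      hF.aestronglyMeasurable
  have := S.subtypeL.integral_comp_comm hG
  have h2 : ∫ x, F x ∂μ = (∫ x, G x ∂μ : S) := this
  rw [h2]
  exact (∫ x, G x ∂μ : S).2

/-- A closed subspace containing the operators of rank one contains the compact operators. -/
theorem mem_of_isCompactOperator [CompleteSpace H] {M : Submodule ℂ (H →L[ℂ] H)}
    (hM : IsClosed (M : Set (H →L[ℂ] H))) (h : ∀ x y, ketBra x y ∈ M) {T : H →L[ℂ] H}
    (hT : IsCompactOperator T) : T ∈ M := by
  refine hM.closure_subset (Metric.mem_closure_iff.2 fun ε hε => ?_)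
  have hε2 : 0 < ε / 2 := by positivity
  have hc := IsCompactOperator.isCompact_closure_image_closedBall
    (f := (T : H →ₗ[ℂ] H)) hT 1
  obtain ⟨t, htf, ht⟩ := Metric.totallyBounded_iff.1 hc.totallyBounded _ hε2
  -- `t` is a finite `ε / 2`-net of the closed image of the unit ball. Projecting onto its span
  -- moves each image point no farther than its nearest net point.
  let U := Submodule.span ℂ t
  have : FiniteDimensional ℂ U := FiniteDimensional.span_of_finite ℂ htf
  refine ⟨U.starProjection ∘L T, ?_, ?_⟩
  · rw [(stdOrthonormalBasis ℂ U).starProjection_eq_sum_rankOne,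
      ContinuousLinearMap.finsetSum_comp]
    refine M.sum_mem fun i _ => ?_
    rw [InnerProductSpace.rankOne_comp]
    exact h _ _
  · rw [dist_eq_norm]
    refine lt_of_le_of_lt ?_ (half_lt_self hε)
    refine ContinuousLinearMap.opNorm_le_of_unit_norm hε2.le fun x hx => ?_
    have hTx : T x ∈ ⋃ y ∈ t, Metric.ball y (ε / 2) :=
      ht (subset_closure ⟨x, by simp [hx], rfl⟩)
    obtain ⟨y, hy, hxy⟩ := Set.mem_iUnion₂.1 hTx
    have hmin := Submodule.starProjection_minimal (U := U) (T x)
    rw [sub_apply, ContinuousLinearMap.comp_apply, hmin]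
    refine (ciInf_le ⟨0, ?_⟩ (⟨y, Submodule.subset_span hy⟩ : U)).trans ?_
    · rintro _ ⟨u, rfl⟩
      exact norm_nonneg _
    · exact (dist_eq_norm (T x) y ▸ hxy.le)

end Compact

/-! ### Compactness and density in the coherent state representation -/

section Coherent

variable (L : R4 ≃L[ℝ] R2 × R2)

theorem integrable_invPow_midpoint :
    Integrable (fun p : R4 × R4 => invPow 5 ((2⁻¹ : ℝ) • (p.1 + p.2)) * invPow 5 (p.1 - p.2)) :=
  (integrable_comp_clequiv_iff midpointEquiv.symm volume volume).2
    (integrable_invPow_five.mul_prod integrable_invPow_five)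

theorem continuous_ketBra_coh :
    Continuous (fun p : R4 × R4 => ketBra (toL2 (coh L p.1)) (toL2 (coh L p.2))) :=
  continuous_ketBra_prod (g := fun z => toL2 (coh L z)) (continuous_toL2_coh L)

/-- The part of the operator with symbol `f` localized near the origin of phase space. -/
theorem exists_compact_truncation {f : R4 → ℂ} (hf : IsSymbol 0 f) (R : ℝ) (hR : 0 ≤ R) :
    ∃ S : L2 →L[ℂ] L2, IsCompactOperator S ∧ ∀ φ ψ, ⟪φ, S ψ⟫_ℂ =
      kernelForm L ({p : R4 × R4 | ‖(2⁻¹ : ℝ) • (p.1 + p.2)‖ ≤ R}.indicator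
        fun p => cohKernel L f p.1 p.2) φ ψ := by
  obtain ⟨C, hC, h⟩ := exists_norm_cohKernel_le L hf 5
  let A : Set (R4 × R4) := {p | ‖(2⁻¹ : ℝ) • (p.1 + p.2)‖ ≤ R}
  have hA : MeasurableSet A := (isClosed_le (by fun_prop) continuous_const).measurableSet
  let F : R4 × R4 → L2 →L[ℂ] L2 := fun p =>
    cohKernel L f p.1 p.2 • ketBra (toL2 (coh L p.1)) (toL2 (coh L p.2))
  have hFc : Continuous F := (continuous_cohKernel L hf).smul (continuous_ketBra_coh L)
  have hF : IntegrableOn F A := by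
    refine Integrable.mono' (g := fun p : R4 × R4 => C * ((1 + R) ^ 5 * (‖toL2 gauss‖ *
      ‖toL2 gauss‖)) * (invPow 5 ((2⁻¹ : ℝ) • (p.1 + p.2)) * invPow 5 (p.1 - p.2)))
      (integrable_invPow_midpoint.const_mul _).integrableOn hFc.aestronglyMeasurable ?_
    refine (ae_restrict_iff' hA).2 (Eventually.of_forall fun p hp => ?_)
    simp only [F, norm_smul, norm_ketBra, norm_toL2_coh]
    -- On the cut-off region the midpoint weight is bounded below, so inserting it makes the
    -- off-diagonal bound integrable in both directions.
    have h1 : 1 ≤ (1 + R) ^ 5 * invPow 5 ((2⁻¹ : ℝ) • (p.1 + p.2)) := by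
      rw [invPow, ← div_eq_mul_inv, one_le_div (by positivity)]
      have h0 : 0 ≤ 1 + R := by linarith
      exact pow_le_pow_left₀ (by positivity) (add_le_add_right hp 1) 5
    have h2 := (invPow_pos 5 (p.1 - p.2)).le
    calc _ ≤ C * invPow 5 (p.1 - p.2) * (‖toL2 gauss‖ * ‖toL2 gauss‖) := by
          gcongr; exact h _ _
      _ ≤ C * invPow 5 (p.1 - p.2) * (‖toL2 gauss‖ * ‖toL2 gauss‖) *
          ((1 + R) ^ 5 * invPow 5 ((2⁻¹ : ℝ) • (p.1 + p.2))) :=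
          le_mul_of_one_le_right (by positivity) h1
      _ = _ := by ring
  have hFK : ∀ p, IsCompactOperator (F p) := fun p =>
    (isCompactOperator_ketBra (toL2 (coh L p.1)) (toL2 (coh L p.2))).smul
      (cohKernel L f p.1 p.2)
  refine ⟨∫ p in A, F p, isCompactOperator_integral hF hFK, fun φ ψ => ?_⟩
  rw [ContinuousLinearMap.integral_apply hF, ← integral_inner (hF.apply_continuousLinearMap ψ),
    ← integral_indicator hA, kernelForm]
  refine integral_congr_ae (Eventually.of_forall fun p => ?_)
  by_cases hp : p ∈ A
  · have hp' : p ∈ {p : R4 × R4 | ‖(2⁻¹ : ℝ) • (p.1 + p.2)‖ ≤ R} := hp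
    simp only [Set.indicator_of_mem hp, Set.indicator_of_mem hp', F, smul_apply,
      ketBra_apply, inner_smul_right]
    ring
  · have hp' : p ∉ {p : R4 × R4 | ‖(2⁻¹ : ℝ) • (p.1 + p.2)‖ ≤ R} := hp
    simp only [Set.indicator_of_notMem hp, Set.indicator_of_notMem hp', mul_zero, zero_mul]

/-- The kernel is at most `windowAvg` at the midpoint, hence uniformly small for distant midpoints.
The truncated operators are compact and converge in norm. -/
theorem isCompactOperator_of_isWig {f : R4 → ℂ} (hf : f ∈ kInftyClass) {T : L2 →L[ℂ] L2}
    (hT : IsWig L f T) : IsCompactOperator T := by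
  have hfs := IsSymbol.of_mem_kInftyClass hf
  obtain ⟨C, hC, h⟩ := exists_norm_cohKernel_le L hfs 10
  obtain ⟨C₅, hC₅, h₅⟩ := exists_norm_cohKernel_le L hfs 5
  have hκ : (frameConst L : ℂ) ^ 2 ≠ 0 := by
    exact_mod_cast (pow_pos (frameConst_pos L) 2).ne'
  set J := frameConst L * ∫ y : R4, invPow 5 y
  have hJ : 0 ≤ J := mul_nonneg (frameConst_pos L).le
    (integral_nonneg fun y => (invPow_pos 5 y).le)
  have hform : ∀ φ ψ, ⟪φ, ((frameConst L : ℂ) ^ 2 • T) ψ⟫_ℂ =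
      kernelForm L (fun p => cohKernel L f p.1 p.2) φ ψ := by
    intro φ ψ
    rw [smul_apply, inner_smul_right, ← kernelForm_opKernel L
      (fun p => (congrArg norm (hT.opKernel_eq p)).trans_le (h₅ p.1 p.2)) integrable_invPow_five,
      funext hT.opKernel_eq]
  suffices hmain : IsCompactOperator ((frameConst L : ℂ) ^ 2 • T) by
    have := hmain.smul ((frameConst L : ℂ) ^ 2)⁻¹
    have e : ((frameConst L : ℂ) ^ 2)⁻¹ • (((frameConst L : ℂ) ^ 2 • T : L2 →L[ℂ] L2) : L2 → L2) =
        T := by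
      ext1 ψ
      rw [Pi.smul_apply, smul_apply, inv_smul_smul₀ hκ]
    rwa [e] at this
  refine (isClosed_setOfPred_isCompactOperator (σ₁₂ := RingHom.id ℂ) (M₁ := L2)
    (M₂ := L2)).closure_subset (Metric.mem_closure_iff.2 fun ε hε => ?_)
  obtain ⟨δ, hδ, hδε⟩ : ∃ δ : ℝ, 0 < δ ∧ √(δ * C) * J < ε := by
    have hlim : Tendsto (fun δ : ℝ => √(δ * C) * J) (𝓝[>] 0) (𝓝 0) := by
      have : Continuous fun δ : ℝ => √(δ * C) * J := by fun_prop
      simpa using (this.tendsto 0).mono_left nhdsWithin_le_nhds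
    obtain ⟨δ, h1, h2⟩ := ((hlim.eventually (gt_mem_nhds hε)).and self_mem_nhdsWithin).exists
    exact ⟨δ, h2, h1⟩
  obtain ⟨R, hR0, hR⟩ : ∃ R : ℝ, 0 ≤ R ∧ ∀ c, R < ‖c‖ → windowAvg L f c ≤ δ := by
    have h1 := (tendsto_windowAvg L hf).eventually (gt_mem_nhds hδ)
    rw [← Metric.cobounded_eq_cocompact, ← comap_norm_atTop] at h1
    obtain ⟨R, hR⟩ := eventually_atTop.1 (eventually_comap.1 h1)
    exact ⟨max R 0, le_max_right _ _, fun c hc =>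
      (hR ‖c‖ ((le_max_left _ _).trans hc.le) c rfl).le⟩
  obtain ⟨S, hS, hSf⟩ := exists_compact_truncation L hfs R hR0
  refine ⟨S, hS, lt_of_le_of_lt ?_ hδε⟩
  let A : Set (R4 × R4) := {p | ‖(2⁻¹ : ℝ) • (p.1 + p.2)‖ ≤ R}
  have hA : MeasurableSet A := (isClosed_le (by fun_prop) continuous_const).measurableSet
  have hKc := (continuous_cohKernel L hfs).aestronglyMeasurable (μ := volume)
  rw [dist_eq_norm]
  refine norm_le_of_inner_eq_kernelForm L (K := Aᶜ.indicator fun p => cohKernel L f p.1 p.2)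
    (η := invPow 5) ?_ (Real.sqrt_nonneg _)
    integrable_invPow_five (fun y => (invPow_pos 5 y).le) fun φ ψ => ?_
  · intro p
    by_cases hp : p ∈ A
    · rw [Set.indicator_of_notMem (by simpa using hp), norm_zero]
      exact mul_nonneg (Real.sqrt_nonneg _) (invPow_pos _ _).le
    · rw [Set.indicator_of_mem (by simpa using hp)]
      have h1 : ‖cohKernel L f p.1 p.2‖ ≤ δ := by
        rw [norm_cohKernel]
        exact (norm_kern_le_windowAvg L _ _ _).trans (hR _ (not_le.1 hp))
      have h2 := h p.1 p.2
      have h3 := (invPow_pos 5 (p.1 - p.2)).le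
      rw [show (10 : ℕ) = 5 + 5 from rfl, invPow_add] at h2
      -- The uniform bound `δ` alone has no off-diagonal decay. Its geometric mean with the decay of
      -- order 10 is both small and of order 5, as the Schur test requires.
      refine le_of_sq_le_sq ?_ (mul_nonneg (Real.sqrt_nonneg _) h3)
      rw [mul_pow, Real.sq_sqrt (by positivity), sq]
      refine (mul_le_mul h1 h2 (norm_nonneg _) hδ.le).trans (le_of_eq ?_)
      ring
  · have hi : ∀ B : Set (R4 × R4), MeasurableSet B → Integrable (fun p : R4 × R4 =>
        ⟪φ, toL2 (coh L p.1)⟫_ℂ * B.indicator (fun p => cohKernel L f p.1 p.2) p *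
          ⟪toL2 (coh L p.2), ψ⟫_ℂ) := fun B hB =>
      integrable_kernelForm_integrand L (hKc.indicator hB) (B := C₅) (η := invPow 5)
        (fun p => (Set.indicator_le_self' (s := B) (f := fun p : R4 × R4 =>
          ‖cohKernel L f p.1 p.2‖) (fun _ _ => norm_nonneg _) p |>.trans' (by
            rw [← norm_indicator_eq_indicator_norm])).trans (h₅ _ _))
        integrable_invPow_five φ ψ
    rw [sub_apply, inner_sub_right, hform, hSf, kernelForm, kernelForm, kernelForm,
      sub_eq_iff_eq_add, ← integral_add (hi _ hA.compl) (hi _ hA)]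
    refine integral_congr_ae (Eventually.of_forall fun p => ?_)
    simp only
    rw [← add_mul, ← mul_add]
    congr 2
    exact (congrFun (Set.indicator_compl_add_self A
      fun p : R4 × R4 => cohKernel L f p.1 p.2) p).symm

/-! ### Density -/

theorem wig_coh_coh_mem_schwartzClass (z w : R4) :
    (fun x => wig L (coh L z) (coh L w) x) ∈ schwartzClass := by
  refine ⟨Complex.exp (Complex.I * (sform L z w / 2 : ℝ)) •
    SchwartzMap.smulLeftCLM ℂ
      (fun x : R4 => Complex.exp (Complex.I * (⟪sformVec L (z - w), x⟫_ℝ : ℝ)))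
      (SchwartzMap.compSubConstCLM ℂ ((2⁻¹ : ℝ) • (z + w)) (phi L)), ?_⟩
  ext x
  simp only [smul_apply, smul_eq_mul,
    SchwartzMap.smulLeftCLM_apply_apply (hasTemperateGrowth_cexp_inner _),
    SchwartzMap.compSubConstCLM_apply]
  rw [← mul_assoc, ← Complex.exp_add, wig_coh_coh, inner_sformVec]
  congr 2
  push_cast
  ring

/-- The orthogonality relations read with their second factor fixed: the symbol of |g_z⟩⟨g_w| is the
matrix element with the two states exchanged. -/
theorem isWig_ketBra (z w : R4) :
    IsWig L (fun x => (wigConst L : ℂ)⁻¹ * wig L (coh L w) (coh L z) x)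
      (ketBra (toL2 (coh L z)) (toL2 (coh L w))) := by
  intro φ ψ
  have hc : (wigConst L : ℂ) ≠ 0 := by exact_mod_cast (wigConst_pos L).ne'
  have h : ∫ x, (wigConst L : ℂ)⁻¹ * wig L (coh L w) (coh L z) x * wig L φ ψ x =
      (wigConst L : ℂ)⁻¹ * ∫ x, wig L φ ψ x * wig L (coh L w) (coh L z) x := by
    rw [← integral_const_mul]
    exact integral_congr_ae (Eventually.of_forall fun x => by ring)
  rw [h, integral_wig_mul_wig, inv_mul_cancel_left₀ hc, ketBra_apply,
    inner_smul_right, mul_comm]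

theorem topologicalClosure_span_coh :
    (Submodule.span ℂ (Set.range fun z => toL2 (coh L z))).topologicalClosure = ⊤ := by
  rw [Submodule.topologicalClosure_eq_top_iff, Submodule.eq_bot_iff]
  intro φ hφ
  refine ext_inner_coh L fun z => ?_
  rw [inner_zero_right]
  exact (Submodule.mem_orthogonal _ _).1 hφ _ (Submodule.subset_span ⟨z, rfl⟩)

/-- For a fixed second vector, the admissible first vectors form a closed subspace containing the
total set of coherent states; then the second vector is treated in the same way. -/
theorem ketBra_mem_of_coh {M : Submodule ℂ (L2 →L[ℂ] L2)}
    (hM : IsClosed (M : Set (L2 →L[ℂ] L2)))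
    (h : ∀ z w, ketBra (toL2 (coh L z)) (toL2 (coh L w)) ∈ M) (φ ψ : L2) :
    ketBra φ ψ ∈ M := by
  have hc := continuous_ketBra (H := L2)
  have h1 : ∀ φ w, ketBra φ (toL2 (coh L w)) ∈ M := by
    intro φ w
    let V : Submodule ℂ L2 :=
      { carrier := {φ | ketBra φ (toL2 (coh L w)) ∈ M}
        add_mem' := fun {a b} ha hb => by
          simp only [Set.mem_ofPred_eq, ketBra_add_left] at *
          exact M.add_mem ha hb
        zero_mem' := by simp [ketBra_zero_left]
        smul_mem' := fun c a ha => by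
          simp only [Set.mem_ofPred_eq, ketBra_smul_left] at *
          exact M.smul_mem c ha }
    have hV : IsClosed (V : Set L2) := hM.preimage (hc.comp (by fun_prop :
      Continuous fun φ : L2 => (φ, toL2 (coh L w))))
    have : (⊤ : Submodule ℂ L2) ≤ V := by
      rw [← topologicalClosure_span_coh L]
      refine Submodule.topologicalClosure_minimal _ (Submodule.span_le.2 ?_) hV
      rintro _ ⟨z, rfl⟩
      exact h z w
    exact this Submodule.mem_top
  let V : Submodule ℂ L2 :=
    { carrier := {ψ | ketBra φ ψ ∈ M}
      add_mem' := fun {a b} ha hb => by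
        simp only [Set.mem_ofPred_eq, ketBra_add_right] at *
        exact M.add_mem ha hb
      zero_mem' := by simp [ketBra_zero_right]
      smul_mem' := fun c a ha => by
        simp only [Set.mem_ofPred_eq, ketBra_smul_right] at *
        exact M.smul_mem _ ha }
  have hV : IsClosed (V : Set L2) := hM.preimage (hc.comp (by fun_prop :
    Continuous fun ψ : L2 => (φ, ψ)))
  have : (⊤ : Submodule ℂ L2) ≤ V := by
    rw [← topologicalClosure_span_coh L]
    refine Submodule.topologicalClosure_minimal _ (Submodule.span_le.2 ?_) hV
    rintro _ ⟨w, rfl⟩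
    exact h1 φ w
  exact this Submodule.mem_top

end Coherent

end

section

/-! ### Linear operations on symbols -/

theorem norm_iteratedFDeriv_const_mul {f : R4 → ℂ} (hf : ContDiff ℝ ∞ f) (a : ℂ) (n : ℕ)
    (x : R4) : ‖iteratedFDeriv ℝ n (fun x => a * f x) x‖ = ‖a‖ * ‖iteratedFDeriv ℝ n f x‖ := by
  have h := iteratedFDeriv_const_smul_apply (𝕜 := ℝ) (a := a) (i := n) (f := f) (x := x)
    (hf.of_le (by exact_mod_cast le_top)).contDiffAt
  rw [← norm_smul, ← h]
  rfl

theorem norm_iteratedFDeriv_add_le {f g : R4 → ℂ} (hf : ContDiff ℝ ∞ f) (hg : ContDiff ℝ ∞ g)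
    (n : ℕ) (x : R4) : ‖iteratedFDeriv ℝ n (fun x => f x + g x) x‖ ≤
      ‖iteratedFDeriv ℝ n f x‖ + ‖iteratedFDeriv ℝ n g x‖ := by
  have h := iteratedFDeriv_add_apply (𝕜 := ℝ) (i := n) (x := x)
    (hf.of_le (by exact_mod_cast le_top)).contDiffAt
    (hg.of_le (by exact_mod_cast le_top)).contDiffAt
  exact (congrArg norm h).le.trans (norm_add_le _ _)

theorem const_mul_mem_gammaClass {m ρ : ℝ} {f : R4 → ℂ} (hf : f ∈ gammaClass m ρ) (a : ℂ) :
    (fun x => a * f x) ∈ gammaClass m ρ := by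
  refine ⟨contDiff_const.mul hf.1, fun n => ?_⟩
  obtain ⟨C, hC⟩ := hf.2 n
  refine ⟨‖a‖ * C, fun x => ?_⟩
  rw [norm_iteratedFDeriv_const_mul hf.1, mul_assoc]
  exact mul_le_mul_of_nonneg_left (hC x) (norm_nonneg a)

theorem add_mem_gammaClass {m ρ : ℝ} {f g : R4 → ℂ} (hf : f ∈ gammaClass m ρ)
    (hg : g ∈ gammaClass m ρ) : (fun x => f x + g x) ∈ gammaClass m ρ := by
  refine ⟨hf.1.add hg.1, fun n => ?_⟩
  obtain ⟨C, hC⟩ := hf.2 n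
  obtain ⟨C', hC'⟩ := hg.2 n
  refine ⟨C + C', fun x => (norm_iteratedFDeriv_add_le hf.1 hg.1 n x).trans ?_⟩
  rw [add_mul]
  exact add_le_add (hC x) (hC' x)

theorem const_mul_mem_kInftyClass {f : R4 → ℂ} (hf : f ∈ kInftyClass) (a : ℂ) :
    (fun x => a * f x) ∈ kInftyClass := by
  refine ⟨contDiff_const.mul hf.1, fun n => ?_⟩
  simp_rw [norm_iteratedFDeriv_const_mul hf.1]
  simpa using (hf.2 n).const_mul ‖a‖

theorem add_mem_kInftyClass {f g : R4 → ℂ} (hf : f ∈ kInftyClass) (hg : g ∈ kInftyClass) :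
    (fun x => f x + g x) ∈ kInftyClass := by
  refine ⟨hf.1.add hg.1, fun n => ?_⟩
  refine squeeze_zero (fun _ => norm_nonneg _) (norm_iteratedFDeriv_add_le hf.1 hg.1 n) ?_
  simpa using (hf.2 n).add (hg.2 n)

theorem const_mul_mem_schwartzClass {f : R4 → ℂ} (hf : f ∈ schwartzClass) (a : ℂ) :
    (fun x => a * f x) ∈ schwartzClass := by
  obtain ⟨f, rfl⟩ := hf
  exact ⟨a • f, rfl⟩

theorem add_mem_schwartzClass {f g : R4 → ℂ} (hf : f ∈ schwartzClass) (hg : g ∈ schwartzClass) :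
    (fun x => f x + g x) ∈ schwartzClass := by
  obtain ⟨f, rfl⟩ := hf
  obtain ⟨g, rfl⟩ := hg
  exact ⟨f + g, rfl⟩

theorem IsSymbol.const_mul {m : ℝ} {f : R4 → ℂ} (hf : IsSymbol m f) (a : ℂ) :
    IsSymbol m (fun x => a * f x) := by
  refine ⟨contDiff_const.mul hf.1, fun n => ?_⟩
  obtain ⟨C, hC⟩ := hf.2 n
  refine ⟨‖a‖ * C, fun x => ?_⟩
  rw [norm_iteratedFDeriv_const_mul hf.1, mul_assoc]
  exact mul_le_mul_of_nonneg_left (hC x) (norm_nonneg a)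

/-! ### The Weyl operators of a symbol class -/

/-- The integrability clause is automatic: the symbol is bounded and the displaced parity matrix
elements are integrable. The normalization of Δ̂ is moved into the symbol. -/
theorem isWeylOperator_iff {θ₁₂ θ₃₄ : ℝ} {L : R4 ≃L[ℝ] R2 × R2} {c : ℂ}
    (hc : ∀ φ ψ x, deltaHat θ₁₂ θ₃₄ φ ψ x = c * wig L φ ψ x) {f : R4 → ℂ} (hf : IsSymbol 0 f)
    (T : L2 →L[ℂ] L2) :
    IsWeylOperator θ₁₂ θ₃₄ f T ↔ IsWig L (fun x => c * f x) T := by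
  have e : ∀ φ ψ, (fun x => f x * deltaHat θ₁₂ θ₃₄ φ ψ x) =
      fun x => c * f x * wig L φ ψ x := by
    intro φ ψ
    ext x
    rw [hc]
    ring
  unfold IsWeylOperator IsWig
  simp only [e]
  exact ⟨fun h φ ψ => (h φ ψ).2, fun h φ ψ =>
    ⟨integrable_mul_wig L (hf.const_mul c) φ ψ, h φ ψ⟩⟩

/-- The Weyl operators of a symbol class closed under composition form a dense algebra of compact
operators. -/
theorem weylImage_dense_subalgebra {θ₁₂ θ₃₄ : ℝ} (h₁₂ : θ₁₂ ≠ 0) (h₃₄ : θ₃₄ ≠ 0)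
    {F : Set (R4 → ℂ)} (hK : F ⊆ kInftyClass) (hS : schwartzClass ⊆ F)
    (hadd : ∀ f ∈ F, ∀ g ∈ F, (fun x => f x + g x) ∈ F)
    (hsmul : ∀ f ∈ F, ∀ a : ℂ, (fun x => a * f x) ∈ F)
    (hmul : ∀ f ∈ F, ∀ g ∈ F, moyal (phaseEquiv h₁₂ h₃₄) f g ∈ F) :
    (∀ f ∈ F, ∃! T, IsWeylOperator θ₁₂ θ₃₄ f T) ∧
      IsNormDenseSubalgebra (weylImage θ₁₂ θ₃₄ F) := by
  obtain ⟨c, hc0, hc⟩ := exists_deltaHat_eq_wig h₁₂ h₃₄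
  set L := phaseEquiv h₁₂ h₃₄
  have hc0' : (c : ℂ) ≠ 0 := by exact_mod_cast hc0.ne'
  have hsym : ∀ f ∈ F, IsSymbol 0 f := fun f hf => .of_mem_kInftyClass (hK hf)
  -- Closure of `F` under scalars makes the constant in Δ̂ irrelevant for the set of operators.
  have hmem : ∀ T, T ∈ weylImage θ₁₂ θ₃₄ F ↔ ∃ f ∈ F, IsWig L f T := by
    intro T
    constructor
    · rintro ⟨f, hf, hT⟩
      exact ⟨_, hsmul f hf c, (isWeylOperator_iff hc (hsym f hf) T).1 hT⟩
    · rintro ⟨f, hf, hT⟩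
      have hf' := hsmul f hf (c : ℂ)⁻¹
      refine ⟨_, hf', (isWeylOperator_iff hc (hsym _ hf') T).2 ?_⟩
      simpa only [mul_inv_cancel_left₀ hc0'] using hT
  have hzero : (0 : R4 → ℂ) ∈ F := hS ⟨0, rfl⟩
  obtain ⟨D, hD⟩ := exists_isWig_mul L
  let B : NonUnitalSubalgebra ℂ (L2 →L[ℂ] L2) :=
    { carrier := {T | ∃ f ∈ F, IsWig L f T}
      add_mem' := by
        rintro S T ⟨f, hf, hfS⟩ ⟨g, hg, hgT⟩
        exact ⟨_, hadd f hf g hg, hfS.add (hsym f hf) (hsym g hg) hgT⟩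
      zero_mem' := ⟨0, hzero, fun φ ψ => by simp⟩
      mul_mem' := by
        rintro S T ⟨f, hf, hfS⟩ ⟨g, hg, hgT⟩
        exact ⟨_, hsmul _ (hmul f hf g hg) D, hD (hsym f hf) (hsym g hg) hfS hgT⟩
      smul_mem' := by
        rintro a T ⟨f, hf, hfT⟩
        exact ⟨_, hsmul f hf a, hfT.smul a⟩ }
  have hB : (B : Set (L2 →L[ℂ] L2)) = weylImage θ₁₂ θ₃₄ F := by
    ext T
    exact (hmem T).symm
  refine ⟨fun f hf => ?_, ⟨B, hB⟩, ?_, ?_⟩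
  · obtain ⟨T, hT⟩ := exists_isWig L (hsym _ (hsmul f hf c))
    refine ⟨T, (isWeylOperator_iff hc (hsym f hf) T).2 hT, fun S hSf => ?_⟩
    exact ((isWeylOperator_iff hc (hsym f hf) S).1 hSf).unique hT
  · intro T hT
    obtain ⟨f, hf, hfT⟩ := (hmem T).1 hT
    exact isCompactOperator_of_isWig L (hK hf) hfT
  · intro T hT
    let M := B.toSubmodule.topologicalClosure
    have hM : IsClosed (M : Set (L2 →L[ℂ] L2)) := B.toSubmodule.isClosed_topologicalClosure
    have hket : ∀ z w, ketBra (toL2 (coh L z)) (toL2 (coh L w)) ∈ M := fun z w =>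
      B.toSubmodule.le_topologicalClosure
        ⟨_, hsmul _ (hS (wig_coh_coh_mem_schwartzClass L w z)) _, isWig_ketBra L z w⟩
    have := mem_of_isCompactOperator hM (ketBra_mem_of_coh L hM hket) hT
    rw [← hB]
    exact this

end

end WeylQuantization

end

theorem lemma1 (θ₁₂ θ₃₄ : ℝ) (h₁₂ : θ₁₂ ≠ 0) (h₃₄ : θ₃₄ ≠ 0) :
    ((∀ f ∈ WeylQuantization.schwartzClass,
        ∃! T, WeylQuantization.IsWeylOperator θ₁₂ θ₃₄ f T) ∧
      WeylQuantization.IsNormDenseSubalgebra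
        (WeylQuantization.weylImage θ₁₂ θ₃₄ WeylQuantization.schwartzClass)) ∧
    (∀ m ρ : ℝ, m < 0 → 0 < ρ → ρ ≤ 1 →
      (∀ f ∈ WeylQuantization.gammaClass m ρ,
        ∃! T, WeylQuantization.IsWeylOperator θ₁₂ θ₃₄ f T) ∧
      WeylQuantization.IsNormDenseSubalgebra
        (WeylQuantization.weylImage θ₁₂ θ₃₄ (WeylQuantization.gammaClass m ρ))) ∧
    ((∀ f ∈ WeylQuantization.kInftyClass,
        ∃! T, WeylQuantization.IsWeylOperator θ₁₂ θ₃₄ f T) ∧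
      WeylQuantization.IsNormDenseSubalgebra
        (WeylQuantization.weylImage θ₁₂ θ₃₄ WeylQuantization.kInftyClass)) := by
  have hSK : WeylQuantization.schwartzClass ⊆ WeylQuantization.kInftyClass :=
    -- Any negative order would serve as the intermediate class.
    (WeylQuantization.schwartzClass_subset_gammaClass (-1) 0).trans
      (WeylQuantization.gammaClass_subset_kInftyClass (by norm_num) le_rfl)
  refine ⟨?_, fun m ρ hm hρ _ => ?_, ?_⟩
  · exact WeylQuantization.weylImage_dense_subalgebra h₁₂ h₃₄ hSK subset_rfl
      (fun f hf g hg => WeylQuantization.add_mem_schwartzClass hf hg)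
      (fun f hf a => WeylQuantization.const_mul_mem_schwartzClass hf a)
      (fun f hf g hg => WeylQuantization.moyal_mem_schwartzClass _ hf hg)
  · exact WeylQuantization.weylImage_dense_subalgebra h₁₂ h₃₄
      (WeylQuantization.gammaClass_subset_kInftyClass hm hρ.le)
      (WeylQuantization.schwartzClass_subset_gammaClass m ρ)
      (fun f hf g hg => WeylQuantization.add_mem_gammaClass hf hg)
      (fun f hf a => WeylQuantization.const_mul_mem_gammaClass hf a)
      -- The composition has order `2m`, which is at most `m` because `m` is negative.
      (fun f hf g hg => WeylQuantization.gammaClass_mono (by linarith)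
        (WeylQuantization.moyal_mem_gammaClass _ hρ.le hm.le hm.le hf hg))
  · exact WeylQuantization.weylImage_dense_subalgebra h₁₂ h₃₄ subset_rfl hSK
      (fun f hf g hg => WeylQuantization.add_mem_kInftyClass hf hg)
      (fun f hf a => WeylQuantization.const_mul_mem_kInftyClass hf a)
      (fun f hf g hg => WeylQuantization.moyal_mem_kInftyClass _ hf hg)
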